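/- **Setting.** Let $\Lambda$ be a graph on a finite set $V$ of sites, and let $\Lambda'\supseteq\Lambda$ be a connected simple plane graph on the same sites, all of whose faces, except possibly the outer one, are triangles ($\Lambda'=\Lambda$ if $\Lambda$ is itself a triangulation; otherwise $\Lambda'$ is obtained from the planar graph $\Lambda$ by adding edges). Site $v$ carries a Hilbert space of finite dimension $d_v$, and $|\Psi\rangle$ is a normalized pure state of all sites that is *strictly local* with respect to $\Lambda$: whenever $X,Y\subseteq V$ are disjoint and no edge of $\Lambda$ joins $X$ to $Y$, the reduced state is $\rho^{XY}=\rho^X\otimes\rho^Y$. Let $V=A\sqcup B\sqcup C$, where $A$ and $C$ are nonempty and each induces a connected subgraph of $\Lambda'$. **Measurement of $B$.** Each site $i\in B$ of dimension $d_i$ is measured with a finite-outcome POVM $\{F_r\}$ that forms a 2-design, $$\frac1{d_i}\sum_r \operatorname{Tr}[F_r]\Big(\frac{F_r}{\operatorname{Tr}F_r}\Big)^{\otimes 2}=\frac{\mathbb I+\mathrm{SWAP}}{d_i(d_i+1)}$$ (outcomes with $F_r=0$ omitted). A joint outcome $s$ has Born probability $p_s$ and leaves $A$ in the state $\rho^A_s$.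 **Distillation on $A$.** Let $d_A=\prod_{v\in A}d_v$, $d'\ge1$, let $L_0:\mathbb C^{d'}\to\mathcal H_A$ be an isometry, and let $\{(q_k,U_k)\}_k$ be a finite ensemble of unitaries on $\mathcal H_A$ forming a unitary 2-design. With $L_k^\dagger=L_0^\dagger U_k$ put $$\mathcal T[\rho]=\frac{d_A}{d'}\sum_k q_k\,L_k^\dagger\rho L_k\otimes|k\rangle\langle k|_{M_A},\qquad \epsilon_s=\big\|\mathcal T[\rho^A_s]-\tfrac{\mathbb I_{d'}}{d'}\otimes \operatorname{Tr}_{A'}\mathcal T[\rho^A_s]\big\|_1,\qquad \overline\epsilon=\sum_s p_s\epsilon_s ,$$ where $A'$ is the $d'$-dimensional output and $\|\cdot\|_1$ is the trace norm. **Claim.** $$\overline\epsilon\;\le\;\sqrt{d'}\;\mathcal Z_{\rm SAW}\,f(\mathcal Z_{\rm SAW}),\qquad f(x)=\frac{e^x-1}{x},\qquad \mathcal Z_{\rm SAW}=\sum_{W\in{\rm SAW}(\Lambda'^*,A,C)}e^{-\frac12S^{(2)}_W}.$$ Here ${\rm SAW}(\Lambda'^*,A,C)$ is the set of self-avoiding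 walks $W$ on the dual lattice $\Lambda'^*$ that separate $A$ from $C$: a walk either begins and ends at the exterior of the system or is a closed loop, it visits no face and crosses no edge twice, it is identified with the set of edges of $\Lambda'$ that it crosses, and deleting those edges leaves no path from $A$ to $C$. The entropy across the cut is $S^{(2)}_W=-\log\operatorname{Tr}\big[(\rho^{T_W})^2\big]$, with $T_W$ the set of sites still connected to $C$ after the edges of $W$ are deleted and $\rho^{T_W}$ the reduced state of $|\Psi\rangle$. -/

import Mathlib

open scoped Kronecker ComplexOrder

noncomputable section

namespace MIE

/-! ### Plane graphs, triangulations, and self-avoiding walks on the dual lattice -/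

section Plane

variable {V : Type*} [Fintype V] [DecidableEq V]

/-- An embedding of a finite connected simple graph in the plane (equivalently the sphere), given
combinatorially: `rot` is the rotation system, which lists the darts (oriented edges) leaving each
vertex in cyclic order. The faces are the orbits of the face permutation, and the surface carrying
the embedding is the sphere exactly when Euler's formula `|V| - |E| + |F| = 2` holds. -/
structure PlaneEmbedding (G : SimpleGraph V) where
  connected : G.Connected
  /-- next dart around the same base point -/
  rot : Equiv.Perm G.Dart
  rot_fst : ∀ e, (rot e).fst = e.fst
  rot_sameCycle : ∀ e e' : G.Dart, e.fst = e'.fst → rot.SameCycle e e'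
  euler : Fintype.card V +
      Nat.card (Quotient (Equiv.Perm.SameCycle.setoid
        ((SimpleGraph.Dart.symm_involutive (G := G)).toPerm.trans rot))) =
    Nat.card G.edgeSet + 2

namespace PlaneEmbedding

variable {G : SimpleGraph V} (P : PlaneEmbedding G)

/-- The permutation sending a dart `u → v` to the next dart `v → w` along the same face. -/
def facePerm : Equiv.Perm G.Dart :=
  (SimpleGraph.Dart.symm_involutive (G := G)).toPerm.trans P.rot

/-- The faces, i.e. the vertices of the dual lattice. -/
def Face : Type _ := Quotient (Equiv.Perm.SameCycle.setoid P.facePerm)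

/-- The face on a fixed side of a dart; the face on the other side of the same edge
is `P.face e.symm`. -/
def face (e : G.Dart) : P.Face := Quotient.mk (Equiv.Perm.SameCycle.setoid P.facePerm) e

/-- All faces except possibly the distinguished (outer) one are triangles, so that the dual
lattice is 3-valent away from the vertex representing the exterior of the system. -/
def IsTriangulation (outer : P.Face) : Prop :=
  ∀ f : P.Face, f ≠ outer → {e : G.Dart | P.face e = f}.ncard = 3

/-- `W` is the set of edges crossed by a closed self-avoiding walk on the dual lattice. The walk
crosses the edges of the darts `w 0, …, w k`, passing from the face `P.face (w i)` to the face
`P.face (w i).symm = P.face (w (i + 1))` (indices are cyclic); it visits no face twice and crosses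
no edge twice. The exterior of the system is one of the faces, so a walk visiting it is the same
as an open self-avoiding walk in the bulk which begins and terminates at the boundary. A walk is
identified with the set of edges it crosses (no base point, no orientation). -/
def IsSAW (W : Finset (Sym2 V)) : Prop :=
  ∃ (k : ℕ) (w : Fin (k + 1) → G.Dart),
    (∀ i, P.face (w i).symm = P.face (w (i + 1))) ∧
    (Function.Injective fun i => P.face (w i)) ∧
    (Function.Injective fun i => (w i).edge) ∧
    W = Finset.univ.image fun i => (w i).edge

end PlaneEmbedding

/-- Cutting the edges in `W` leaves no path from `A` to `C`. -/
def Separates (G : SimpleGraph V) (W : Finset (Sym2 V)) (A C : Finset V) : Prop :=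
  ∀ a ∈ A, ∀ c ∈ C, ¬ (G.deleteEdges (W : Set (Sym2 V))).Reachable a c

open Classical in
/-- The sites on the `C`-side of the cut `W`. -/
def cSide (G : SimpleGraph V) (W : Finset (Sym2 V)) (C : Finset V) : Finset V :=
  Finset.univ.filter fun v => ∃ c ∈ C, (G.deleteEdges (W : Set (Sym2 V))).Reachable c v

open Classical in
/-- The self-avoiding walks on the dual lattice that separate `A` from `C`. -/
def PlaneEmbedding.saw {G : SimpleGraph V} (P : PlaneEmbedding G) (A C : Finset V) :
    Finset (Finset (Sym2 V)) :=
  Finset.univ.filter fun W => P.IsSAW W ∧ Separates G W A C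

end Plane

/-! ### States on a lattice of qudits -/

section States

variable {V : Type*} [Fintype V] [DecidableEq V] (d : V → ℕ)

/-- Computational basis configurations of the sites in `X`. -/
abbrev Conf (X : Finset V) : Type _ := (v : {v // v ∈ X}) → Fin (d v)

/-- Computational basis configurations of the whole system. -/
abbrev FullConf : Type _ := (v : V) → Fin (d v)

variable {d}

/-- The configuration of the whole system that agrees with `s` on `X` and with `r` off `X`. -/
def glue {X : Finset V} (s : Conf d X) (r : Conf d Xᶜ) : FullConf d :=
  fun v => if h : v ∈ X then s ⟨v, h⟩ else r ⟨v, Finset.mem_compl.mpr h⟩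

/-- Partial trace over all sites outside `X`. -/
def reduced (M : Matrix (FullConf d) (FullConf d) ℂ) (X : Finset V) :
    Matrix (Conf d X) (Conf d X) ℂ :=
  fun s t => ∑ r : Conf d Xᶜ, M (glue s r) (glue t r)

/-- The projector `|Ψ⟩⟨Ψ|`. -/
def pureState (Ψ : FullConf d → ℂ) : Matrix (FullConf d) (FullConf d) ℂ :=
  Matrix.vecMulVec Ψ (star Ψ)

/-- Strictly local correlations with respect to the graph `Λ`: regions `X`, `Y` with no edge
between them (they are screened by the remaining sites, which are traced out) are uncorrelated,
`ρ^{XY} = ρ^X ⊗ ρ^Y`. -/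
def StrictlyLocal (Λ : SimpleGraph V) (ρ : Matrix (FullConf d) (FullConf d) ℂ) : Prop :=
  ∀ X Y : Finset V, Disjoint X Y → (∀ x ∈ X, ∀ y ∈ Y, ¬ Λ.Adj x y) →
    ∀ s t : Conf d (X ∪ Y),
      reduced ρ (X ∪ Y) s t =
        reduced ρ X (fun v => s ⟨v, Finset.mem_union_left Y v.2⟩)
            (fun v => t ⟨v, Finset.mem_union_left Y v.2⟩) *
          reduced ρ Y (fun v => s ⟨v, Finset.mem_union_right X v.2⟩)
            (fun v => t ⟨v, Finset.mem_union_right X v.2⟩)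

/-- Rényi-2 entropy `-log Tr ρ²`. -/
def renyi2 {n : Type*} [Fintype n] (ρ : Matrix n n ℂ) : ℝ :=
  -Real.log ((ρ * ρ).trace.re)

/-- Tensor product of one operator per site. -/
def tensorOp (M : (v : V) → Matrix (Fin (d v)) (Fin (d v)) ℂ) :
    Matrix (FullConf d) (FullConf d) ℂ :=
  fun x y => ∏ v, M v (x v) (y v)

end States

/-! ### Trace norm, generalized measurements and designs -/

section Designs

/-- The trace norm `Tr √(XᴴX)`, i.e. the sum of the singular values. -/
def traceNorm {n : Type*} [Fintype n] [DecidableEq n] (X : Matrix n n ℂ) : ℝ :=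
  ∑ i, Real.sqrt ((Matrix.isHermitian_conjTranspose_mul_self X).eigenvalues i)

/-- A positive operator-valued measure with finitely many outcomes. -/
structure IsPOVM {n R : Type*} [Fintype n] [DecidableEq n] [Fintype R]
    (F : R → Matrix n n ℂ) : Prop where
  posSemidef : ∀ r, (F r).PosSemidef
  sum_eq_one : ∑ r, F r = 1

/-- The swap operator on two copies. -/
def swapOp (n : Type*) [DecidableEq n] : Matrix (n × n) (n × n) ℂ :=
  fun x y => if x.1 = y.2 ∧ x.2 = y.1 then 1 else 0

/-- The second moment `∑_r Tr[F_r] (F_r / Tr[F_r])^{⊗2}` of a POVM. -/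
def povmSecondMoment {n R : Type*} [Fintype n] [Fintype R] (F : R → Matrix n n ℂ) :
    Matrix (n × n) (n × n) ℂ :=
  ∑ r, (F r).trace • (((F r).trace⁻¹ • F r) ⊗ₖ ((F r).trace⁻¹ • F r))

/-- A POVM forms a 2-design if its normalized second moment equals the Haar average
`∫ (|φ⟩⟨φ|)^{⊗2} dφ = (1 + SWAP) / (n (n + 1))` over pure states. The weights `Tr[F_r]` sum to the
dimension, which is the reason for the factor on the left. -/
def IsTwoDesignPOVM {n R : Type*} [Fintype n] [DecidableEq n] [Fintype R]
    (F : R → Matrix n n ℂ) : Prop :=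
  (Fintype.card n : ℂ)⁻¹ • povmSecondMoment F =
    ((Fintype.card n : ℂ) * ((Fintype.card n : ℂ) + 1))⁻¹ • (1 + swapOp n)

/-- Projector onto the symmetric subspace of two copies. -/
def symProj (n : Type*) [DecidableEq n] : Matrix (n × n) (n × n) ℂ :=
  (2 : ℂ)⁻¹ • (1 + swapOp n)

/-- Projector onto the antisymmetric subspace of two copies. -/
def antiProj (n : Type*) [DecidableEq n] : Matrix (n × n) (n × n) ℂ :=
  (2 : ℂ)⁻¹ • (1 - swapOp n)

/-- The value of the Haar average `∫ (U ⊗ U) X (U ⊗ U)ᴴ dU` over the unitary group. -/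
def haarTwirl {n : Type*} [Fintype n] [DecidableEq n] (X : Matrix (n × n) (n × n) ℂ) :
    Matrix (n × n) (n × n) ℂ :=
  ((symProj n * X).trace / (symProj n).trace) • symProj n +
    ((antiProj n * X).trace / (antiProj n).trace) • antiProj n

/-- The unitaries `U k`, drawn with probabilities `p k`, form a unitary 2-design. -/
structure IsUnitaryTwoDesign {n K : Type*} [Fintype n] [DecidableEq n] [Fintype K]
    (p : K → ℝ) (U : K → Matrix n n ℂ) : Prop where
  nonneg : ∀ k, 0 ≤ p k
  sum_eq_one : ∑ k, p k = 1
  unitary : ∀ k, U k ∈ Matrix.unitaryGroup n ℂ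
  twirl : ∀ X : Matrix (n × n) (n × n) ℂ,
    ∑ k, (p k : ℂ) • ((U k ⊗ₖ U k) * X * (U k ⊗ₖ U k).conjTranspose) = haarTwirl X

/-- The distillation channel
`ρ ↦ (d_A / d') ∑_k p_k L_kᴴ ρ L_k ⊗ |k⟩⟨k|`, where `L_kᴴ = L₀ᴴ U_k`. -/
def distill {n K : Type*} [Fintype n] [DecidableEq n] [Fintype K] [DecidableEq K] {d' : ℕ}
    (L₀ : Matrix n (Fin d') ℂ) (p : K → ℝ) (U : K → Matrix n n ℂ) (ρ : Matrix n n ℂ) :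
    Matrix (Fin d' × K) (Fin d' × K) ℂ :=
  ((Fintype.card n : ℂ) / (d' : ℂ)) •
    ∑ k, (p k : ℂ) • ((L₀.conjTranspose * U k * ρ * (L₀.conjTranspose * U k).conjTranspose) ⊗ₖ
      Matrix.single k k (1 : ℂ))

/-- The reduced state of the classical register `M_A`. -/
def registerState {K : Type*} {d' : ℕ} (Y : Matrix (Fin d' × K) (Fin d' × K) ℂ) : Matrix K K ℂ :=
  fun k l => ∑ i, Y (i, k) (i, l)

/-- The distillation error of the state `ρ` on `A`:
`‖ρ^{A'M_A} - π^{A'} ⊗ ρ^{M_A}‖₁` with `ρ^{A'M_A}` the output of the distillation channel. -/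
def distillError {n K : Type*} [Fintype n] [DecidableEq n] [Fintype K] [DecidableEq K] {d' : ℕ}
    (L₀ : Matrix n (Fin d') ℂ) (p : K → ℝ) (U : K → Matrix n n ℂ) (ρ : Matrix n n ℂ) : ℝ :=
  traceNorm (distill L₀ p U ρ -
    ((d' : ℂ)⁻¹ • (1 : Matrix (Fin d') (Fin d') ℂ)) ⊗ₖ registerState (distill L₀ p U ρ))

end Designs

/-! ### Measuring the region `B` and distilling from `A` -/

section Protocol

variable {V : Type*} [Fintype V] [DecidableEq V] {d : V → ℕ} {R : V → Type*}

/-- The region `B` of measured sites: all sites outside `A` and `C`. -/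
abbrev bulk (A C : Finset V) : Finset V := (A ∪ C)ᶜ

/-- Joint measurement outcomes on `B`. -/
abbrev Outcome (R : V → Type*) (A C : Finset V) : Type _ := (v : {v // v ∈ bulk A C}) → R v

/-- The subnormalized state `Tr_{BC}[(F_s ⊗ 1_{AC}) |Ψ⟩⟨Ψ|]` of `A` after outcome `s` on `B`. -/
def postMeas (Ψ : FullConf d → ℂ) (F : (v : V) → R v → Matrix (Fin (d v)) (Fin (d v)) ℂ)
    (A C : Finset V) (s : Outcome R A C) : Matrix (Conf d A) (Conf d A) ℂ :=
  reduced (tensorOp (fun v => if h : v ∈ bulk A C then F v (s ⟨v, h⟩) else 1) * pureState Ψ) A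

/-- Born probability of the outcome `s`. -/
def outcomeProb (Ψ : FullConf d → ℂ) (F : (v : V) → R v → Matrix (Fin (d v)) (Fin (d v)) ℂ)
    (A C : Finset V) (s : Outcome R A C) : ℝ :=
  (postMeas Ψ F A C s).trace.re

/-- The normalized post-measurement state of `A` given the outcome `s`. -/
def condState (Ψ : FullConf d → ℂ) (F : (v : V) → R v → Matrix (Fin (d v)) (Fin (d v)) ℂ)
    (A C : Finset V) (s : Outcome R A C) : Matrix (Conf d A) (Conf d A) ℂ :=
  ((outcomeProb Ψ F A C s : ℂ))⁻¹ • postMeas Ψ F A C s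

/-- The average distillation error `ε̄ = ∑_s p_s ε_s`. -/
def avgError [∀ v, Fintype (R v)] {K : Type*} [Fintype K] [DecidableEq K] {d' : ℕ}
    (Ψ : FullConf d → ℂ) (F : (v : V) → R v → Matrix (Fin (d v)) (Fin (d v)) ℂ)
    (A C : Finset V) (L₀ : Matrix (Conf d A) (Fin d') ℂ) (p : K → ℝ)
    (U : K → Matrix (Conf d A) (Conf d A) ℂ) : ℝ :=
  ∑ s : Outcome R A C, outcomeProb Ψ F A C s * distillError L₀ p U (condState Ψ F A C s)

/-- Boltzmann exponent `H[W] = S⁽²⁾_W / 2`, with `S⁽²⁾_W` the Rényi-2 entropy of the pre-measurement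
state across the cut `W`, i.e. of its reduced state on the `C`-side of `W`. -/
def cutEnergy (G : SimpleGraph V) (Ψ : FullConf d → ℂ) (C : Finset V) (W : Finset (Sym2 V)) : ℝ :=
  (1 / 2) * renyi2 (reduced (pureState Ψ) (cSide G W C))

/-- The partition function of self-avoiding walks on the dual lattice separating `A` from `C`. -/
def zSAW {G : SimpleGraph V} (P : PlaneEmbedding G) (Ψ : FullConf d → ℂ) (A C : Finset V) : ℝ :=
  ∑ W ∈ P.saw A C, Real.exp (-cutEnergy G Ψ C W)

end Protocol

/-- `f(x) = (eˣ - 1) / x`. -/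
def f (x : ℝ) : ℝ := (Real.exp x - 1) / x

end MIE

end

noncomputable section

set_option linter.unusedSectionVars false

namespace MIE

/-! ### Edge cuts of plane graphs and closed walks on the dual lattice -/

section GraphLemmas

/-! The distillation error is governed by the Hilbert-Schmidt norm of the unnormalized state of `A`
after the measurement. By trace-norm duality, Cauchy-Schwarz and the second moment of the unitary
design, each error is at most `√d'` times that norm (`distillError_le`). The Born weight cancels the
normalization, so it remains to bound `phi`, the sum of these norms over all outcomes
(`avgError_le_phi`).

Write each POVM element on the measured region as a multiple of the identity plus a traceless part
and expand, with `D` the set of averaged sites. For each `D` some connected set `S ⊇ A` with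
connected complement containing `C` has its outer boundary layer averaged and its inner layer, apart
from `A`, traceless (`exists_cutSet`). Let `T` range over the sets of cuts that fit `D`. Since the
family of fitting cuts is nonempty, the signs `(-1)^|T|` cancel, and the term `T = ∅`, which is the
original operator, is bounded by the terms with `T ≠ ∅` (`nrm_le_sum`).

Only families `T` whose layers do not conflict survive, and in a triangulation these are nested
(`cutSets_nested`), because the outer layer of a cut is connected there. An averaged layer is traced
out, so strict locality factorizes the sum over outcomes across it (`phi_eq_mul`). In the factor
that belongs to `S`, the 2-design property lets the traceless inner layer be replaced by unmeasured
sites (`phi_le_insert`). The sites still measured inside `S` are then uncorrelated with `Sᶜ`. Their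
outcomes leave the state of `Sᶜ` unchanged, and purity of the global state bounds the factor by the
Hilbert-Schmidt norm of the reduced state on `Sᶜ` (`nrm_le`), which is `exp(-S⁽²⁾/2)`. Hence `T`
contributes at most the product of its Boltzmann weights (`phi_le_prod`), and the sum over `T ≠ ∅`
is at most `exp(∑ weights) - 1`.

Finally, each such `S` is determined by its edge cut, and on a plane graph that edge cut is one
closed self-avoiding walk on the dual lattice (`exists_closed_walk`), so the sum of weights is at
most the partition function. -/

theorem eq_of_reachable {W α : Type*} {H : SimpleGraph W} (g : W → α)
    (h : ∀ u v, H.Adj u v → g u = g v) {u v : W} (r : H.Reachable u v) : g u = g v := by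
  obtain ⟨p⟩ := r
  induction p with
  | nil => rfl
  | cons ha _ ih => exact (h _ _ ha).trans ih

theorem eq_on_of_induce_preconnected {V α : Type*} {G : SimpleGraph V} {S : Set V}
    (hS : (G.induce S).Preconnected) (g : V → α)
    (h : ∀ u ∈ S, ∀ v ∈ S, G.Adj u v → g u = g v) :
    ∀ u ∈ S, ∀ v ∈ S, g u = g v := by
  intro u hu v hv
  exact eq_of_reachable (H := G.induce S) (fun x => g x.1)
    (fun a b hab => h a.1 a.2 b.1 b.2 hab) (hS ⟨u, hu⟩ ⟨v, hv⟩)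

theorem eq_of_sameCycle {X α : Type*} {σ : Equiv.Perm X} (g : X → α) (h : ∀ x, g (σ x) = g x)
    {x y : X} (hxy : σ.SameCycle x y) : g x = g y := by
  obtain ⟨i, rfl⟩ := hxy
  have key : ∀ (n : ℕ) (z : X), g ((σ ^ n) z) = g z := by
    intro n
    induction n with
    | zero => intro z; simp
    | succ n ih => intro z; rw [pow_succ', Equiv.Perm.mul_apply, h, ih]
  cases i with
  | ofNat n => simpa using (key n x).symm
  | negSucc n =>
    have := key (n + 1) ((σ ^ (Int.negSucc n)) x)
    rw [← this, zpow_negSucc, ← Equiv.Perm.mul_apply, mul_inv_cancel, Equiv.Perm.one_apply]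

end GraphLemmas

/-! ### Faces, darts and homology mod 2 of a plane graph. -/

namespace PlaneEmbedding

variable {V : Type*} [Fintype V] [DecidableEq V] {G : SimpleGraph V} (P : PlaneEmbedding G)

theorem facePerm_apply (e : G.Dart) : P.facePerm e = P.rot e.symm := rfl

theorem facePerm_fst (e : G.Dart) : (P.facePerm e).fst = e.snd := by
  rw [facePerm_apply, P.rot_fst]; rfl

theorem face_facePerm (e : G.Dart) : P.face (P.facePerm e) = P.face e :=
  Quotient.sound (s := Equiv.Perm.SameCycle.setoid P.facePerm)
    ((Equiv.Perm.sameCycle_apply_left).2 (Equiv.Perm.SameCycle.refl _ _))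

theorem sameCycle_of_face_eq {e e' : G.Dart} (h : P.face e = P.face e') :
    P.facePerm.SameCycle e e' :=
  Quotient.exact (s := Equiv.Perm.SameCycle.setoid P.facePerm) h

theorem face_surjective : Function.Surjective P.face := fun f => by
  obtain ⟨e, he⟩ := Quotient.exists_rep f
  exact ⟨e, he⟩

instance finite_dart : Finite G.Dart :=
  Finite.of_injective _ SimpleGraph.Dart.toProd_injective

instance finite_face : Finite P.Face := Finite.of_surjective P.face P.face_surjective

/-- The dual graph is connected: a function on the faces that takes the same value on both sides
of each edge is constant. -/
theorem eq_of_dual {α : Type*} (h : P.Face → α) (hh : ∀ e, h (P.face e) = h (P.face e.symm))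
    (f f' : P.Face) : h f = h f' := by
  obtain ⟨e, rfl⟩ := P.face_surjective f
  obtain ⟨e', rfl⟩ := P.face_surjective f'
  -- Turning to the next dart at a vertex moves to the face across one edge, so all faces around a
  -- vertex carry the same value; connectedness of `G` then spreads it.
  have hrot : ∀ x, h (P.face (P.rot x)) = h (P.face x) := by
    intro x
    have h1 : P.rot x = P.facePerm x.symm := by rw [facePerm_apply, SimpleGraph.Dart.symm_symm]
    rw [h1, face_facePerm, ← hh]
  have hbase : ∀ x y : G.Dart, x.fst = y.fst → h (P.face x) = h (P.face y) := fun x y hxy =>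
    eq_of_sameCycle (fun z => h (P.face z)) hrot (P.rot_sameCycle x y hxy)
  have key : (∀ x : G.Dart, x.fst = e.fst → h (P.face x) = h (P.face e)) =
      (∀ x : G.Dart, x.fst = e'.fst → h (P.face x) = h (P.face e)) := by
    refine eq_of_reachable (fun u => ∀ x : G.Dart, x.fst = u → h (P.face x) = h (P.face e)) ?_
      (P.connected.preconnected e.fst e'.fst)
    have one : ∀ u v, G.Adj u v → (∀ x : G.Dart, x.fst = u → h (P.face x) = h (P.face e)) →
        ∀ x : G.Dart, x.fst = v → h (P.face x) = h (P.face e) := by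
      intro u v huv H x hx
      have h1 := H ⟨(u, v), huv⟩ rfl
      rw [hh] at h1
      rw [← h1]
      exact hbase _ _ hx
    intro u v huv
    exact propext ⟨one u v huv, one v u huv.symm⟩
  exact (key.mp (fun x hx => hbase _ _ hx) e' rfl).symm

theorem exists_dart (e : G.edgeSet) : ∃ d : G.Dart, d.edge = e.1 := by
  obtain ⟨e, he⟩ := e
  induction e with
  | _ u v => exact ⟨⟨(u, v), he⟩, rfl⟩

/-- An arbitrary orientation of each edge. -/
def orient (e : G.edgeSet) : G.Dart := (exists_dart e).choose

theorem orient_edge (e : G.edgeSet) : (orient e).edge = e.1 := (exists_dart e).choose_spec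

theorem eq_orient (d : G.Dart) (e : G.edgeSet) (h : d.edge = e.1) :
    d = orient e ∨ d = (orient e).symm :=
  (SimpleGraph.dart_edge_eq_iff _ _).1 (h.trans (orient_edge e).symm)

theorem sum_dart_eq [Fintype G.Dart] [Fintype G.edgeSet] {M : Type*} [AddCommMonoid M]
    (F : G.Dart → M) : ∑ d, F d = ∑ e : G.edgeSet, (F (orient e) + F (orient e).symm) := by
  classical
  rw [← Finset.sum_fiberwise_of_maps_to (s := Finset.univ) (t := Finset.univ)
    (g := fun d : G.Dart => (⟨d.edge, d.edge_mem⟩ : G.edgeSet)) (fun _ _ => Finset.mem_univ _)]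
  refine Finset.sum_congr rfl fun e _ => ?_
  have : (Finset.univ.filter fun d : G.Dart => (⟨d.edge, d.edge_mem⟩ : G.edgeSet) = e) =
      {orient e, (orient e).symm} := by
    ext d
    simp only [Finset.mem_filter, Finset.mem_univ, true_and, Finset.mem_insert,
      Finset.mem_singleton]
    constructor
    · intro h
      exact eq_orient d e (by rw [← h])
    · rintro (rfl | rfl)
      · exact Subtype.ext (orient_edge e)
      · exact Subtype.ext ((SimpleGraph.Dart.edge_symm _).trans (orient_edge e))
  rw [this, Finset.sum_pair (SimpleGraph.Dart.symm_ne _).symm]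

theorem zmod_two_add_self (x : ZMod 2) : x + x = 0 := CharTwo.add_self_eq_zero x

/-- The kernel lies in the line of constant functions, and rank-nullity does the rest. This serves
both the graph and its dual. -/
theorem finrank_ker_le_one {X E : Type*} [Fintype X] [Fintype E] (M : Matrix E X (ZMod 2))
    (h : ∀ g, M.mulVec g = 0 → ∀ x y, g x = g y) : Fintype.card X ≤ M.rank + 1 := by
  have h1 := LinearMap.finrank_range_add_finrank_ker M.mulVecLin
  have h2 : LinearMap.ker M.mulVecLin ≤ Submodule.span (ZMod 2) {fun _ : X => (1 : ZMod 2)} := by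
    intro g hg
    have hc := h g (by simpa using hg)
    rw [Submodule.mem_span_singleton]
    rcases isEmpty_or_nonempty X with hX | ⟨⟨x⟩⟩
    · exact ⟨0, Subsingleton.elim _ _⟩
    · exact ⟨g x, funext fun y => by simp [hc x y]⟩
  have h3 := (Submodule.finrank_mono h2).trans
    (finrank_span_le_card (R := ZMod 2) {fun _ : X => (1 : ZMod 2)})
  simp only [Set.toFinset_singleton, Finset.card_singleton] at h3
  rw [Module.finrank_fintype_fun_eq_card] at h1
  have h4 : M.rank = Module.finrank (ZMod 2) (LinearMap.range M.mulVecLin) := rfl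
  omega

/-- On a plane graph, an edge set that is orthogonal to all face boundaries of the dual lattice is
a cut. -/
theorem exists_coboundary [Fintype G.edgeSet] (x : G.edgeSet → ZMod 2)
    (hx : ∀ h : P.Face → ZMod 2,
      ∑ e, x e * (h (P.face (orient e)) + h (P.face (orient e).symm)) = 0) :
    ∃ g : V → ZMod 2, ∀ e, x e = g (orient e).fst + g (orient e).snd := by
  classical
  have : Fintype P.Face := Fintype.ofFinite _
  have : Fintype G.Dart := Fintype.ofFinite _
  -- `δ` and `b` are the coboundary maps of the graph and of its dual. Over `ZMod 2` the arbitrary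
  -- orientation of the edges does not matter.
  let δ : Matrix G.edgeSet V (ZMod 2) := Matrix.of fun e v =>
    (if (orient e).fst = v then 1 else 0) + (if (orient e).snd = v then 1 else 0)
  let b : Matrix G.edgeSet P.Face (ZMod 2) := Matrix.of fun e f =>
    (if P.face (orient e) = f then 1 else 0) + (if P.face (orient e).symm = f then 1 else 0)
  have hδ : ∀ g e, δ.mulVec g e = g (orient e).fst + g (orient e).snd := by
    intro g e
    simp [δ, Matrix.mulVec, dotProduct, add_mul, Finset.sum_add_distrib]
  have hb : ∀ g e, b.mulVec g e = g (P.face (orient e)) + g (P.face (orient e).symm) := by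
    intro g e
    simp [b, Matrix.mulVec, dotProduct, add_mul, Finset.sum_add_distrib]
  have rδ : Fintype.card V ≤ δ.rank + 1 := by
    refine finrank_ker_le_one δ fun g hg u v => ?_
    refine eq_of_reachable g ?_ (P.connected.preconnected u v)
    intro u v huv
    have h1 := congrFun hg (⟨s(u, v), huv⟩ : G.edgeSet)
    rw [hδ, Pi.zero_apply, CharTwo.add_eq_zero] at h1
    rcases eq_orient ⟨(u, v), huv⟩ (⟨s(u, v), huv⟩ : G.edgeSet) rfl with h2 | h2
    · rw [← h2] at h1; exact h1
    · rw [← SimpleGraph.Dart.symm_symm (orient _), ← h2] at h1; exact h1.symm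
  have rb : Fintype.card P.Face ≤ b.rank + 1 := by
    refine finrank_ker_le_one b fun g hg => P.eq_of_dual g fun d => ?_
    have h1 := congrFun hg (⟨d.edge, d.edge_mem⟩ : G.edgeSet)
    rw [hb, Pi.zero_apply, CharTwo.add_eq_zero] at h1
    rcases eq_orient d (⟨d.edge, d.edge_mem⟩ : G.edgeSet) rfl with h2 | h2
    · rw [h2]; exact h1
    · rw [h2, SimpleGraph.Dart.symm_symm]; exact h1.symm
  -- Summed over darts, `g` at the head of a dart equals `g` at the tail of the next dart along the
  -- same face, so the two halves of the sum cancel mod 2.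
  have horth : ∀ (g : V → ZMod 2) (h : P.Face → ZMod 2), ∑ e, δ.mulVec g e * b.mulVec h e = 0 := by
    intro g h
    have h1 : ∑ d : G.Dart, (g d.fst + g d.snd) * h (P.face d) =
        ∑ e, δ.mulVec g e * b.mulVec h e := by
      rw [sum_dart_eq]
      refine Finset.sum_congr rfl fun e _ => ?_
      rw [hδ, hb, mul_add]
      congr 1
      show (g (orient e).snd + g (orient e).fst) * _ = _
      rw [add_comm]
    have h2 : ∑ d : G.Dart, g d.snd * h (P.face d) = ∑ d : G.Dart, g d.fst * h (P.face d) := by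
      rw [← Equiv.sum_comp P.facePerm (fun d => g d.fst * h (P.face d))]
      simp only [facePerm_fst, face_facePerm]
    rw [← h1]
    simp only [add_mul, Finset.sum_add_distrib, h2]
    exact zmod_two_add_self _
  have heuler : Fintype.card V + Fintype.card P.Face = Fintype.card G.edgeSet + 2 := by
    have := P.euler
    rw [Nat.card_eq_fintype_card (α := G.edgeSet)] at this
    rw [← this, ← Nat.card_eq_fintype_card (α := P.Face)]
    rfl
  have hle : LinearMap.range δ.mulVecLin ≤ LinearMap.ker b.transpose.mulVecLin := by
    rintro _ ⟨g, rfl⟩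
    rw [LinearMap.mem_ker, Matrix.mulVecLin_apply, Matrix.mulVecLin_apply]
    refine dotProduct_eq_zero _ fun h => ?_
    rw [Matrix.mulVec_transpose, ← Matrix.dotProduct_mulVec]
    exact horth g h
  -- Vanishing of the first cohomology: the kernel has dimension `|E| - rank b ≤ |E| - |F| + 1`,
  -- which Euler's formula turns into `|V| - 1 ≤ rank δ`.
  have heq : LinearMap.range δ.mulVecLin = LinearMap.ker b.transpose.mulVecLin := by
    refine Submodule.eq_of_le_of_finrank_le hle ?_
    have h1 := LinearMap.finrank_range_add_finrank_ker b.transpose.mulVecLin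
    have h2 : b.transpose.rank =
        Module.finrank (ZMod 2) (LinearMap.range b.transpose.mulVecLin) := rfl
    have h3 : δ.rank = Module.finrank (ZMod 2) (LinearMap.range δ.mulVecLin) := rfl
    rw [Matrix.rank_transpose] at h2
    rw [Module.finrank_fintype_fun_eq_card] at h1
    omega
  have hxk : x ∈ LinearMap.ker b.transpose.mulVecLin := by
    rw [LinearMap.mem_ker, Matrix.mulVecLin_apply]
    refine dotProduct_eq_zero _ fun h => ?_
    rw [Matrix.mulVec_transpose, ← Matrix.dotProduct_mulVec, ← hx h]
    exact Finset.sum_congr rfl fun e _ => by rw [hb]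
  rw [← heq] at hxk
  obtain ⟨g, hg⟩ := hxk
  exact ⟨g, fun e => by rw [← hg]; exact hδ g e⟩

end PlaneEmbedding

/-! ### Edge cuts as closed walks on the dual lattice. -/

section Cuts

variable {V : Type*} [Fintype V] [DecidableEq V] {G : SimpleGraph V}

/-- A dart with exactly one end in `S`. -/
def Crosses (S : Finset V) (d : G.Dart) : Prop := ¬ (d.fst ∈ S ↔ d.snd ∈ S)

theorem crosses_symm {S : Finset V} {d : G.Dart} : Crosses S d.symm ↔ Crosses S d := by
  show ¬ (d.snd ∈ S ↔ d.fst ∈ S) ↔ _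
  unfold Crosses
  tauto

theorem crosses_of_edge_eq {S : Finset V} {d d' : G.Dart} (h : d.edge = d'.edge) :
    Crosses S d ↔ Crosses S d' := by
  rcases (SimpleGraph.dart_edge_eq_iff _ _).1 h with rfl | rfl
  · rfl
  · exact crosses_symm

/-- The end of a crossing dart outside `S`. -/
def outEnd (S : Finset V) (d : G.Dart) : V := if d.fst ∈ S then d.snd else d.fst

theorem outEnd_symm {S : Finset V} {d : G.Dart} (h : Crosses S d) :
    outEnd S d.symm = outEnd S d := by
  unfold Crosses at h
  show (if d.snd ∈ S then d.fst else d.snd) = if d.fst ∈ S then d.snd else d.fst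
  split_ifs <;> first | rfl | (exfalso; tauto)

theorem outEnd_of_edge_eq {S : Finset V} {d d' : G.Dart} (h : d.edge = d'.edge)
    (hd : Crosses S d') : outEnd S d = outEnd S d' := by
  rcases (SimpleGraph.dart_edge_eq_iff _ _).1 h with rfl | rfl
  · rfl
  · exact outEnd_symm hd

namespace PlaneEmbedding

variable (P : PlaneEmbedding G)

/-- A cut crosses the boundary of each face an even number of times. -/
theorem exists_other_crossing {S : Finset V} {d : G.Dart} (hd : Crosses S d) :
    ∃ d' : G.Dart, Crosses S d' ∧ P.face d' = P.face d ∧ d' ≠ d := by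
  classical
  have : Fintype G.Dart := Fintype.ofFinite _
  by_contra! hcon
  let χ : V → ZMod 2 := fun v => if v ∈ S then 1 else 0
  -- The number of crossing darts of the face of `d`, mod 2. Along the face each vertex occurs once
  -- as a head for each time it occurs as a tail.
  have h0 : ∑ e : G.Dart, (χ e.fst + χ e.snd) * (if P.face e = P.face d then 1 else 0) = 0 := by
    have h2 : ∑ e : G.Dart, χ e.snd * (if P.face e = P.face d then 1 else 0) =
        ∑ e : G.Dart, χ e.fst * (if P.face e = P.face d then 1 else 0) := by
      rw [← Equiv.sum_comp P.facePerm
        (fun e => χ e.fst * (if P.face e = P.face d then 1 else 0))]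
      simp only [facePerm_fst, face_facePerm]
    simp only [add_mul, Finset.sum_add_distrib, h2]
    exact zmod_two_add_self _
  rw [Finset.sum_eq_single d] at h0
  · rw [if_pos rfl, mul_one] at h0
    apply hd
    simp only [χ] at h0
    by_cases h1 : d.fst ∈ S <;> by_cases h2 : d.snd ∈ S <;> simp_all
  · intro e _ he
    by_cases hf : P.face e = P.face d
    · have hc : ¬ Crosses S e := fun hc => he (hcon e hc hf)
      unfold Crosses at hc
      rw [not_not] at hc
      by_cases h1 : e.fst ∈ S
      · have h2 := hc.1 h1
        simp only [χ, h1, h2, if_true, zmod_two_add_self, zero_mul]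
      · have h2 : e.snd ∉ S := fun h => h1 (hc.2 h)
        simp only [χ, h1, h2, if_false, add_zero, zero_mul]
    · rw [if_neg hf, mul_zero]
  · intro h; exact absurd (Finset.mem_univ d) h

/-- A nonempty cut contains the edges crossed by a closed self-avoiding walk on the dual
lattice. -/
theorem exists_closed_walk_in_cut {S : Finset V} {d₀ : G.Dart} (hd₀ : Crosses S d₀) :
    ∃ (k : ℕ) (w : Fin (k + 1) → G.Dart),
      (∀ i, P.face (w i).symm = P.face (w (i + 1))) ∧
      (Function.Injective fun i => P.face (w i)) ∧
      (Function.Injective fun i => (w i).edge) ∧ ∀ i, Crosses S (w i) := by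
  classical
  -- After crossing an edge into the next face, parity supplies another crossing dart of that face,
  -- so the walk can continue without turning back.
  have hex : ∀ d : {d : G.Dart // Crosses S d}, ∃ d' : {d : G.Dart // Crosses S d},
      P.face d'.1 = P.face d.1.symm ∧ d'.1 ≠ d.1.symm := by
    rintro ⟨d, hd⟩
    obtain ⟨d', h1, h2, h3⟩ := P.exists_other_crossing (crosses_symm.2 hd)
    exact ⟨⟨d', h1⟩, h2, h3⟩
  choose nxt hface hne using hex
  let e : ℕ → {d : G.Dart // Crosses S d} := fun n => nxt^[n] ⟨d₀, hd₀⟩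
  have he : ∀ n, e (n + 1) = nxt (e n) := fun n => Function.iterate_succ_apply' _ _ _
  -- There are finitely many faces, so the walk revisits one. Taking the shortest gap `m` over all
  -- starting points makes the loop between the two visits self-avoiding.
  have hrep : ∃ m i, P.face (e i).1 = P.face (e (i + m + 1)).1 := by
    obtain ⟨i, j, hij, h⟩ := Finite.exists_ne_map_eq_of_infinite fun n => P.face (e n).1
    rcases lt_or_gt_of_ne hij with hlt | hlt
    · refine ⟨j - i - 1, i, ?_⟩
      rw [show i + (j - i - 1) + 1 = j by omega]; exact h
    · refine ⟨i - j - 1, j, ?_⟩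
      rw [show j + (i - j - 1) + 1 = i by omega]; exact h.symm
  obtain ⟨i, hi⟩ := Nat.find_spec hrep
  set k := Nat.find hrep with hk
  have hmin : ∀ a b, a < b → b ≤ k → P.face (e (i + a)).1 ≠ P.face (e (i + b)).1 := by
    intro a b hab hb h
    refine Nat.find_min hrep (m := b - a - 1) (by omega) ⟨i + a, ?_⟩
    rw [show i + a + (b - a - 1) + 1 = i + b by omega]; exact h
  -- Crossing an edge again in the same direction repeats a face. Crossing it backwards repeats the
  -- face entered after step `a`, unless it happens at the very next step, which `hne` excludes.
  have hedge : ∀ a b, a < b → b ≤ k → (e (i + a)).1.edge ≠ (e (i + b)).1.edge := by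
    intro a b hab hb h
    rcases (SimpleGraph.dart_edge_eq_iff _ _).1 h.symm with h1 | h1
    · exact hmin a b hab hb (by rw [h1])
    · rcases Nat.lt_or_ge (a + 1) b with hlt | hge
      · refine hmin (a + 1) b hlt hb ?_
        rw [h1, ← add_assoc, he, hface]
      · have : b = a + 1 := by omega
        subst this
        rw [← add_assoc, he] at h1
        exact hne _ h1
  refine ⟨k, fun t => (e (i + t)).1, ?_, ?_, ?_, fun t => (e (i + t)).2⟩
  · intro t
    have h1 : P.face (e (i + t)).1.symm = P.face (e (i + t + 1)).1 := by rw [he, hface]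
    rw [h1]
    rcases Nat.lt_or_ge t.1 k with hlt | hge
    · have : ((t + 1 : Fin (k + 1)) : ℕ) = t.1 + 1 := by
        rw [Fin.val_add_one]
        rw [if_neg]
        intro h
        rw [h] at hlt
        simp at hlt
      show _ = P.face (e (i + (t + 1 : Fin (k + 1)).1)).1
      rw [this, add_assoc]
    · have hlast : t = Fin.last k := Fin.ext (by simp; omega)
      subst hlast
      rw [Fin.last_add_one]
      simpa using hi.symm
  · intro a b hab
    by_contra hne'
    rcases lt_or_gt_of_ne hne' with h | h
    · exact hmin a b h (by omega) hab
    · exact hmin b a h (by omega) hab.symm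
  · intro a b hab
    by_contra hne'
    rcases lt_or_gt_of_ne hne' with h | h
    · exact hedge a b h (by omega) hab
    · exact hedge b a h (by omega) hab.symm

/-- The cut between two complementary connected sets of sites is crossed by a closed self-avoiding
walk on the dual lattice. -/
theorem exists_closed_walk {S : Finset V} (hS : (G.induce (S : Set V)).Preconnected)
    (hSc : (G.induce ((Sᶜ : Finset V) : Set V)).Preconnected)
    {d₀ : G.Dart} (hd₀ : Crosses S d₀) :
    ∃ (k : ℕ) (w : Fin (k + 1) → G.Dart),
      (∀ i, P.face (w i).symm = P.face (w (i + 1))) ∧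
      (Function.Injective fun i => P.face (w i)) ∧
      (Function.Injective fun i => (w i).edge) ∧
      ∀ d : G.Dart, Crosses S d ↔ ∃ i, (w i).edge = d.edge := by
  classical
  have : Fintype G.edgeSet := Fintype.ofFinite _
  obtain ⟨k, w, h1, h2, h3, h4⟩ := P.exists_closed_walk_in_cut hd₀
  refine ⟨k, w, h1, h2, h3, fun d => ⟨fun hd => ?_, fun ⟨i, hi⟩ => ?_⟩⟩
  swap
  · exact (crosses_of_edge_eq hi).1 (h4 i)
  -- The indicator of the walk. It will turn out to be a coboundary supported in the cut of `S`, and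
  -- with both sides connected the only nonzero one is the whole cut.
  let x : G.edgeSet → ZMod 2 := fun e => ∑ i, if (w i).edge = e.1 then 1 else 0
  have hx1 : ∀ i, x ⟨(w i).edge, (w i).edge_mem⟩ = 1 := by
    intro i
    simp only [x]
    rw [Finset.sum_eq_single i]
    · simp
    · intro j _ hj
      exact if_neg fun h => hj (h3 h)
    · intro h; exact absurd (Finset.mem_univ i) h
  have hx0 : ∀ d : G.Dart, (¬ ∃ i, (w i).edge = d.edge) → x ⟨d.edge, d.edge_mem⟩ = 0 := by
    intro d hd
    refine Finset.sum_eq_zero fun i _ => if_neg fun h => hd ⟨i, h⟩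
  -- Each step contributes the values of `h` on the two faces that it joins, and these cancel around
  -- the closed walk.
  have hdual : ∀ h : P.Face → ZMod 2,
      ∑ e, x e * (h (P.face (orient e)) + h (P.face (orient e).symm)) = 0 := by
    intro h
    have hc : ∀ i, ∑ e : G.edgeSet, (if (w i).edge = e.1 then 1 else 0) *
        (h (P.face (orient e)) + h (P.face (orient e).symm)) =
        h (P.face (w i)) + h (P.face (w i).symm) := by
      intro i
      rw [Finset.sum_eq_single (⟨(w i).edge, (w i).edge_mem⟩ : G.edgeSet)]
      · rw [if_pos rfl, one_mul]
        rcases eq_orient (w i) ⟨(w i).edge, (w i).edge_mem⟩ rfl with h5 | h5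
        · rw [← h5]
        · rw [← SimpleGraph.Dart.symm_symm (orient _), ← h5, SimpleGraph.Dart.symm_symm, add_comm]
      · intro e _ he
        rw [if_neg, zero_mul]
        intro h6
        exact he (Subtype.ext h6.symm)
      · intro h; exact absurd (Finset.mem_univ _) h
    simp only [x, Finset.sum_mul]
    rw [Finset.sum_comm]
    simp only [hc, Finset.sum_add_distrib, h1]
    have hshift : ∑ i, h (P.face (w (i + 1))) = ∑ i, h (P.face (w i)) :=
      Equiv.sum_comp (Equiv.addRight (1 : Fin (k + 1))) (fun i => h (P.face (w i)))
    rw [hshift]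
    exact zmod_two_add_self _
  obtain ⟨g, hg⟩ := P.exists_coboundary x hdual
  have hg' : ∀ d : G.Dart, x ⟨d.edge, d.edge_mem⟩ = g d.fst + g d.snd := by
    intro d
    rw [hg]
    rcases eq_orient d ⟨d.edge, d.edge_mem⟩ rfl with h5 | h5
    · rw [← h5]
    · rw [← SimpleGraph.Dart.symm_symm (orient _), ← h5, add_comm]; rfl
  -- Edges that do not cross the cut are not on the walk, so the potential `g` is constant on `S`
  -- and on `Sᶜ`. Its jump is therefore the same on every crossing edge.
  have hnc : ∀ u v, G.Adj u v → (u ∈ S ↔ v ∈ S) → g u = g v := by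
    intro u v huv hiff
    have h5 := hx0 ⟨(u, v), huv⟩ (fun ⟨i, hi⟩ => (crosses_of_edge_eq hi).1 (h4 i) hiff)
    rw [hg', CharTwo.add_eq_zero] at h5
    exact h5
  have hgS := eq_on_of_induce_preconnected hS g fun u hu v hv huv =>
    hnc u v huv ⟨fun _ => hv, fun _ => hu⟩
  have hgSc := eq_on_of_induce_preconnected hSc g fun u hu v hv huv =>
    hnc u v huv ⟨fun h => absurd h (Finset.mem_compl.1 hu), fun h => absurd h (Finset.mem_compl.1 hv)⟩
  have hsum : g d.fst + g d.snd = g (w 0).fst + g (w 0).snd := by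
    have hw := h4 0
    unfold Crosses at hd hw
    by_cases ha : d.fst ∈ S <;> by_cases hb : (w 0).fst ∈ S
    · have ha' : d.snd ∉ S := by tauto
      have hb' : (w 0).snd ∉ S := by tauto
      rw [hgS _ ha _ hb, hgSc _ (Finset.mem_compl.2 ha') _ (Finset.mem_compl.2 hb')]
    · have ha' : d.snd ∉ S := by tauto
      have hb' : (w 0).snd ∈ S := by tauto
      rw [hgS _ ha _ hb', hgSc _ (Finset.mem_compl.2 ha') _ (Finset.mem_compl.2 hb), add_comm]
    · have ha' : d.snd ∈ S := by tauto
      have hb' : (w 0).snd ∉ S := by tauto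
      rw [hgS _ ha' _ hb, hgSc _ (Finset.mem_compl.2 ha) _ (Finset.mem_compl.2 hb'), add_comm]
    · have ha' : d.snd ∈ S := by tauto
      have hb' : (w 0).snd ∈ S := by tauto
      rw [hgS _ ha' _ hb', hgSc _ (Finset.mem_compl.2 ha) _ (Finset.mem_compl.2 hb)]
  by_contra hcon
  have h5 := hx0 d hcon
  rw [hg', hsum, ← hg', hx1] at h5
  exact one_ne_zero h5

theorem ncard_face_le {d : G.Dart} {m : ℕ} (hm : 0 < m) (h : P.facePerm^[m] d = d) :
    {e : G.Dart | P.face e = P.face d} ⊆ (Finset.range m).image (fun n => P.facePerm^[n] d) := by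
  classical
  intro e he
  obtain ⟨n, hn⟩ := (P.sameCycle_of_face_eq (Eq.symm he)).exists_nat_pow_eq
  rw [← Equiv.Perm.iterate_eq_pow] at hn
  rw [Finset.coe_image, Set.mem_image]
  refine ⟨n % m, by simpa using Nat.mod_lt _ hm, ?_⟩
  show P.facePerm^[n % m] d = e
  rw [Function.IsPeriodicPt.iterate_mod_apply h, hn]

/-- Among four successive iterates two coincide, and a period below 3 would leave the face with
fewer than three darts. -/
theorem facePerm_triangle {d : G.Dart} (h3 : {e : G.Dart | P.face e = P.face d}.ncard = 3) :
    P.facePerm^[3] d = d := by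
  classical
  have hper : ∀ m, 0 < m → P.facePerm^[m] d = d → 3 ≤ m := by
    intro m hm h
    have h1 := Set.ncard_le_ncard (P.ncard_face_le hm h) (Finset.finite_toSet _)
    rw [Set.ncard_coe_finset, h3] at h1
    exact h1.trans (Finset.card_image_le.trans (by simp))
  have hmem : ∀ n, P.face (P.facePerm^[n] d) = P.face d := by
    intro n
    induction n with
    | zero => rfl
    | succ n ih => rw [Function.iterate_succ_apply', face_facePerm, ih]
  have hpig : ∃ a ∈ Finset.range 4, ∃ b ∈ Finset.range 4, a ≠ b ∧
      P.facePerm^[a] d = P.facePerm^[b] d := by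
    have hfin : {e : G.Dart | P.face e = P.face d}.Finite := Set.toFinite _
    refine Finset.exists_ne_map_eq_of_card_lt_of_maps_to (t := hfin.toFinset) ?_ ?_
    · rw [← Set.ncard_eq_toFinset_card _ hfin, h3]; simp
    · intro n _
      simpa using hmem n
  obtain ⟨a, ha, b, hb, hab, h⟩ := hpig
  rw [Finset.mem_range] at ha hb
  have main : ∀ a b, a < b → b < 4 → P.facePerm^[a] d = P.facePerm^[b] d →
      P.facePerm^[3] d = d := by
    intro a b hab hb h
    have h1 : P.facePerm^[b - a] d = d := by
      have : P.facePerm^[a] (P.facePerm^[b - a] d) = P.facePerm^[a] d := by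
        rw [← Function.iterate_add_apply, show a + (b - a) = b by omega, h]
      exact (P.facePerm.injective.iterate a) this
    have h2 := hper (b - a) (by omega) h1
    rw [show b - a = 3 by omega] at h1
    exact h1
  rcases lt_or_gt_of_ne hab with hlt | hlt
  · exact main a b hlt hb h
  · exact main b a hlt ha h.symm

/-- Two consecutive crossing darts of a triangle share a vertex. If it lies outside `S`, it is the
outer end of both; if it lies in `S`, the two outer ends are joined by the third side of the
triangle. -/
theorem outEnd_eq_of_triangle {α : Type*} {S : Finset V} (Q : V → α)
    (hQ : ∀ u v, u ∉ S → v ∉ S → (∃ s ∈ S, G.Adj u s) → (∃ s ∈ S, G.Adj v s) →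
      G.Adj u v → Q u = Q v) {d : G.Dart} (h3 : P.facePerm^[3] d = d) (hd : Crosses S d)
    (hd' : Crosses S (P.facePerm d)) : Q (outEnd S d) = Q (outEnd S (P.facePerm d)) := by
  have hb := P.facePerm_fst d
  have hc := P.facePerm_fst (P.facePerm d)
  have ha := P.facePerm_fst (P.facePerm (P.facePerm d))
  have ha' : P.facePerm (P.facePerm (P.facePerm d)) = d := h3
  rw [ha'] at ha
  have hac := (P.facePerm (P.facePerm d)).adj
  have hab := d.adj
  have hbc := (P.facePerm d).adj
  rw [hc, ← ha] at hac
  rw [hb] at hbc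
  unfold Crosses at hd hd'
  rw [hb] at hd'
  unfold outEnd
  rw [hb]
  by_cases hbS : d.snd ∈ S
  · have h1 : d.fst ∉ S := by tauto
    have h2 : (P.facePerm d).snd ∉ S := by tauto
    rw [if_neg h1, if_pos hbS]
    exact hQ _ _ h1 h2 ⟨_, hbS, hab⟩ ⟨_, hbS, hbc.symm⟩ hac.symm
  · have h1 : d.fst ∈ S := by tauto
    rw [if_pos h1, if_neg hbS]

/-- In a triangulation, the outer boundary of a connected set of sites with connected complement
is connected. -/
theorem eq_on_neighbors {outer : P.Face} (hP : P.IsTriangulation outer) {α : Type*}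
    {S : Finset V} (hS : (G.induce (S : Set V)).Preconnected)
    (hSc : (G.induce ((Sᶜ : Finset V) : Set V)).Preconnected) (Q : V → α)
    (hQ : ∀ u v, u ∉ S → v ∉ S → (∃ s ∈ S, G.Adj u s) → (∃ s ∈ S, G.Adj v s) →
      G.Adj u v → Q u = Q v)
    {u v : V} (hu : u ∉ S) (hv : v ∉ S) (hu' : ∃ s ∈ S, G.Adj u s) (hv' : ∃ s ∈ S, G.Adj v s) :
    Q u = Q v := by
  classical
  obtain ⟨s, hs, hus⟩ := hu'
  obtain ⟨t, ht, hvt⟩ := hv'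
  have hcr : ∀ {a b : V} (hab : G.Adj a b), a ∉ S → b ∈ S → Crosses S (⟨(a, b), hab⟩ : G.Dart) :=
    fun _ ha hb h => ha (h.2 hb)
  obtain ⟨k, w, h1, h2, h3, h4⟩ := P.exists_closed_walk hS hSc (hcr hus hu hs)
  have hcw : ∀ i, Crosses S (w i) := fun i => (h4 _).2 ⟨i, rfl⟩
  -- The walk enters and leaves a triangular face through two of its three darts; `n` tells whether
  -- they coincide, or which one follows the other.
  have hstep : ∀ i, P.face (w (i + 1)) ≠ outer →
      Q (outEnd S (w i)) = Q (outEnd S (w (i + 1))) := by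
    intro i hi
    have hcard := hP _ hi
    rw [← h1] at hcard
    have hp3 := P.facePerm_triangle hcard
    have hcs := crosses_symm.2 (hcw i)
    have hmem := P.ncard_face_le (by norm_num) hp3
      (show w (i + 1) ∈ {e : G.Dart | P.face e = P.face (w i).symm} from (h1 i).symm)
    rw [Finset.coe_image, Set.mem_image] at hmem
    obtain ⟨n, hn, hne⟩ := hmem
    rw [← outEnd_symm (hcw i)]
    have hn3 : n < 3 := by simpa using hn
    change P.facePerm^[n] (w i).symm = w (i + 1) at hne
    interval_cases n
    · rw [← hne]; rfl
    · have hne' : P.facePerm (w i).symm = w (i + 1) := hne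
      have := P.outEnd_eq_of_triangle Q hQ hp3 hcs (by rw [hne']; exact hcw _)
      rw [this, hne']
    · have hne' : P.facePerm (w (i + 1)) = (w i).symm := by rw [← hne]; exact hp3
      have hcard' := hP _ hi
      have := P.outEnd_eq_of_triangle Q hQ (P.facePerm_triangle hcard') (hcw _)
        (by rw [hne']; exact hcs)
      rw [this, hne']
  -- The outer face is visited at most once, so only one link of the cyclic chain of outer ends can
  -- fail. Starting at `j`, the chain runs once around without using that link.
  have hconst : ∃ c, ∀ i, Q (outEnd S (w i)) = c := by
    obtain ⟨j, hj⟩ : ∃ j, ∀ i, P.face (w i) = outer → i = j := by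
      by_cases hex : ∃ j, P.face (w j) = outer
      · obtain ⟨j, hj⟩ := hex
        exact ⟨j, fun i hi => h2 (hi.trans hj.symm)⟩
      · exact ⟨0, fun i hi => absurd ⟨i, hi⟩ hex⟩
    refine ⟨Q (outEnd S (w j)), ?_⟩
    have key : ∀ m : Fin (k + 1), Q (outEnd S (w (j + m))) = Q (outEnd S (w j)) := by
      intro m
      induction m using Fin.induction with
      | zero => rw [add_zero]
      | succ m ih =>
        rw [← ih, ← Fin.coeSucc_eq_succ, ← add_assoc]
        refine (hstep _ fun h => ?_).symm
        have h5 := hj _ h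
        rw [add_assoc, add_eq_left, Fin.coeSucc_eq_succ] at h5
        exact Fin.succ_ne_zero _ h5
    intro i
    have := key (i - j)
    rwa [add_sub_cancel] at this
  obtain ⟨c, hc⟩ := hconst
  have hend : ∀ {a b : V} (hab : G.Adj a b), a ∉ S → b ∈ S → Q a = c := by
    intro a b hab ha hb
    obtain ⟨i, hi⟩ := (h4 _).1 (hcr hab ha hb)
    rw [← hc i, outEnd_of_edge_eq hi (hcr hab ha hb)]
    simp [outEnd, ha]
  rw [hend hus hu hs, hend hvt hv ht]

end PlaneEmbedding

end Cuts

/-! ### Connected cuts between `A` and `C` and their boundary layers. -/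

section CutSets

variable {V : Type*} [Fintype V] [DecidableEq V] (G : SimpleGraph V)

open Classical in
/-- The sites in `S` with a neighbor outside `S`. -/
def innerBd (S : Finset V) : Finset V := Finset.univ.filter fun v => v ∈ S ∧ ∃ u, u ∉ S ∧ G.Adj v u

open Classical in
/-- The sites outside `S` with a neighbor in `S`. -/
def outerBd (S : Finset V) : Finset V := Finset.univ.filter fun v => v ∉ S ∧ ∃ u, u ∈ S ∧ G.Adj v u

open Classical in
/-- The connected sets of sites that contain `A`, avoid `C` and have a connected complement. -/
def cutSets (A C : Finset V) : Finset (Finset V) := Finset.univ.filter fun S =>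
  A ⊆ S ∧ Disjoint S C ∧ (G.induce (S : Set V)).Preconnected ∧
    (G.induce ((Sᶜ : Finset V) : Set V)).Preconnected

open Classical in
/-- The edges with exactly one end in `S`. -/
def edgeCut (S : Finset V) : Finset (Sym2 V) :=
  Finset.univ.filter fun e => ∃ d : G.Dart, Crosses S d ∧ d.edge = e

variable {G}

theorem mem_innerBd {S : Finset V} {v : V} :
    v ∈ innerBd G S ↔ v ∈ S ∧ ∃ u, u ∉ S ∧ G.Adj v u := by simp [innerBd]

theorem mem_outerBd {S : Finset V} {v : V} :
    v ∈ outerBd G S ↔ v ∉ S ∧ ∃ u, u ∈ S ∧ G.Adj v u := by simp [outerBd]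

theorem mem_cutSets {A C S : Finset V} : S ∈ cutSets G A C ↔
    A ⊆ S ∧ Disjoint S C ∧ (G.induce (S : Set V)).Preconnected ∧
      (G.induce ((Sᶜ : Finset V) : Set V)).Preconnected := by simp [cutSets]

theorem mem_edgeCut {S : Finset V} {e : Sym2 V} :
    e ∈ edgeCut G S ↔ ∃ d : G.Dart, Crosses S d ∧ d.edge = e := by simp [edgeCut]

theorem mem_iff_of_reachable_deleteEdges {S : Finset V} {u v : V}
    (h : (G.deleteEdges (edgeCut G S : Set (Sym2 V))).Reachable u v) : u ∈ S ↔ v ∈ S := by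
  refine iff_of_eq (eq_of_reachable (fun x => x ∈ S) (fun a b hab => ?_) h)
  rw [SimpleGraph.deleteEdges_adj] at hab
  obtain ⟨h1, h2⟩ := hab
  by_contra hcon
  exact h2 (Finset.mem_coe.2 (mem_edgeCut.2
    ⟨(⟨(a, b), h1⟩ : G.Dart), fun h => hcon (propext h), rfl⟩))

/-- No path crosses the deleted edges, and the connected set `Sᶜ` loses none of its own edges. In
particular the edge cut determines `S`. -/
theorem cSide_edgeCut {A C S : Finset V} (hC : C.Nonempty) (hS : S ∈ cutSets G A C) :
    cSide G (edgeCut G S) C = Sᶜ := by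
  obtain ⟨-, hSC, -, hSc⟩ := mem_cutSets.1 hS
  ext v
  simp only [cSide, Finset.mem_filter, Finset.mem_univ, true_and]
  constructor
  · rintro ⟨c, hc, h⟩
    rw [Finset.mem_compl]
    intro hv
    exact Finset.disjoint_left.1 hSC ((mem_iff_of_reachable_deleteEdges h).2 hv) hc
  · intro hv
    obtain ⟨c, hc⟩ := hC
    have hcS : c ∈ Sᶜ := Finset.mem_compl.2 fun h => Finset.disjoint_left.1 hSC h hc
    refine ⟨c, hc, ?_⟩
    have := eq_on_of_induce_preconnected hSc
      (fun x => (G.deleteEdges (edgeCut G S : Set (Sym2 V))).Reachable c x) ?_ c hcS v hv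
    · exact this.mp (SimpleGraph.Reachable.refl _)
    · intro x hx y hy hxy
      have hadj : (G.deleteEdges (edgeCut G S : Set (Sym2 V))).Adj x y := by
        rw [SimpleGraph.deleteEdges_adj]
        refine ⟨hxy, fun h => ?_⟩
        obtain ⟨d, hd, hde⟩ := mem_edgeCut.1 (Finset.mem_coe.1 h)
        refine (crosses_of_edge_eq (d' := ⟨(x, y), hxy⟩) hde).1 hd ⟨fun h => ?_, fun h => ?_⟩
        · exact absurd h (Finset.mem_compl.1 hx)
        · exact absurd h (Finset.mem_compl.1 hy)
      exact propext ⟨fun h => h.trans hadj.reachable, fun h => h.trans hadj.symm.reachable⟩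

/-- Connectedness of `G` makes the cut nonempty, and connectedness of both sides makes it a single
closed walk. -/
theorem edgeCut_mem_saw (P : PlaneEmbedding G) {A C S : Finset V} (hA : A.Nonempty)
    (hC : C.Nonempty) (hS : S ∈ cutSets G A C) : edgeCut G S ∈ P.saw A C := by
  obtain ⟨hAS, hSC, hSp, hSc⟩ := mem_cutSets.1 hS
  obtain ⟨a, ha⟩ := hA
  obtain ⟨c, hc⟩ := hC
  have hcS : c ∉ S := fun h => Finset.disjoint_left.1 hSC h hc
  obtain ⟨d₀, hd₀⟩ : ∃ d : G.Dart, Crosses S d := by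
    by_contra! hcon
    have := eq_of_reachable (fun x => x ∈ S) (fun u v huv => ?_) (P.connected.preconnected a c)
    · exact hcS (this.mp (hAS ha))
    · have := hcon ⟨(u, v), huv⟩
      unfold Crosses at this
      rw [not_not] at this
      exact propext this
  simp only [PlaneEmbedding.saw, Finset.mem_filter, Finset.mem_univ, true_and]
  constructor
  · obtain ⟨k, w, h1, h2, h3, h4⟩ := P.exists_closed_walk hSp hSc hd₀
    refine ⟨k, w, h1, h2, h3, ?_⟩
    ext e
    rw [mem_edgeCut, Finset.mem_image]
    constructor
    · rintro ⟨d, hd, rfl⟩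
      obtain ⟨i, hi⟩ := (h4 d).1 hd
      exact ⟨i, Finset.mem_univ _, hi⟩
    · rintro ⟨i, -, rfl⟩
      exact ⟨w i, (h4 _).2 ⟨i, rfl⟩, rfl⟩
  · intro a ha c hc h
    exact Finset.disjoint_left.1 hSC ((mem_iff_of_reachable_deleteEdges h).1 (hAS ha)) hc

theorem sum_cutSets_le (P : PlaneEmbedding G) {A C : Finset V} (hA : A.Nonempty)
    (hC : C.Nonempty) (g : Finset (Sym2 V) → ℝ) (hg : ∀ W, 0 ≤ g W) :
    ∑ S ∈ cutSets G A C, g (edgeCut G S) ≤ ∑ W ∈ P.saw A C, g W := by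
  classical
  rw [← Finset.sum_image (s := cutSets G A C) (g := edgeCut G) (f := g)]
  · refine Finset.sum_le_sum_of_subset_of_nonneg ?_ fun _ _ _ => hg _
    intro W hW
    obtain ⟨S, hS, rfl⟩ := Finset.mem_image.1 hW
    exact edgeCut_mem_saw P hA hC hS
  · intro S hS T hT h
    have h1 := cSide_edgeCut hC (Finset.mem_coe.1 hS)
    rw [h, cSide_edgeCut hC (Finset.mem_coe.1 hT)] at h1
    exact (compl_injective h1).symm

/-- Two cuts whose boundary layers do not conflict are nested. -/
theorem cutSets_nested (P : PlaneEmbedding G) {outer : P.Face} (hP : P.IsTriangulation outer)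
    {A C S T : Finset V} (hA : A.Nonempty) (hC : C.Nonempty)
    (hS : S ∈ cutSets G A C) (hT : T ∈ cutSets G A C)
    (h1 : ∀ v ∈ outerBd G S, v ∉ innerBd G T) (h2 : ∀ v ∈ outerBd G T, v ∉ innerBd G S) :
    S = T ∨ (S ⊆ T ∧ outerBd G S ⊆ T) ∨ (T ⊆ S ∧ outerBd G T ⊆ S) := by
  have aux : ∀ {S T : Finset V}, S ∈ cutSets G A C → T ∈ cutSets G A C →
      (∀ v ∈ outerBd G S, v ∉ innerBd G T) → (S ⊆ T ∧ outerBd G S ⊆ T) ∨ T ⊆ S := by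
    intro S T hS hT h1
    obtain ⟨hAS, hSC, hSp, hSc⟩ := mem_cutSets.1 hS
    obtain ⟨hAT, hTC, hTp, hTc⟩ := mem_cutSets.1 hT
    obtain ⟨a, ha⟩ := hA
    obtain ⟨c, hc⟩ := hC
    -- Two adjacent sites of the outer layer of `S` on different sides of `T` would put one of them
    -- in the inner layer of `T`, which is a conflict. Connectedness of the layer then places all of
    -- it on one side.
    have hconst : ∀ u ∈ outerBd G S, ∀ v ∈ outerBd G S, (u ∈ T) = (v ∈ T) := by
      intro u hu v hv
      obtain ⟨hu1, hu2⟩ := mem_outerBd.1 hu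
      obtain ⟨hv1, hv2⟩ := mem_outerBd.1 hv
      refine P.eq_on_neighbors hP hSp hSc (fun x => x ∈ T) ?_ hu1 hv1 hu2 hv2
      intro x y hx hy hx' hy' hxy
      refine propext ⟨fun h => ?_, fun h => ?_⟩
      · by_contra hyT
        exact h1 x (mem_outerBd.2 ⟨hx, hx'⟩) (mem_innerBd.2 ⟨h, y, hyT, hxy⟩)
      · by_contra hxT
        exact h1 y (mem_outerBd.2 ⟨hy, hy'⟩) (mem_innerBd.2 ⟨h, x, hxT, hxy.symm⟩)
    -- If the layer misses `T`, the connected set `T` contains `a ∈ S` and cannot leave `S`. If the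
    -- layer lies in `T`, the connected set `Tᶜ` contains `c ∉ S` and cannot enter `S`.
    by_cases hex : ∃ u ∈ outerBd G S, u ∉ T
    · right
      obtain ⟨u, hu, huT⟩ := hex
      have hout : ∀ v ∈ outerBd G S, v ∉ T := fun v hv h => huT ((hconst u hu v hv).mpr h)
      have hcon := eq_on_of_induce_preconnected hTp (fun x => x ∈ S) ?_ a (hAT ha)
      · intro v hv
        exact (hcon v hv).mp (hAS ha)
      · intro x hx y hy hxy
        refine propext ⟨fun h => ?_, fun h => ?_⟩
        · by_contra hyS
          exact hout y (mem_outerBd.2 ⟨hyS, x, h, hxy.symm⟩) hy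
        · by_contra hxS
          exact hout x (mem_outerBd.2 ⟨hxS, y, h, hxy⟩) hx
    · left
      push Not at hex
      refine ⟨fun v hv => ?_, hex⟩
      by_contra hvT
      have hcT : c ∈ Tᶜ := Finset.mem_compl.2 fun h => Finset.disjoint_left.1 hTC h hc
      have hcon := eq_on_of_induce_preconnected hTc (fun x => x ∈ S) ?_ c hcT v
        (Finset.mem_compl.2 hvT)
      · exact Finset.disjoint_left.1 hSC (hcon.mpr hv) hc
      · intro x hx y hy hxy
        refine propext ⟨fun h => ?_, fun h => ?_⟩
        · by_contra hyS
          exact Finset.mem_compl.1 hy (hex y (mem_outerBd.2 ⟨hyS, x, h, hxy.symm⟩))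
        · by_contra hxS
          exact Finset.mem_compl.1 hx (hex x (mem_outerBd.2 ⟨hxS, y, h, hxy⟩))
  rcases aux hS hT h1 with h | h
  · exact Or.inr (Or.inl h)
  · rcases aux hT hS h2 with h' | h'
    · exact Or.inr (Or.inr h')
    · exact Or.inl (Finset.Subset.antisymm h' h)

/-- The subgraph of the edges with both ends in `X`. -/
def restrictTo (G : SimpleGraph V) (X : Set V) : SimpleGraph V where
  Adj u v := G.Adj u v ∧ u ∈ X ∧ v ∈ X
  symm := ⟨fun _ _ h => ⟨h.1.symm, h.2.2, h.2.1⟩⟩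
  loopless := ⟨fun _ h => G.loopless.irrefl _ h.1⟩

theorem mem_of_reachable_restrictTo {X : Set V} {x y : V} (hx : x ∈ X)
    (h : (restrictTo G X).Reachable x y) : y ∈ X :=
  (eq_of_reachable (H := restrictTo G X) (fun z => z ∈ X)
    (fun _ _ hab => propext ⟨fun _ => hab.2.2, fun _ => hab.2.1⟩) h).mp hx

theorem reachable_induce_of_restrictTo {X Y : Set V} {x y : V}
    (hY : ∀ z, (restrictTo G X).Reachable x z → z ∈ Y)
    (h : (restrictTo G X).Reachable x y) :
    (G.induce Y).Reachable ⟨x, hY x (SimpleGraph.Reachable.refl _)⟩ ⟨y, hY y h⟩ := by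
  have h' := (SimpleGraph.reachable_iff_reflTransGen x y).1 h
  induction h' with
  | refl => exact SimpleGraph.Reachable.refl _
  | tail hab hbc ih =>
    have hb := (SimpleGraph.reachable_iff_reflTransGen _ _).2 hab
    refine (ih hb).trans (SimpleGraph.Adj.reachable ?_)
    exact hbc.1

/-- For each set `D` of sites that contains `C` and avoids `A` there is a cut whose outer boundary
layer lies in `D` and whose inner boundary layer avoids `D`. -/
theorem exists_cutSet (hG : G.Connected) {A C D : Finset V} (hA : A.Nonempty) (hC : C.Nonempty)
    (hAc : (G.induce (A : Set V)).Preconnected) (hCc : (G.induce (C : Set V)).Preconnected)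
    (hCD : C ⊆ D) (hAD : Disjoint A D) :
    ∃ S ∈ cutSets G A C, outerBd G S ⊆ D ∧ Disjoint (innerBd G S) D := by
  classical
  obtain ⟨a, ha⟩ := hA
  obtain ⟨c, hc⟩ := hC
  -- `T` is the component of `C` in `D`, and `S` is the component of `A` in the complement of `T`.
  -- Sites leaving `S` enter `T ⊆ D`, and a neighbor of `T` in `D` would already belong to `T`.
  let T : Set V := {v | (restrictTo G (D : Set V)).Reachable c v}
  let S : Set V := {v | (restrictTo G Tᶜ).Reachable a v}
  have hTD : T ⊆ D := fun v hv => mem_of_reachable_restrictTo (hCD hc) hv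
  have hcT : c ∈ T := SimpleGraph.Reachable.refl _
  have haS : a ∈ S := SimpleGraph.Reachable.refl _
  have haT : a ∈ Tᶜ := fun h => Finset.disjoint_left.1 hAD ha (hTD h)
  have hST : S ⊆ Tᶜ := fun v hv => mem_of_reachable_restrictTo haT hv
  have hCT : ∀ v ∈ C, v ∈ T := by
    intro v hv
    refine (eq_on_of_induce_preconnected hCc
      (fun x => (restrictTo G (D : Set V)).Reachable c x) ?_ c hc v hv).mp hcT
    intro x hx y hy hxy
    have hadj : (restrictTo G (D : Set V)).Adj x y := ⟨hxy, hCD hx, hCD hy⟩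
    exact propext ⟨fun h => h.trans hadj.reachable, fun h => h.trans hadj.symm.reachable⟩
  have hAS : ∀ v ∈ A, v ∈ S := by
    intro v hv
    refine (eq_on_of_induce_preconnected hAc
      (fun x => (restrictTo G Tᶜ).Reachable a x) ?_ a ha v hv).mp haS
    intro x hx y hy hxy
    have hadj : (restrictTo G Tᶜ).Adj x y := ⟨hxy,
      fun h => Finset.disjoint_left.1 hAD hx (hTD h),
      fun h => Finset.disjoint_left.1 hAD hy (hTD h)⟩
    exact propext ⟨fun h => h.trans hadj.reachable, fun h => h.trans hadj.symm.reachable⟩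
  have hstepS : ∀ u ∈ S, ∀ v, G.Adj u v → v ∉ S → v ∈ T := by
    intro u hu v huv hv
    by_contra hvT
    exact hv (SimpleGraph.Reachable.trans hu
      (SimpleGraph.Adj.reachable ⟨huv, hST hu, hvT⟩))
  have hSconn : ∀ v (hv : v ∈ S), (G.induce S).Reachable ⟨a, haS⟩ ⟨v, hv⟩ := fun v hv =>
    reachable_induce_of_restrictTo (X := Tᶜ) (Y := S) (fun z hz => hz) hv
  have hcS : c ∈ Sᶜ := fun h => hST h hcT
  let R : Set V := {v | ∃ hv : v ∈ Sᶜ, (G.induce Sᶜ).Reachable ⟨c, hcS⟩ ⟨v, hv⟩}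
  have hTR : T ⊆ R := fun v hv => ⟨fun h => hST h hv,
    reachable_induce_of_restrictTo (X := (D : Set V)) (Y := Sᶜ)
      (fun z hz h => hST h hz) hv⟩
  -- The complement of `S` is connected: it consists of `T` and of the other components of `Tᶜ`,
  -- each of which is attached to `T` because `G` is connected.
  have hRS : ∀ v, v ∈ R ∨ v ∈ S := by
    intro v
    have hone : ∀ x y, G.Adj x y → (x ∈ R ∨ x ∈ S) → (y ∈ R ∨ y ∈ S) := by
      rintro x y hxy (⟨hx, h⟩ | h)
      · by_cases hy : y ∈ S
        · exact Or.inr hy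
        · exact Or.inl ⟨hy, h.trans (SimpleGraph.Adj.reachable hxy)⟩
      · by_cases hy : y ∈ S
        · exact Or.inr hy
        · exact Or.inl (hTR (hstepS x h y hxy hy))
    refine (eq_of_reachable (fun x => x ∈ R ∨ x ∈ S) ?_
      (hG.preconnected a v)).mp (Or.inr haS)
    exact fun x y hxy => propext ⟨hone x y hxy, hone y x hxy.symm⟩
  have hcoe : ((S.toFinset : Finset V) : Set V) = S := Set.coe_toFinset S
  have hcoe' : (((S.toFinset)ᶜ : Finset V) : Set V) = Sᶜ := by rw [Finset.coe_compl, hcoe]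
  refine ⟨S.toFinset, mem_cutSets.2 ⟨fun v hv => Set.mem_toFinset.2 (hAS v hv), ?_, ?_, ?_⟩, ?_, ?_⟩
  · rw [Finset.disjoint_left]
    exact fun v hv hvC => hST (Set.mem_toFinset.1 hv) (hCT v hvC)
  · rw [hcoe]
    exact fun x y => (hSconn x.1 x.2).symm.trans (hSconn y.1 y.2)
  · rw [hcoe']
    have hall : ∀ x : (Sᶜ : Set V), (G.induce Sᶜ).Reachable ⟨c, hcS⟩ x := by
      intro x
      rcases hRS x.1 with ⟨_, h⟩ | h
      · exact h
      · exact absurd h x.2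
    exact fun x y => (hall x).symm.trans (hall y)
  · intro v hv
    obtain ⟨hvS, u, hu, huv⟩ := mem_outerBd.1 hv
    rw [Set.mem_toFinset] at hu hvS
    exact hTD (hstepS u hu v huv.symm hvS)
  · rw [Finset.disjoint_left]
    intro v hv hvD
    obtain ⟨hvS, u, hu, huv⟩ := mem_innerBd.1 hv
    rw [Set.mem_toFinset] at hu hvS
    have huT := hstepS v hvS u huv hu
    exact hST hvS (SimpleGraph.Reachable.trans huT
      (SimpleGraph.Adj.reachable ⟨huv.symm, hTD huT, hvD⟩))

end CutSets

/-! ### Expectation values of product operators -/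

section Indep

variable {V : Type*} [Fintype V] [DecidableEq V] {R : V → Type*} [∀ v, Fintype (R v)]

/-- Adjoin a dummy outcome of total weight one at `v`, then swap it with the actual outcome there.
This isolates the sum over a single site's outcomes. -/
theorem sum_eq_sum_update (w : (v : V) → R v → ℝ) (v : V) (hw : ∑ r, w v r = 1)
    (g : ((v : V) → R v) → ℝ) :
    ∑ s, g s = ∑ s, w v (s v) * ∑ r, g (Function.update s v r) := by
  have h1 : ∑ s, g s = ∑ p : ((v : V) → R v) × R v, w v p.2 * g p.1 := by
    rw [Fintype.sum_prod_type]
    refine Finset.sum_congr rfl fun s _ => ?_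
    dsimp only
    rw [← Finset.sum_mul, hw, one_mul]
  let e : ((v : V) → R v) × R v → ((v : V) → R v) × R v :=
    fun p => (Function.update p.1 v p.2, p.1 v)
  have he : Function.Involutive e := by
    rintro ⟨s, r⟩
    simp [e]
  rw [h1, ← Equiv.sum_comp he.toPerm, Fintype.sum_prod_type]
  refine Finset.sum_congr rfl fun s _ => ?_
  rw [Finset.mul_sum]
  rfl

theorem sum_prod_weights (w : (v : V) → R v → ℝ) (hw : ∀ v, ∑ r, w v r = 1) :
    ∑ s : ((v : V) → R v), ∏ v, w v (s v) = 1 := by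
  rw [← Fintype.piFinset_univ, ← Finset.prod_univ_sum]
  simp [hw]

/-- Functions of disjoint sets of coordinates are independent under a product weight. -/
theorem sum_mul_of_disjoint (w : (v : V) → R v → ℝ) (hw : ∀ v, ∑ r, w v r = 1)
    {X Y : Finset V} (hXY : Disjoint X Y) (g₁ g₂ : ((v : V) → R v) → ℝ)
    (hg₁ : ∀ s t : (v : V) → R v, (∀ v ∈ X, s v = t v) → g₁ s = g₁ t)
    (hg₂ : ∀ s t : (v : V) → R v, (∀ v ∈ Y, s v = t v) → g₂ s = g₂ t) :
    ∑ s, (∏ v ∈ (X ∪ Y)ᶜ, w v (s v)) * (g₁ s * g₂ s) =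
      (∑ s, (∏ v ∈ Xᶜ, w v (s v)) * g₁ s) * ∑ s, (∏ v ∈ Yᶜ, w v (s v)) * g₂ s := by
  -- Exchanging the `Y` coordinates of two independent copies turns the product of two sums into one
  -- sum times the total weight of a spare copy, which is one.
  let e : ((v : V) → R v) × ((v : V) → R v) → ((v : V) → R v) × ((v : V) → R v) :=
    fun p => (Y.piecewise p.2 p.1, Y.piecewise p.1 p.2)
  have he : Function.Involutive e := by
    rintro ⟨s, t⟩
    refine Prod.ext ?_ ?_ <;> funext v <;> by_cases hv : v ∈ Y <;> simp [e, Finset.piecewise, hv]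
  rw [Finset.sum_mul_sum, ← Finset.sum_product', Finset.univ_product_univ,
    ← Equiv.sum_comp he.toPerm]
  have h1 : ∑ s, (∏ v ∈ (X ∪ Y)ᶜ, w v (s v)) * (g₁ s * g₂ s) =
      ∑ p : ((v : V) → R v) × ((v : V) → R v),
        ((∏ v ∈ (X ∪ Y)ᶜ, w v (p.1 v)) * (g₁ p.1 * g₂ p.1)) * ∏ v, w v (p.2 v) := by
    rw [Fintype.sum_prod_type]
    refine Finset.sum_congr rfl fun s _ => ?_
    dsimp only
    rw [← Finset.mul_sum, sum_prod_weights w hw, mul_one]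
  rw [h1]
  refine Finset.sum_congr rfl ?_
  rintro ⟨s, t⟩ -
  show _ = (∏ v ∈ Xᶜ, w v (Y.piecewise t s v)) * g₁ (Y.piecewise t s) *
    ((∏ v ∈ Yᶜ, w v (Y.piecewise s t v)) * g₂ (Y.piecewise s t))
  have e1 : g₁ (Y.piecewise t s) = g₁ s := hg₁ _ _ fun v hv =>
    Finset.piecewise_eq_of_notMem _ _ _ (Finset.disjoint_left.1 hXY hv)
  have e2 : g₂ (Y.piecewise s t) = g₂ s := hg₂ _ _ fun v hv =>
    Finset.piecewise_eq_of_mem _ _ _ hv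
  have e3 : ∏ v ∈ Yᶜ, w v (Y.piecewise s t v) = ∏ v ∈ Yᶜ, w v (t v) :=
    Finset.prod_congr rfl fun v hv => by
      rw [Finset.piecewise_eq_of_notMem _ _ _ (Finset.mem_compl.1 hv)]
  have e4 : ∏ v ∈ Xᶜ, w v (Y.piecewise t s v) =
      (∏ v ∈ Y, w v (t v)) * ∏ v ∈ (X ∪ Y)ᶜ, w v (s v) := by
    have hset : Xᶜ = Y ∪ (X ∪ Y)ᶜ := by
      ext v
      simp only [Finset.mem_compl, Finset.mem_union]
      have := fun h : v ∈ X => Finset.disjoint_left.1 hXY h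
      tauto
    rw [hset, Finset.prod_union]
    · congr 1
      · exact Finset.prod_congr rfl fun v hv => by
          rw [Finset.piecewise_eq_of_mem _ _ _ hv]
      · refine Finset.prod_congr rfl fun v hv => ?_
        rw [Finset.piecewise_eq_of_notMem]
        simp only [Finset.mem_compl, Finset.mem_union] at hv
        tauto
    · rw [Finset.disjoint_left]
      intro v hv h
      simp only [Finset.mem_compl, Finset.mem_union] at h
      tauto
  have e5 : ∏ v, w v (t v) = (∏ v ∈ Y, w v (t v)) * ∏ v ∈ Yᶜ, w v (t v) :=
    (Finset.prod_mul_prod_compl Y _).symm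
  rw [e1, e2, e3, e4, e5]
  ring

end Indep

/-! ### Euclidean norms of finite families. -/

section L2

/-- The Euclidean norm of a finite family of complex numbers. -/
def l2 {ι : Type*} [Fintype ι] (f : ι → ℂ) : ℝ := Real.sqrt (∑ i, ‖f i‖ ^ 2)

variable {ι : Type*} [Fintype ι]

theorem l2_eq_norm (f : ι → ℂ) : l2 f = ‖WithLp.toLp 2 f‖ := by
  rw [EuclideanSpace.norm_eq]; rfl

theorem l2_nonneg (f : ι → ℂ) : 0 ≤ l2 f := Real.sqrt_nonneg _

theorem l2_smul (c : ℂ) (f : ι → ℂ) : l2 (fun i => c * f i) = ‖c‖ * l2 f := by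
  rw [l2_eq_norm, l2_eq_norm, ← norm_smul]
  rfl

theorem l2_sum_le {J : Type*} (t : Finset J) (f : J → ι → ℂ) :
    l2 (fun i => ∑ j ∈ t, f j i) ≤ ∑ j ∈ t, l2 (f j) := by
  simp only [l2_eq_norm]
  refine le_trans (le_of_eq ?_) (norm_sum_le _ _)
  congr 1
  ext i
  simp

end L2

/-! ### Expectation values, open sites and factorization. -/

section Ev

variable {V : Type*} [Fintype V] [DecidableEq V] {d : V → ℕ}

/-- `Tr[(⨂ G_v) ρ]`. -/
def ev (ρ : Matrix (FullConf d) (FullConf d) ℂ)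
    (G : (v : V) → Matrix (Fin (d v)) (Fin (d v)) ℂ) : ℂ :=
  ∑ x : FullConf d, ∑ y : FullConf d, (∏ v, G v (x v) (y v)) * ρ y x

/-- Multiply the operators on the sites in `K` by the matrix units `|a'⟩⟨a|`. -/
def openAt (K : Finset V) (a a' : Conf d K) (G : (v : V) → Matrix (Fin (d v)) (Fin (d v)) ℂ) :
    (v : V) → Matrix (Fin (d v)) (Fin (d v)) ℂ :=
  fun v => if h : v ∈ K then Matrix.single (a' ⟨v, h⟩) (a ⟨v, h⟩) 1 * G v else G v

/-- The Hilbert-Schmidt norm of `Tr_{Kᶜ}[(⨂ G_v) ρ]`. -/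
def nrm (ρ : Matrix (FullConf d) (FullConf d) ℂ) (K : Finset V)
    (G : (v : V) → Matrix (Fin (d v)) (Fin (d v)) ℂ) : ℝ :=
  l2 fun p : Conf d K × Conf d K => ev ρ (openAt K p.1 p.2 G)

/-- Replace the operators off `X` by the identity. -/
def onSet (X : Finset V) (G : (v : V) → Matrix (Fin (d v)) (Fin (d v)) ℂ) :
    (v : V) → Matrix (Fin (d v)) (Fin (d v)) ℂ :=
  fun v => if v ∈ X then G v else 1

variable (ρ : Matrix (FullConf d) (FullConf d) ℂ)

theorem ev_smul (c : V → ℂ) (G : (v : V) → Matrix (Fin (d v)) (Fin (d v)) ℂ) :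
    ev ρ (fun v => c v • G v) = (∏ v, c v) * ev ρ G := by
  simp only [ev, Matrix.smul_apply, smul_eq_mul, Finset.prod_mul_distrib, Finset.mul_sum,
    mul_assoc]

theorem openAt_smul (K : Finset V) (a a' : Conf d K) (c : V → ℂ)
    (G : (v : V) → Matrix (Fin (d v)) (Fin (d v)) ℂ) :
    openAt K a a' (fun v => c v • G v) = fun v => c v • openAt K a a' G v := by
  funext v
  by_cases h : v ∈ K <;> simp [openAt, h]

theorem nrm_smul (K : Finset V) (c : V → ℂ) (G : (v : V) → Matrix (Fin (d v)) (Fin (d v)) ℂ) :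
    nrm ρ K (fun v => c v • G v) = ‖∏ v, c v‖ * nrm ρ K G := by
  simp only [nrm, openAt_smul, ev_smul, l2_smul]

theorem nrm_nonneg (K : Finset V) (G : (v : V) → Matrix (Fin (d v)) (Fin (d v)) ℂ) :
    0 ≤ nrm ρ K G := l2_nonneg _

theorem nrm_empty (G : (v : V) → Matrix (Fin (d v)) (Fin (d v)) ℂ) :
    nrm ρ ∅ G = ‖ev ρ G‖ := by
  have hG : ∀ p : Conf d (∅ : Finset V) × Conf d (∅ : Finset V), openAt ∅ p.1 p.2 G = G := by
    intro p; funext v; simp [openAt]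
  have : IsEmpty {v // v ∈ (∅ : Finset V)} := ⟨fun v => Finset.notMem_empty _ v.2⟩
  simp only [nrm, hG, l2]
  rw [Fintype.sum_prod_type, Fintype.sum_unique, Fintype.sum_unique, Real.sqrt_sq (norm_nonneg _)]

theorem eq_smul_onSet (Z : Finset V) (c : V → ℂ)
    (G : (v : V) → Matrix (Fin (d v)) (Fin (d v)) ℂ) (hG : ∀ v ∈ Z, G v = c v • 1) :
    G = fun v => (if v ∈ Z then c v else 1) • onSet Zᶜ G v := by
  funext v
  by_cases h : v ∈ Z <;> simp [onSet, h, hG]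

/-- Scalar operators come out of the norm as their absolute values, even on open sites, since
opening multiplies them by matrix units. -/
theorem nrm_of_scalar (K Z : Finset V) (c : V → ℂ)
    (G : (v : V) → Matrix (Fin (d v)) (Fin (d v)) ℂ) (hG : ∀ v ∈ Z, G v = c v • 1) :
    nrm ρ K G = (∏ v ∈ Z, ‖c v‖) * nrm ρ K (onSet Zᶜ G) := by
  conv_lhs => rw [eq_smul_onSet Z c G hG]
  rw [nrm_smul, norm_prod]
  congr 1
  rw [← Finset.univ_inter Z, ← Finset.prod_ite_mem]
  refine Finset.prod_congr rfl fun v _ => ?_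
  by_cases hv : v ∈ Z <;> simp [hv]

theorem ev_of_scalar (Z : Finset V) (c : V → ℂ)
    (G : (v : V) → Matrix (Fin (d v)) (Fin (d v)) ℂ) (hG : ∀ v ∈ Z, G v = c v • 1) :
    ev ρ G = (∏ v ∈ Z, c v) * ev ρ (onSet Zᶜ G) := by
  conv_lhs => rw [eq_smul_onSet Z c G hG]
  rw [ev_smul]
  congr 1
  rw [Finset.prod_ite_mem, Finset.univ_inter]

/-- Splitting a configuration into its parts on and off `X`. -/
def glueEquiv (X : Finset V) : Conf d X × Conf d Xᶜ ≃ FullConf d where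
  toFun p := glue p.1 p.2
  invFun x := (fun v => x v, fun v => x v)
  left_inv := by
    rintro ⟨s, r⟩
    refine Prod.ext ?_ ?_ <;> funext v
    · simp [glue, v.2]
    · simp [glue, Finset.mem_compl.1 v.2]
  right_inv x := by
    funext v
    by_cases h : v ∈ X <;> simp [glue, h]

theorem glue_mem {X : Finset V} (s : Conf d X) (r : Conf d Xᶜ) (v : {v // v ∈ X}) :
    glue s r v = s v := by simp [glue, v.2]

theorem glue_notMem {X : Finset V} (s : Conf d X) (r : Conf d Xᶜ) (v : {v // v ∈ Xᶜ}) :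
    glue s r v = r v := by simp [glue, Finset.mem_compl.1 v.2]

theorem prod_eq_prod_mem_mul {M : Type*} [CommMonoid M] (X : Finset V) (g : V → M) :
    ∏ v, g v = (∏ v : {v // v ∈ X}, g v) * ∏ v : {v // v ∈ Xᶜ}, g v := by
  rw [← Finset.prod_mul_prod_compl X, ← Finset.prod_coe_sort X, ← Finset.prod_coe_sort Xᶜ]

theorem prod_one_apply {ι : Type*} [Fintype ι] {n : ι → ℕ} (x y : (i : ι) → Fin (n i)) :
    ∏ i, (1 : Matrix (Fin (n i)) (Fin (n i)) ℂ) (x i) (y i) = if x = y then 1 else 0 := by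
  classical
  simp only [Matrix.one_apply]
  rw [Finset.prod_ite_zero]
  simp [funext_iff]

/-- Identity operators off `X` force the two configurations to agree there, which is the partial
trace. In this form the hypothesis on reduced states can be applied. -/
theorem ev_eq_sum_reduced (X : Finset V) (G : (v : V) → Matrix (Fin (d v)) (Fin (d v)) ℂ)
    (hG : ∀ v ∉ X, G v = 1) :
    ev ρ G = ∑ s : Conf d X, ∑ t : Conf d X,
      (∏ v : {v // v ∈ X}, G v (s v) (t v)) * reduced ρ X t s := by
  have hprod : ∀ (s t : Conf d X) (r r' : Conf d Xᶜ),
      ∏ v, G v (glue s r v) (glue t r' v) =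
        (∏ v : {v // v ∈ X}, G v (s v) (t v)) * if r = r' then 1 else 0 := by
    intro s t r r'
    rw [prod_eq_prod_mem_mul X]
    congr 1
    · exact Finset.prod_congr rfl fun v _ => by rw [glue_mem, glue_mem]
    · rw [← prod_one_apply]
      refine Finset.prod_congr rfl fun v _ => ?_
      rw [glue_notMem, glue_notMem, hG _ (Finset.mem_compl.1 v.2)]
  unfold ev
  rw [← Equiv.sum_comp (glueEquiv X), Fintype.sum_prod_type]
  refine Finset.sum_congr rfl fun s _ => ?_
  have h1 : ∀ r : Conf d Xᶜ, ∑ y, (∏ v, G v (glueEquiv X (s, r) v) (y v)) * ρ y (glueEquiv X (s, r))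
      = ∑ t : Conf d X, (∏ v : {v // v ∈ X}, G v (s v) (t v)) * ρ (glue t r) (glue s r) := by
    intro r
    rw [← Equiv.sum_comp (glueEquiv X), Fintype.sum_prod_type]
    refine Finset.sum_congr rfl fun t _ => ?_
    change ∑ r', (∏ v, G v (glue s r v) (glue t r' v)) * ρ (glue t r') (glue s r) = _
    simp [hprod]
  simp only [h1]
  rw [Finset.sum_comm]
  simp only [reduced, Finset.mul_sum]

/-- Product operators on uncorrelated regions. -/
theorem ev_mul_of_strictlyLocal {Λ : SimpleGraph V} (hloc : StrictlyLocal Λ ρ) {X Y : Finset V}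
    (hXY : Disjoint X Y) (hΛ : ∀ x ∈ X, ∀ y ∈ Y, ¬ Λ.Adj x y)
    (G : (v : V) → Matrix (Fin (d v)) (Fin (d v)) ℂ) (hG : ∀ v ∉ X ∪ Y, G v = 1) :
    ev ρ G = ev ρ (onSet X G) * ev ρ (onSet Y G) := by
  rw [ev_eq_sum_reduced ρ (X ∪ Y) G hG,
    ev_eq_sum_reduced ρ X (onSet X G) (fun v hv => by simp [onSet, hv]),
    ev_eq_sum_reduced ρ Y (onSet Y G) (fun v hv => by simp [onSet, hv])]
  let e := Equiv.piFinsetUnion (fun v => Fin (d v)) hXY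
  have heX : ∀ (p : Conf d X × Conf d Y) (v : {v // v ∈ X}),
      e p ⟨v, Finset.mem_union_left Y v.2⟩ = p.1 v := fun p v =>
    Equiv.piFinsetUnion_left _ hXY v.2 (Finset.mem_union_left Y v.2)
  have heY : ∀ (p : Conf d X × Conf d Y) (v : {v // v ∈ Y}),
      e p ⟨v, Finset.mem_union_right X v.2⟩ = p.2 v := fun p v =>
    Equiv.piFinsetUnion_right _ hXY v.2 (Finset.mem_union_right X v.2)
  have hprod : ∀ p q : Conf d X × Conf d Y,
      ∏ v : {v // v ∈ X ∪ Y}, G v (e p v) (e q v) =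
        (∏ v : {v // v ∈ X}, onSet X G v (p.1 v) (q.1 v)) *
          ∏ v : {v // v ∈ Y}, onSet Y G v (p.2 v) (q.2 v) := by
    intro p q
    let g : V → ℂ := fun v => if h : v ∈ X ∪ Y then G v (e p ⟨v, h⟩) (e q ⟨v, h⟩) else 1
    have h1 : ∏ v : {v // v ∈ X ∪ Y}, G v (e p v) (e q v) = ∏ v ∈ X ∪ Y, g v := by
      rw [← Finset.prod_coe_sort (X ∪ Y) g]
      refine Finset.prod_congr rfl fun v _ => ?_
      simp only [g]
      rw [dif_pos v.2]
    rw [h1, Finset.prod_union hXY, ← Finset.prod_coe_sort X, ← Finset.prod_coe_sort Y]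
    congr 1
    · refine Finset.prod_congr rfl fun v _ => ?_
      rw [← heX p v, ← heX q v]
      simp [g, v.2, onSet]
    · refine Finset.prod_congr rfl fun v _ => ?_
      rw [← heY p v, ← heY q v]
      simp [g, v.2, onSet]
  have hred : ∀ p q : Conf d X × Conf d Y, reduced ρ (X ∪ Y) (e q) (e p) =
      reduced ρ X q.1 p.1 * reduced ρ Y q.2 p.2 := by
    intro p q
    rw [hloc X Y hXY hΛ]
    congr 1
    · congr 1 <;> funext v <;> exact heX _ v
    · congr 1 <;> funext v <;> exact heY _ v
  rw [← Equiv.sum_comp e]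
  simp only [← Equiv.sum_comp e (fun t => _ * reduced ρ (X ∪ Y) t _), hprod, hred,
    Fintype.sum_prod_type, Finset.sum_mul_sum]
  refine Finset.sum_congr rfl fun s _ => Finset.sum_congr rfl fun s' _ =>
    Finset.sum_congr rfl fun t _ => Finset.sum_congr rfl fun t' _ => ?_
  ring

end Ev

/-! ### Second moments of a 2-design measurement. -/

section Design

variable {n R ι : Type*} [Fintype n] [DecidableEq n] [Nonempty n] [Fintype R] [Fintype ι]

theorem norm_sq_eq_mul_conj (z : ℂ) : ((‖z‖ ^ 2 : ℝ) : ℂ) = z * star z := by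
  rw [Complex.star_def, Complex.mul_conj, Complex.normSq_eq_norm_sq]

theorem IsPOVM.trace_eq {F : R → Matrix n n ℂ} (hF : IsPOVM F) {w : R → ℝ}
    (hw : ∀ r, w r = (F r).trace.re / Fintype.card n) (r : R) :
    (F r).trace = (Fintype.card n : ℂ) * w r := by
  have h1 := (hF.posSemidef r).trace_nonneg
  have h2 : ((F r).trace.re : ℂ) = (F r).trace := by
    rw [Complex.le_def] at h1
    exact Complex.ext rfl h1.2
  have h3 : (Fintype.card n : ℂ) ≠ 0 := Nat.cast_ne_zero.2 Fintype.card_ne_zero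
  rw [hw, Complex.ofReal_div, h2, Complex.ofReal_natCast, mul_div_cancel₀ _ h3]

theorem IsPOVM.weight_nonneg {F : R → Matrix n n ℂ} (hF : IsPOVM F) {w : R → ℝ}
    (hw : ∀ r, w r = (F r).trace.re / Fintype.card n) (r : R) : 0 ≤ w r := by
  have h1 := (hF.posSemidef r).trace_nonneg
  rw [Complex.le_def] at h1
  rw [hw]
  exact div_nonneg h1.1 (Nat.cast_nonneg _)

theorem IsPOVM.sum_weight {F : R → Matrix n n ℂ} (hF : IsPOVM F) {w : R → ℝ}
    (hw : ∀ r, w r = (F r).trace.re / Fintype.card n) : ∑ r, w r = 1 := by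
  have h3 : (Fintype.card n : ℝ) ≠ 0 := Nat.cast_ne_zero.2 Fintype.card_ne_zero
  have h4 : ∑ r, (F r).trace.re = Fintype.card n := by
    rw [← Complex.re_sum, ← Matrix.trace_sum, hF.sum_eq_one, Matrix.trace_one]
    simp
  simp only [hw]
  rw [← Finset.sum_div, h4, div_self h3]

theorem IsPOVM.eq_zero {F : R → Matrix n n ℂ} (hF : IsPOVM F) {w : R → ℝ}
    (hw : ∀ r, w r = (F r).trace.re / Fintype.card n) {r : R} (hr : w r = 0) : F r = 0 := by
  rw [← (hF.posSemidef r).trace_eq_zero_iff, hF.trace_eq hw, hr]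
  simp

/-- Second moment of the traceless parts of the elements of a 2-design POVM. -/
theorem sum_traceless_mul_star {F : R → Matrix n n ℂ} (hF : IsPOVM F) (hF₂ : IsTwoDesignPOVM F)
    {w : R → ℝ} (hw : ∀ r, w r = (F r).trace.re / Fintype.card n) (p q : n × n) :
    ∑ r, (w r : ℂ)⁻¹ * ((F r - (w r : ℂ) • 1) p.1 p.2 * star ((F r - (w r : ℂ) • 1) q.1 q.2)) =
      (Fintype.card n : ℂ) / (Fintype.card n + 1) * (if p = q then 1 else 0) -
        ((Fintype.card n : ℂ) + 1)⁻¹ * ((if p.1 = p.2 then 1 else 0) *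
          (if q.1 = q.2 then 1 else 0)) := by
  obtain ⟨i, j⟩ := p
  obtain ⟨k, l⟩ := q
  have hD : (Fintype.card n : ℂ) ≠ 0 := Nat.cast_ne_zero.2 Fintype.card_ne_zero
  have hD1 : (Fintype.card n : ℂ) + 1 ≠ 0 := by
    exact_mod_cast Nat.succ_ne_zero (Fintype.card n)
  set D : ℂ := (Fintype.card n : ℂ) with hDdef
  -- The `((i, l), (j, k))` entry of the design identity. The second tensor factor carries the
  -- transposed index pair, since `F r` is Hermitian and `star (F r k l) = F r l k`.
  have hQ : ∑ r, (w r : ℂ)⁻¹ * (F r i j * F r l k) =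
      D / (D + 1) * ((if i = j then 1 else 0) * (if k = l then 1 else 0) +
        if i = k ∧ j = l then 1 else 0) := by
    have h1 := congrFun (congrFun hF₂ (i, l)) (j, k)
    simp only [povmSecondMoment, Matrix.smul_apply, Matrix.sum_apply, Matrix.kroneckerMap_apply,
      Matrix.add_apply, swapOp, Matrix.one_apply, smul_eq_mul, Prod.mk.injEq,
      ← hDdef] at h1
    have h2 : ∀ r, (F r).trace * ((F r).trace⁻¹ * F r i j * ((F r).trace⁻¹ * F r l k)) =
        D⁻¹ * ((w r : ℂ)⁻¹ * (F r i j * F r l k)) := by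
      intro r
      rw [hF.trace_eq hw r, ← hDdef, mul_inv]
      by_cases h0 : (w r : ℂ) = 0
      · simp [h0]
      · field_simp
    simp only [h2, ← Finset.mul_sum] at h1
    have h3 : ∑ r, (w r : ℂ)⁻¹ * (F r i j * F r l k) = D * D * (D⁻¹ * (D⁻¹ *
        ∑ r, (w r : ℂ)⁻¹ * (F r i j * F r l k))) := by field_simp
    rw [h3, h1]
    have h4 : (if i = j ∧ l = k then (1 : ℂ) else 0) =
        (if i = j then 1 else 0) * (if k = l then 1 else 0) := by
      by_cases ha : i = j <;> by_cases hb : k = l <;> simp [ha, hb, eq_comm]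
    have h5 : (if i = k ∧ l = j then (1 : ℂ) else 0) = if i = k ∧ j = l then 1 else 0 := by
      simp only [eq_comm]
    rw [h4, h5]
    field_simp
  have hterm : ∀ r, (w r : ℂ)⁻¹ *
      ((F r - (w r : ℂ) • 1) i j * star ((F r - (w r : ℂ) • 1) k l)) =
      (w r : ℂ)⁻¹ * (F r i j * F r l k) - (if i = j then 1 else 0) * F r l k -
        (if k = l then 1 else 0) * F r i j +
        (w r : ℂ) * ((if i = j then 1 else 0) * (if k = l then 1 else 0)) := by
    intro r
    have hst : star (F r k l) = F r l k := (hF.posSemidef r).1.apply l k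
    simp only [Matrix.sub_apply, Matrix.smul_apply, Matrix.one_apply, smul_eq_mul, star_sub, hst,
      star_mul']
    have h1 : star (w r : ℂ) = (w r : ℂ) := Complex.conj_ofReal _
    have h2 : star (if k = l then (1 : ℂ) else 0) = if k = l then 1 else 0 := by
      split_ifs <;> simp
    rw [h1, h2]
    by_cases h0 : w r = 0
    · have := hF.eq_zero hw h0
      simp [h0, this]
    · have h0' : (w r : ℂ) ≠ 0 := by exact_mod_cast h0
      field_simp
      ring
  have hsum : ∀ a b, ∑ r, F r a b = if a = b then 1 else 0 := by
    intro a b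
    rw [← Matrix.sum_apply, hF.sum_eq_one, Matrix.one_apply]
  have hw1 : ∑ r, (w r : ℂ) = 1 := by exact_mod_cast hF.sum_weight hw
  simp only [hterm, Finset.sum_add_distrib, Finset.sum_sub_distrib, ← Finset.mul_sum,
    ← Finset.sum_mul, hsum, hw1, hQ, Prod.mk.injEq]
  have h4 : (if l = k then (1 : ℂ) else 0) = if k = l then 1 else 0 := by simp only [eq_comm]
  rw [h4]
  field_simp
  ring

/-- Measuring the traceless part of an operator with a 2-design, on average over the outcomes,
does not increase its Hilbert-Schmidt norm. -/
theorem sum_l2_traceless_le {F : R → Matrix n n ℂ} (hF : IsPOVM F) (hF₂ : IsTwoDesignPOVM F)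
    {w : R → ℝ} (hw : ∀ r, w r = (F r).trace.re / Fintype.card n) (M : n × n → ι → ℂ) :
    ∑ r, l2 (fun e => ∑ p, (F r - (w r : ℂ) • 1) p.1 p.2 * M p e) ≤
      l2 (fun p : (n × n) × ι => M p.1 p.2) := by
  set Φ : R → n × n → ℂ := fun r p => (F r - (w r : ℂ) • 1) p.1 p.2 with hΦ
  have hw0 := hF.weight_nonneg hw
  -- With `n` the dimension, the second moment is `n/(n+1)` times the squared norm minus `1/(n+1)`
  -- times the squared modulus of the diagonal sum; both corrections only help.
  have hmoment : ∀ e, ∑ r, (w r)⁻¹ * ‖∑ p, Φ r p * M p e‖ ^ 2 ≤ ∑ p, ‖M p e‖ ^ 2 := by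
    intro e
    have hc : ((∑ r, (w r)⁻¹ * ‖∑ p, Φ r p * M p e‖ ^ 2 : ℝ) : ℂ) =
        (((Fintype.card n : ℝ) / (Fintype.card n + 1) * ∑ p, ‖M p e‖ ^ 2 -
          ((Fintype.card n : ℝ) + 1)⁻¹ * ‖∑ i, M (i, i) e‖ ^ 2 : ℝ) : ℂ) := by
      have h1 : ∀ r, (((w r)⁻¹ * ‖∑ p, Φ r p * M p e‖ ^ 2 : ℝ) : ℂ) =
          ∑ p, ∑ q, ((w r : ℂ)⁻¹ * (Φ r p * star (Φ r q))) * (M p e * star (M q e)) := by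
        intro r
        rw [Complex.ofReal_mul, norm_sq_eq_mul_conj, Complex.ofReal_inv, star_sum,
          Finset.sum_mul_sum, Finset.mul_sum]
        refine Finset.sum_congr rfl fun p _ => ?_
        rw [Finset.mul_sum]
        refine Finset.sum_congr rfl fun q _ => ?_
        rw [star_mul']
        ring
      rw [Complex.ofReal_sum]
      simp only [h1]
      rw [Finset.sum_comm]
      have h2 : ∀ p, ∑ r, ∑ q, ((w r : ℂ)⁻¹ * (Φ r p * star (Φ r q))) * (M p e * star (M q e)) =
          ∑ q, ((Fintype.card n : ℂ) / (Fintype.card n + 1) * (if p = q then 1 else 0) -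
            ((Fintype.card n : ℂ) + 1)⁻¹ * ((if p.1 = p.2 then 1 else 0) *
              (if q.1 = q.2 then 1 else 0))) * (M p e * star (M q e)) := by
        intro p
        rw [Finset.sum_comm]
        refine Finset.sum_congr rfl fun q _ => ?_
        rw [← Finset.sum_mul, ← sum_traceless_mul_star hF hF₂ hw p q]
      simp only [h2, sub_mul, Finset.sum_sub_distrib]
      rw [Complex.ofReal_sub]
      congr 1
      · rw [Complex.ofReal_mul, Complex.ofReal_sum, Finset.mul_sum]
        refine Finset.sum_congr rfl fun p _ => ?_
        rw [norm_sq_eq_mul_conj, Finset.sum_eq_single p]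
        · push_cast
          simp
        · intro q _ hq
          rw [if_neg hq.symm]; ring
        · intro h; exact absurd (Finset.mem_univ p) h
      · rw [Complex.ofReal_mul, norm_sq_eq_mul_conj, star_sum, Finset.sum_mul_sum]
        have h3 : ∀ g : n × n → ℂ, ∑ p : n × n, (if p.1 = p.2 then 1 else 0) * g p =
            ∑ i, g (i, i) := by
          intro g
          rw [Fintype.sum_prod_type]
          simp
        push_cast
        rw [Finset.mul_sum, ← h3 (fun p => ((Fintype.card n : ℂ) + 1)⁻¹ *
          ∑ j, M p e * star (M (j, j) e))]
        refine Finset.sum_congr rfl fun p _ => ?_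
        rw [← h3 (fun q => M p e * star (M q e)), Finset.mul_sum, Finset.mul_sum]
        refine Finset.sum_congr rfl fun q _ => ?_
        ring
    have hr := Complex.ofReal_injective hc
    rw [hr]
    have hN : (0 : ℝ) ≤ Fintype.card n := Nat.cast_nonneg _
    have h1 : (Fintype.card n : ℝ) / (Fintype.card n + 1) ≤ 1 :=
      (div_le_one (by linarith)).2 (by linarith)
    have h2 : 0 ≤ ∑ p, ‖M p e‖ ^ 2 := Finset.sum_nonneg fun _ _ => by positivity
    have h3 : 0 ≤ ((Fintype.card n : ℝ) + 1)⁻¹ * ‖∑ i, M (i, i) e‖ ^ 2 := by positivity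
    nlinarith
  -- Splitting off `√w` prepares Cauchy-Schwarz against the weights, which sum to one. An outcome of
  -- weight zero has `F r = 0`, so the convention `0⁻¹ = 0` is harmless.
  have hsplit : ∀ r, l2 (fun e => ∑ p, Φ r p * M p e) =
      Real.sqrt (w r) * Real.sqrt ((w r)⁻¹ * ∑ e, ‖∑ p, Φ r p * M p e‖ ^ 2) := by
    intro r
    rw [← Real.sqrt_mul (hw0 r)]
    by_cases h0 : w r = 0
    · have hz := hF.eq_zero hw h0
      simp [l2, hΦ, h0, hz]
    · rw [mul_inv_cancel_left₀ h0]; rfl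
  calc ∑ r, l2 (fun e => ∑ p, Φ r p * M p e)
      = ∑ r, Real.sqrt (w r) * Real.sqrt ((w r)⁻¹ * ∑ e, ‖∑ p, Φ r p * M p e‖ ^ 2) :=
        Finset.sum_congr rfl fun r _ => hsplit r
    _ ≤ Real.sqrt (∑ r, w r) *
          Real.sqrt (∑ r, (w r)⁻¹ * ∑ e, ‖∑ p, Φ r p * M p e‖ ^ 2) :=
        Real.sum_sqrt_mul_sqrt_le _ (fun r => hw0 r) fun r =>
          mul_nonneg (inv_nonneg.2 (hw0 r)) (Finset.sum_nonneg fun _ _ => by positivity)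
    _ ≤ _ := by
        rw [hF.sum_weight hw, Real.sqrt_one, one_mul]
        refine Real.sqrt_le_sqrt ?_
        simp only [Finset.mul_sum]
        rw [Finset.sum_comm, Fintype.sum_prod_type, Finset.sum_comm (s := Finset.univ (α := n × n))]
        exact Finset.sum_le_sum fun e _ => hmoment e

end Design

/-! ### Purity of complementary parts of a pure state. -/

section Purity

variable {α μ ε : Type*} [Fintype α] [Fintype μ] [Fintype ε]

theorem sum_comm_four {β γ M : Type*} [Fintype β] [AddCommMonoid M] [Fintype γ]
    (F : α → β → μ → γ → M) :
    ∑ a, ∑ b, ∑ m, ∑ e, F a b m e = ∑ m, ∑ e, ∑ a, ∑ b, F a b m e := by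
  rw [Finset.sum_congr rfl fun a _ => Finset.sum_comm (s := Finset.univ (α := β))]
  rw [Finset.sum_comm]
  refine Finset.sum_congr rfl fun m _ => ?_
  rw [Finset.sum_congr rfl fun a _ => Finset.sum_comm (s := Finset.univ (α := β))]
  rw [Finset.sum_comm]

/-- The two reduced states of a pure state have the same purity. -/
theorem l2_mul_conjTranspose (χ : μ → ε → ℂ) :
    l2 (fun p : μ × μ => ∑ e, χ p.1 e * star (χ p.2 e)) =
      l2 (fun p : ε × ε => ∑ m, χ m p.1 * star (χ m p.2)) := by
  unfold l2
  congr 1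
  apply Complex.ofReal_injective
  simp only [Complex.ofReal_sum, norm_sq_eq_mul_conj, star_sum, Finset.sum_mul_sum,
    Fintype.sum_prod_type, star_mul', star_star]
  rw [sum_comm_four]
  refine Finset.sum_congr rfl fun e _ => Finset.sum_congr rfl fun e' _ =>
    Finset.sum_congr rfl fun m _ => Finset.sum_congr rfl fun m' _ => ?_
  ring

/-- If the parts `α` and `ε` of a pure state are uncorrelated, then a measurement of `α` leaves
the rest of the system in a state that is at most as mixed as that of `ε` (in the
Hilbert-Schmidt norm). -/
theorem l2_le_of_uncorrelated (ψ : α → μ → ε → ℂ) (B Rα : α → α → ℂ) (σ : ε → ε → ℂ)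
    (hσ : ∑ e, σ e e = 1)
    (hψ : ∀ a a' e e', ∑ m, ψ a' m e' * star (ψ a m e) = Rα a' a * σ e' e) :
    l2 (fun p : μ × μ => ∑ a, ∑ a', (∑ b, star (B b a) * B b a') *
        ∑ e, ψ a' p.1 e * star (ψ a p.2 e)) ≤
      (∑ a, ∑ a', (∑ b, star (B b a) * B b a') * Rα a' a).re *
        l2 (fun p : ε × ε => σ p.1 p.2) := by
  -- `χ b` is the unnormalized pure state after the Kraus operator `⟨b|B` acts on `α`, and `p b` is
  -- its squared norm.
  let χ : α → μ → ε → ℂ := fun b m e => ∑ a, B b a * ψ a m e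
  let p : α → ℂ := fun b => ∑ a, ∑ a', star (B b a) * B b a' * Rα a' a
  have hχ : ∀ b m m' e e', χ b m e * star (χ b m' e') =
      ∑ a, ∑ a', star (B b a) * B b a' * (ψ a' m e * star (ψ a m' e')) := by
    intro b m m' e e'
    simp only [χ, star_sum, Finset.sum_mul_sum, star_mul']
    rw [Finset.sum_comm]
    refine Finset.sum_congr rfl fun a _ => Finset.sum_congr rfl fun a' _ => ?_
    ring
  -- Without correlations between `α` and `ε`, the outcome only rescales the state of `ε`. By purity
  -- the norm on `μ` is then `p b` times that of `σ`, and the triangle inequality sums over `b`.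
  have hE : ∀ b e' e, ∑ m, χ b m e' * star (χ b m e) = p b * σ e' e := by
    intro b e' e
    simp only [hχ, p, Finset.sum_mul]
    rw [Finset.sum_comm]
    refine Finset.sum_congr rfl fun a _ => ?_
    rw [Finset.sum_comm]
    refine Finset.sum_congr rfl fun a' _ => ?_
    rw [← Finset.mul_sum, hψ]
    ring
  have hp : ∀ b, ‖p b‖ = (p b).re := by
    intro b
    have h1 : p b = ((∑ e, ∑ m, ‖χ b m e‖ ^ 2 : ℝ) : ℂ) := by
      simp only [Complex.ofReal_sum, norm_sq_eq_mul_conj, hE, ← Finset.mul_sum, hσ, mul_one]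
    rw [h1, Complex.norm_real, Complex.ofReal_re, Real.norm_of_nonneg]
    exact Finset.sum_nonneg fun _ _ => Finset.sum_nonneg fun _ _ => by positivity
  have hX : (fun q : μ × μ => ∑ a, ∑ a', (∑ b, star (B b a) * B b a') *
        ∑ e, ψ a' q.1 e * star (ψ a q.2 e)) =
      fun q : μ × μ => ∑ b, ∑ e, χ b q.1 e * star (χ b q.2 e) := by
    funext q
    simp only [hχ]
    rw [← sum_comm_four]
    refine Finset.sum_congr rfl fun a _ => Finset.sum_congr rfl fun a' _ => ?_
    rw [Finset.sum_mul_sum]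
  have hre : (∑ a, ∑ a', (∑ b, star (B b a) * B b a') * Rα a' a).re = ∑ b, (p b).re := by
    rw [← Complex.re_sum]
    congr 1
    simp only [p, Finset.sum_mul]
    rw [Finset.sum_congr rfl fun a _ => Finset.sum_comm (s := Finset.univ (α := α))]
    rw [Finset.sum_comm]
  rw [hX, hre, Finset.sum_mul]
  refine (l2_sum_le _ _).trans (Finset.sum_le_sum fun b _ => ?_)
  rw [l2_mul_conjTranspose]
  simp only [hE]
  rw [l2_smul, hp]

end Purity

/-! ### Transfer of purity from a remote region to the open sites. -/

section PurityBound

variable {V : Type*} [Fintype V] [DecidableEq V] {d : V → ℕ}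

/-- Assemble a configuration from its parts on `K`, on `E` and on the remaining sites. -/
def join (K E : Finset V) (i : Conf d (K ∪ E)ᶜ) (k : Conf d K) (e : Conf d E) : FullConf d :=
  fun v => if hK : v ∈ K then k ⟨v, hK⟩ else if hE : v ∈ E then e ⟨v, hE⟩ else
    i ⟨v, by simp [hK, hE]⟩

theorem join_left {K E : Finset V} (i : Conf d (K ∪ E)ᶜ) (k : Conf d K) (e : Conf d E)
    (v : {v // v ∈ K}) : join K E i k e v = k v := by simp [join, v.2]

theorem join_right {K E : Finset V} (hKE : Disjoint K E) (i : Conf d (K ∪ E)ᶜ) (k : Conf d K)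
    (e : Conf d E) (v : {v // v ∈ E}) : join K E i k e v = e v := by
  have h : (v : V) ∉ K := Finset.disjoint_right.1 hKE v.2
  simp [join, h, v.2]

theorem join_rest {K E : Finset V} (i : Conf d (K ∪ E)ᶜ) (k : Conf d K)
    (e : Conf d E) (v : {v // v ∈ (K ∪ E)ᶜ}) : join K E i k e v = i v := by
  have h := v.2
  simp only [Finset.mem_compl, Finset.mem_union, not_or] at h
  simp [join, h.1, h.2]

/-- The equivalence underlying `join`. -/
def joinEquiv {K E : Finset V} (hKE : Disjoint K E) :
    Conf d (K ∪ E)ᶜ × Conf d K × Conf d E ≃ FullConf d where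
  toFun p := join K E p.1 p.2.1 p.2.2
  invFun x := (fun v => x v, fun v => x v, fun v => x v)
  left_inv := by
    rintro ⟨i, k, e⟩
    refine Prod.ext ?_ (Prod.ext ?_ ?_) <;> funext v
    · exact join_rest i k e v
    · exact join_left i k e v
    · exact join_right hKE i k e v
  right_inv x := by
    funext v
    simp only [join]
    split_ifs <;> rfl

theorem sum_join {M : Type*} [AddCommMonoid M] {K E : Finset V} (hKE : Disjoint K E)
    (g : FullConf d → M) : ∑ x, g x = ∑ i, ∑ k, ∑ e, g (join K E i k e) := by
  rw [← Equiv.sum_comp (joinEquiv hKE), Fintype.sum_prod_type]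
  refine Finset.sum_congr rfl fun i _ => ?_
  rw [Fintype.sum_prod_type]
  rfl

theorem prod_join {M : Type*} [CommMonoid M] {K E : Finset V} (hKE : Disjoint K E) (g : V → M) :
    ∏ v, g v = (∏ v : {v // v ∈ (K ∪ E)ᶜ}, g v) * ((∏ v : {v // v ∈ K}, g v) *
      ∏ v : {v // v ∈ E}, g v) := by
  rw [← Finset.prod_compl_mul_prod (K ∪ E), Finset.prod_union hKE,
    ← Finset.prod_coe_sort (K ∪ E)ᶜ, ← Finset.prod_coe_sort K, ← Finset.prod_coe_sort E]

/-- Uncorrelated regions, in terms of the amplitudes of the state. -/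
theorem sum_join_mul_star {Λ : SimpleGraph V} {Ψ : FullConf d → ℂ}
    (hloc : StrictlyLocal Λ (pureState Ψ)) {K E : Finset V} (hKE : Disjoint K E)
    (hΛ : ∀ x ∈ (K ∪ E)ᶜ, ∀ y ∈ E, ¬ Λ.Adj x y) (i i' : Conf d (K ∪ E)ᶜ) (e e' : Conf d E) :
    ∑ k, Ψ (join K E i' k e') * star (Ψ (join K E i k e)) =
      reduced (pureState Ψ) (K ∪ E)ᶜ i' i * reduced (pureState Ψ) E e' e := by
  have hdisj : Disjoint (K ∪ E)ᶜ E := by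
    rw [Finset.disjoint_left]
    intro v hv hE
    simp only [Finset.mem_compl, Finset.mem_union] at hv
    tauto
  let u : Conf d (K ∪ E)ᶜ → Conf d E → Conf d ((K ∪ E)ᶜ ∪ E) := fun i e v =>
    if hE : v.1 ∈ E then e ⟨v, hE⟩ else i ⟨v, by
      rcases Finset.mem_union.1 v.2 with h | h
      · exact h
      · exact absurd h hE⟩
  have huI : ∀ i e (v : {v // v ∈ (K ∪ E)ᶜ}), u i e ⟨v, Finset.mem_union_left E v.2⟩ = i v := by
    intro i e v
    simp [u, Finset.disjoint_left.1 hdisj v.2]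
  have huE : ∀ i e (v : {v // v ∈ E}), u i e ⟨v, Finset.mem_union_right _ v.2⟩ = e v := by
    intro i e v
    simp [u, v.2]
  have h1 := hloc (K ∪ E)ᶜ E hdisj hΛ (u i' e') (u i e)
  have h2 : ∀ i e, (fun v : {v // v ∈ (K ∪ E)ᶜ} => u i e ⟨v, Finset.mem_union_left E v.2⟩) = i :=
    fun i e => funext fun v => huI i e v
  have h3 : ∀ i e, (fun v : {v // v ∈ E} => u i e ⟨v, Finset.mem_union_right _ v.2⟩) = e :=
    fun i e => funext fun v => huE i e v
  rw [h2, h2, h3, h3] at h1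
  rw [← h1]
  -- Tracing out the complement of the two uncorrelated regions is the same as tracing out `K`; only
  -- the index type differs.
  have hmem : ∀ v, v ∈ K ↔ v ∈ ((K ∪ E)ᶜ ∪ E)ᶜ := by
    intro v
    have := fun h : v ∈ K => Finset.disjoint_left.1 hKE h
    simp only [Finset.mem_compl, Finset.mem_union]
    tauto
  let c : Conf d K ≃ Conf d ((K ∪ E)ᶜ ∪ E)ᶜ :=
    { toFun := fun k v => k ⟨v.1, (hmem _).2 v.2⟩
      invFun := fun k v => k ⟨v.1, (hmem _).1 v.2⟩
      left_inv := fun _ => rfl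
      right_inv := fun _ => rfl }
  have hglue : ∀ i k e, glue (u i e) (c k) = join K E i k e := by
    intro i k e
    funext v
    by_cases hK : v ∈ K
    · have hn : v ∉ (K ∪ E)ᶜ ∪ E := Finset.mem_compl.1 ((hmem v).1 hK)
      unfold glue join
      rw [dif_neg hn, dif_pos hK]
      rfl
    · have hn : v ∈ (K ∪ E)ᶜ ∪ E := by
        by_contra h
        exact hK ((hmem v).2 (Finset.mem_compl.2 h))
      unfold glue join
      rw [dif_pos hn, dif_neg hK]
  unfold reduced
  rw [← Equiv.sum_comp c]
  refine Finset.sum_congr rfl fun k _ => ?_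
  rw [hglue, hglue]
  rfl

theorem trace_reduced (Ψ : FullConf d → ℂ) (hΨ : ∑ x, ‖Ψ x‖ ^ 2 = 1) (E : Finset V) :
    ∑ e, reduced (pureState Ψ) E e e = 1 := by
  have h1 : ∑ x, Ψ x * star (Ψ x) = 1 := by
    rw [← Complex.ofReal_one, ← hΨ, Complex.ofReal_sum]
    exact Finset.sum_congr rfl fun x _ => (norm_sq_eq_mul_conj _).symm
  rw [← h1, ← Equiv.sum_comp (glueEquiv E), Fintype.sum_prod_type]
  rfl

theorem single_mul_one_apply {m : ℕ} (a a' i j : Fin m) :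
    (Matrix.single a' a (1 : ℂ) * (1 : Matrix (Fin m) (Fin m) ℂ)) i j =
      if a' = i ∧ a = j then 1 else 0 := by
  rw [Matrix.mul_one, Matrix.single_apply]

open scoped MatrixOrder in
theorem exists_eq_conjTranspose_mul_self {n : Type*} [Fintype n] [DecidableEq n]
    {M : Matrix n n ℂ} (hM : M.PosSemidef) : ∃ B : Matrix n n ℂ, M = B.conjTranspose * B :=
  CStarAlgebra.nonneg_iff_eq_star_mul_self.mp hM.nonneg

/-- The measured sites `(K ∪ E)ᶜ` are not adjacent to `E`, hence uncorrelated with it. Factoring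
each positive operator as `Bᴴ B` gives the setting of `l2_le_of_uncorrelated`, with `K` in the role
of `μ`. -/
theorem nrm_le_of_one {Λ : SimpleGraph V} {Ψ : FullConf d → ℂ} (hΨ : ∑ x, ‖Ψ x‖ ^ 2 = 1)
    (hloc : StrictlyLocal Λ (pureState Ψ)) {K E : Finset V} (hKE : Disjoint K E)
    (hΛ : ∀ x ∈ (K ∪ E)ᶜ, ∀ y ∈ E, ¬ Λ.Adj x y)
    (G : (v : V) → Matrix (Fin (d v)) (Fin (d v)) ℂ) (hG : ∀ v, (G v).PosSemidef)
    (hG1 : ∀ v ∈ K ∪ E, G v = 1) :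
    nrm (pureState Ψ) K G ≤ (ev (pureState Ψ) G).re *
      l2 (fun p : Conf d E × Conf d E => reduced (pureState Ψ) E p.1 p.2) := by
  have hB : ∀ v, ∃ B : Matrix (Fin (d v)) (Fin (d v)) ℂ, G v = B.conjTranspose * B := fun v =>
    exists_eq_conjTranspose_mul_self (hG v)
  choose B hB using hB
  let BB : Conf d (K ∪ E)ᶜ → Conf d (K ∪ E)ᶜ → ℂ := fun b i =>
    ∏ v : {v // v ∈ (K ∪ E)ᶜ}, B v (b v) (i v)
  have hBB : ∀ i i' : Conf d (K ∪ E)ᶜ, ∏ v : {v // v ∈ (K ∪ E)ᶜ}, G v (i v) (i' v) =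
      ∑ b, star (BB b i) * BB b i' := by
    intro i i'
    have h1 : ∀ v : {v // v ∈ (K ∪ E)ᶜ}, G v (i v) (i' v) =
        ∑ β, star (B v β (i v)) * B v β (i' v) := by
      intro v
      rw [hB v, Matrix.mul_apply]
      rfl
    simp only [h1]
    rw [Finset.prod_univ_sum, Fintype.piFinset_univ]
    refine Finset.sum_congr rfl fun b _ => ?_
    rw [Finset.prod_mul_distrib]
    simp only [BB, star_prod]
  have hev : ev (pureState Ψ) G = ∑ i, ∑ i', (∑ b, star (BB b i) * BB b i') *
      reduced (pureState Ψ) (K ∪ E)ᶜ i' i := by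
    rw [ev_eq_sum_reduced _ (K ∪ E)ᶜ G fun v hv => hG1 v (by
      by_contra h; exact hv (Finset.mem_compl.2 h))]
    simp only [hBB]
  have hopen : ∀ p : Conf d K × Conf d K, ev (pureState Ψ) (openAt K p.1 p.2 G) =
      ∑ i, ∑ i', (∑ b, star (BB b i) * BB b i') *
        ∑ e, Ψ (join K E i' p.1 e) * star (Ψ (join K E i p.2 e)) := by
    rintro ⟨a, a'⟩
    have hprod : ∀ i k e i' k' e', ∏ v, openAt K a a' G v (join K E i k e v)
        (join K E i' k' e' v) = (∑ b, star (BB b i) * BB b i') *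
          ((if a' = k ∧ a = k' then 1 else 0) * if e = e' then 1 else 0) := by
      intro i k e i' k' e'
      rw [prod_join hKE, ← hBB, ← prod_one_apply]
      congr 1
      · refine Finset.prod_congr rfl fun v _ => ?_
        have h := v.2
        simp only [Finset.mem_compl, Finset.mem_union, not_or] at h
        rw [join_rest, join_rest, openAt, dif_neg h.1]
      · congr 1
        · have h1 : ∀ v : {v // v ∈ K}, openAt K a a' G v (join K E i k e v)
              (join K E i' k' e' v) = if a' v = k v ∧ a v = k' v then 1 else 0 := by
            intro v
            rw [join_left, join_left, openAt, dif_pos v.2,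
              hG1 v (Finset.mem_union_left E v.2), single_mul_one_apply]
          simp only [h1]
          rw [Finset.prod_ite_zero]
          simp [funext_iff, forall_and]
        · refine Finset.prod_congr rfl fun v _ => ?_
          rw [join_right hKE, join_right hKE, openAt,
            dif_neg (Finset.disjoint_right.1 hKE v.2), hG1 v (Finset.mem_union_right K v.2)]
    unfold ev
    rw [sum_join hKE]
    refine Finset.sum_congr rfl fun i _ => ?_
    have h2 : ∀ k e, ∑ y, (∏ v, openAt K a a' G v (join K E i k e v) (y v)) *
        pureState Ψ y (join K E i k e) = ∑ i', (∑ b, star (BB b i) * BB b i') *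
          ((if a' = k then 1 else 0) * (Ψ (join K E i' a e) * star (Ψ (join K E i k e)))) := by
      intro k e
      rw [sum_join hKE]
      refine Finset.sum_congr rfl fun i' _ => ?_
      simp only [hprod]
      rw [Finset.sum_eq_single a]
      · rw [Finset.sum_eq_single e]
        · simp only [and_true, if_true, mul_one, mul_assoc]
          rfl
        · intro e' _ he'
          rw [if_neg he'.symm]; simp
        · intro h; exact absurd (Finset.mem_univ _) h
      · intro k' _ hk'
        refine Finset.sum_eq_zero fun e' _ => ?_
        rw [if_neg fun h => hk' h.2.symm]; simp
      · intro h; exact absurd (Finset.mem_univ _) h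
    simp only [h2]
    rw [Finset.sum_eq_single a']
    · rw [Finset.sum_comm]
      simp only [if_true, one_mul, Finset.mul_sum]
    · intro k _ hk
      refine Finset.sum_eq_zero fun e _ => Finset.sum_eq_zero fun i' _ => ?_
      rw [if_neg hk.symm]; simp
    · intro h; exact absurd (Finset.mem_univ _) h
  unfold nrm
  simp only [hopen]
  rw [hev]
  exact l2_le_of_uncorrelated (fun i k e => Ψ (join K E i k e)) BB
    (reduced (pureState Ψ) (K ∪ E)ᶜ) (reduced (pureState Ψ) E) (trace_reduced Ψ hΨ E)
    (fun i i' e e' => sum_join_mul_star hloc hKE hΛ i i' e e')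

/-- The Hilbert-Schmidt norm of the state of `K` after a measurement of sites that are not
adjacent to `E`, with the sites in `E` traced out. -/
theorem nrm_le {Λ : SimpleGraph V} {Ψ : FullConf d → ℂ} (hΨ : ∑ x, ‖Ψ x‖ ^ 2 = 1)
    (hloc : StrictlyLocal Λ (pureState Ψ)) {K E : Finset V} (hKE : Disjoint K E)
    (hΛ : ∀ x ∈ (K ∪ E)ᶜ, ∀ y ∈ E, ¬ Λ.Adj x y)
    (G : (v : V) → Matrix (Fin (d v)) (Fin (d v)) ℂ) (hG : ∀ v, (G v).PosSemidef)
    (c : V → ℝ) (hc : ∀ v, 0 ≤ c v) (hGc : ∀ v ∈ K ∪ E, G v = (c v : ℂ) • 1) :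
    nrm (pureState Ψ) K G ≤ (ev (pureState Ψ) G).re *
      l2 (fun p : Conf d E × Conf d E => reduced (pureState Ψ) E p.1 p.2) := by
  have h1 := nrm_le_of_one hΨ hloc hKE hΛ (onSet (K ∪ E)ᶜ G)
    (fun v => by
      unfold onSet
      split_ifs
      · exact hG v
      · exact Matrix.PosSemidef.one)
    (fun v hv => by
      unfold onSet
      rw [if_neg (fun h => Finset.mem_compl.1 h hv)])
  rw [nrm_of_scalar _ K (K ∪ E) (fun v => (c v : ℂ)) G hGc,
    ev_of_scalar _ (K ∪ E) (fun v => (c v : ℂ)) G hGc, ← Complex.ofReal_prod,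
    Complex.re_ofReal_mul, mul_assoc]
  have h2 : ∏ v ∈ K ∪ E, ‖(c v : ℂ)‖ = ∏ v ∈ K ∪ E, c v :=
    Finset.prod_congr rfl fun v _ => by
      rw [Complex.norm_real, Real.norm_of_nonneg (hc v)]
  rw [h2]
  exact mul_le_mul_of_nonneg_left h1 (Finset.prod_nonneg fun v _ => hc v)

end PurityBound

/-! ### Measurements with traced out and traceless sites -/

section Phi

variable {V : Type*} [Fintype V] [DecidableEq V] {d : V → ℕ} {R : V → Type*} [∀ v, Fintype (R v)]

theorem onSet_onSet {X Z : Finset V} (h : X ⊆ Z)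
    (G : (v : V) → Matrix (Fin (d v)) (Fin (d v)) ℂ) : onSet X (onSet Z G) = onSet X G := by
  funext v
  by_cases hv : v ∈ X
  · simp [onSet, hv, h hv]
  · simp [onSet, hv]

theorem openAt_onSet {K X : Finset V} (hK : K ⊆ X) (a a' : Conf d K)
    (G : (v : V) → Matrix (Fin (d v)) (Fin (d v)) ℂ) :
    openAt K a a' (onSet X G) = onSet X (openAt K a a' G) := by
  funext v
  by_cases hv : v ∈ K
  · simp [openAt, onSet, hv, hK hv]
  · simp [openAt, onSet, hv]

theorem onSet_openAt_of_disjoint {K Y : Finset V} (hK : Disjoint K Y) (a a' : Conf d K)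
    (G : (v : V) → Matrix (Fin (d v)) (Fin (d v)) ℂ) :
    onSet Y (openAt K a a' G) = onSet Y G := by
  funext v
  by_cases hv : v ∈ Y
  · have : v ∉ K := Finset.disjoint_right.1 hK hv
    simp [openAt, onSet, this]
  · simp [onSet, hv]

theorem nrm_mul_of_strictlyLocal {Λ : SimpleGraph V} {ρ : Matrix (FullConf d) (FullConf d) ℂ}
    (hloc : StrictlyLocal Λ ρ) {X Y K : Finset V} (hXY : Disjoint X Y)
    (hΛ : ∀ x ∈ X, ∀ y ∈ Y, ¬ Λ.Adj x y) (hK : K ⊆ X)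
    (G : (v : V) → Matrix (Fin (d v)) (Fin (d v)) ℂ) (hG : ∀ v ∉ X ∪ Y, G v = 1) :
    nrm ρ K G = nrm ρ K (onSet X G) * nrm ρ ∅ (onSet Y G) := by
  have h1 : ∀ p : Conf d K × Conf d K, ev ρ (openAt K p.1 p.2 G) =
      ev ρ (onSet Y G) * ev ρ (openAt K p.1 p.2 (onSet X G)) := by
    intro p
    rw [ev_mul_of_strictlyLocal ρ hloc hXY hΛ, openAt_onSet hK,
      onSet_openAt_of_disjoint (Finset.disjoint_of_subset_left hK hXY), mul_comm]
    intro v hv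
    have : v ∉ K := fun h => hv (Finset.mem_union_left Y (hK h))
    rw [openAt, dif_neg this, hG v hv]
  rw [nrm_empty, mul_comm]
  unfold nrm
  simp only [h1, l2_smul]

/-- The weight `Tr[F_r] / d` of an outcome. -/
def wt (F : (v : V) → R v → Matrix (Fin (d v)) (Fin (d v)) ℂ) (v : V) (r : R v) : ℝ :=
  (F v r).trace.re / d v

/-- The operators of an outcome `s`, replaced by their averages on the sites in `N` and by their
traceless parts on the sites in `H`. -/
def modified (F : (v : V) → R v → Matrix (Fin (d v)) (Fin (d v)) ℂ) (N H : Finset V)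
    (s : (v : V) → R v) : (v : V) → Matrix (Fin (d v)) (Fin (d v)) ℂ :=
  fun v => if v ∈ N then (wt F v (s v) : ℂ) • 1 else
    if v ∈ H then F v (s v) - (wt F v (s v) : ℂ) • 1 else F v (s v)

/-- The sum over all outcomes of the Hilbert-Schmidt norm of the resulting operator on `K`. -/
def phi (ρ : Matrix (FullConf d) (FullConf d) ℂ)
    (F : (v : V) → R v → Matrix (Fin (d v)) (Fin (d v)) ℂ) (K N H : Finset V) : ℝ :=
  ∑ s : (v : V) → R v, nrm ρ K (modified F N H s)

/-- The Hilbert-Schmidt norm of the reduced state on `E`. -/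
def hsNorm (ρ : Matrix (FullConf d) (FullConf d) ℂ) (E : Finset V) : ℝ :=
  l2 fun p : Conf d E × Conf d E => reduced ρ E p.1 p.2

variable {F : (v : V) → R v → Matrix (Fin (d v)) (Fin (d v)) ℂ}

theorem wt_eq (v : V) (r : R v) :
    wt F v r = (F v r).trace.re / Fintype.card (Fin (d v)) := by
  rw [wt, Fintype.card_fin]

theorem phi_nonneg (ρ : Matrix (FullConf d) (FullConf d) ℂ) (K N H : Finset V) :
    0 ≤ phi ρ F K N H := Finset.sum_nonneg fun _ _ => nrm_nonneg _ _ _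

variable [∀ v, Nonempty (Fin (d v))] (hF : ∀ v, IsPOVM (F v))

include hF in
-- Everything between `X` and `Y` is averaged, i.e. traced out, so the norm of each outcome
-- factorizes. On each side the averaged sites contribute probability weights that sum to one.
theorem phi_eq_mul {Λ : SimpleGraph V} {ρ : Matrix (FullConf d) (FullConf d) ℂ}
    (hloc : StrictlyLocal Λ ρ) {X Y K N : Finset V} (H : Finset V) (hXY : Disjoint X Y)
    (hΛ : ∀ x ∈ X, ∀ y ∈ Y, ¬ Λ.Adj x y) (hK : K ⊆ X) (hN : (X ∪ Y)ᶜ ⊆ N) :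
    phi ρ F K N H = phi ρ F K (N ∪ Xᶜ) H * phi ρ F ∅ (N ∪ Yᶜ) H := by
  have hw0 : ∀ v r, 0 ≤ wt F v r := fun v r => (hF v).weight_nonneg (wt_eq v) r
  have hw1 : ∀ v, ∑ r, wt F v r = 1 := fun v => (hF v).sum_weight (wt_eq v)
  have hon : ∀ (Z : Finset V) (s : (v : V) → R v),
      onSet Z (modified F (N ∪ Zᶜ) H s) = onSet Z (modified F N H s) := by
    intro Z s
    funext v
    by_cases hv : v ∈ Z <;> simp [onSet, modified, hv]
  have hprod : ∀ (Z : Finset V) (s : (v : V) → R v),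
      ∏ v ∈ Z, ‖(wt F v (s v) : ℂ)‖ = ∏ v ∈ Z, wt F v (s v) := fun Z s =>
    Finset.prod_congr rfl fun v _ => by rw [Complex.norm_real, Real.norm_of_nonneg (hw0 _ _)]
  have hdep : ∀ (L Z : Finset V) (s t : (v : V) → R v), (∀ v ∈ Z, s v = t v) →
      nrm ρ L (onSet Z (modified F N H s)) = nrm ρ L (onSet Z (modified F N H t)) := by
    intro L Z s t hst
    congr 1
    funext v
    by_cases hv : v ∈ Z
    · simp only [onSet, hv, if_true, modified, hst v hv]
    · simp [onSet, hv]
  have hside : ∀ (L Z : Finset V) (s : (v : V) → R v),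
      nrm ρ L (modified F (N ∪ Zᶜ) H s) =
        (∏ v ∈ Zᶜ, wt F v (s v)) * nrm ρ L (onSet Z (modified F N H s)) := by
    intro L Z s
    rw [nrm_of_scalar ρ L Zᶜ (fun v => (wt F v (s v) : ℂ)), hprod, compl_compl, hon]
    intro v hv
    rw [modified, if_pos (Finset.mem_union_right N hv)]
  have hall : ∀ s : (v : V) → R v, nrm ρ K (modified F N H s) =
      (∏ v ∈ (X ∪ Y)ᶜ, wt F v (s v)) * (nrm ρ K (onSet X (modified F N H s)) *
        nrm ρ ∅ (onSet Y (modified F N H s))) := by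
    intro s
    rw [nrm_of_scalar ρ K (X ∪ Y)ᶜ (fun v => (wt F v (s v) : ℂ)), hprod, compl_compl,
      nrm_mul_of_strictlyLocal hloc hXY hΛ hK]
    · rw [onSet_onSet Finset.subset_union_left, onSet_onSet Finset.subset_union_right]
    · intro v hv
      rw [onSet, if_neg hv]
    · intro v hv
      rw [modified, if_pos (hN hv)]
  unfold phi
  simp only [hall, hside]
  exact sum_mul_of_disjoint (wt F) hw1 hXY _ _ (hdep K X) (hdep ∅ Y)

/-- Linearity in the operator at one site, expanded in matrix units. The coefficients of this
expansion are the data of an opened site. -/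
theorem ev_update (ρ : Matrix (FullConf d) (FullConf d) ℂ)
    (G : (v : V) → Matrix (Fin (d v)) (Fin (d v)) ℂ) (v : V)
    (B : Matrix (Fin (d v)) (Fin (d v)) ℂ) :
    ev ρ (Function.update G v B) = ∑ p : Fin (d v) × Fin (d v),
      B p.1 p.2 * ev ρ (Function.update G v (Matrix.single p.1 p.2 1)) := by
  have h1 : ∀ (B : Matrix (Fin (d v)) (Fin (d v)) ℂ) (x y : FullConf d),
      ∏ u, Function.update G v B u (x u) (y u) =
        B (x v) (y v) * ∏ u ∈ Finset.univ.erase v, G u (x u) (y u) := by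
    intro B x y
    rw [← Finset.mul_prod_erase _ _ (Finset.mem_univ v), Function.update_self]
    congr 1
    refine Finset.prod_congr rfl fun u hu => ?_
    rw [Function.update_of_ne (Finset.ne_of_mem_erase hu)]
  unfold ev
  simp only [h1, Finset.mul_sum]
  rw [Finset.sum_comm, Finset.sum_comm (s := Finset.univ (α := Fin (d v) × Fin (d v)))]
  rw [Finset.sum_comm]
  refine Finset.sum_congr rfl fun x _ => ?_
  rw [Finset.sum_comm]
  refine Finset.sum_congr rfl fun y _ => ?_
  rw [Finset.sum_eq_single (x v, y v)]
  · rw [Matrix.single_apply_same]; ring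
  · rintro ⟨i, j⟩ _ hne
    rw [Matrix.single_apply_of_ne]
    · ring
    · rintro ⟨rfl, rfl⟩; exact hne rfl
  · intro h; exact absurd (Finset.mem_univ _) h

theorem openAt_update {K : Finset V} {v : V} (hv : v ∉ K) (a a' : Conf d K)
    (G : (v : V) → Matrix (Fin (d v)) (Fin (d v)) ℂ) (B : Matrix (Fin (d v)) (Fin (d v)) ℂ) :
    openAt K a a' (Function.update G v B) = Function.update (openAt K a a' G) v B := by
  funext u
  by_cases hu : u = v
  · subst hu
    simp [openAt, hv]
  · simp [openAt, Function.update_of_ne hu]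

theorem openAt_insert_update {K : Finset V} {v : V} (hv : v ∉ K) (a a' : Conf d (insert v K))
    (G : (v : V) → Matrix (Fin (d v)) (Fin (d v)) ℂ) :
    openAt (insert v K) a a' (Function.update G v 1) =
      Function.update (openAt K (fun u => a ⟨u, Finset.mem_insert_of_mem u.2⟩)
        (fun u => a' ⟨u, Finset.mem_insert_of_mem u.2⟩) G) v
        (Matrix.single (a' ⟨v, Finset.mem_insert_self v K⟩)
          (a ⟨v, Finset.mem_insert_self v K⟩) 1) := by
  funext u
  by_cases hu : u = v
  · subst hu
    simp [openAt]
  · by_cases huK : u ∈ K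
    · simp [openAt, Function.update_of_ne hu, huK]
    · simp [openAt, huK, hu]

theorem bijective_insert {K : Finset V} {v : V} (hv : v ∉ K) : Function.Bijective
    fun a : Conf d (insert v K) => ((a ⟨v, Finset.mem_insert_self v K⟩,
      fun u => a ⟨u, Finset.mem_insert_of_mem u.2⟩) : Fin (d v) × Conf d K) := by
  constructor
  · intro a b hab
    rw [Prod.mk.injEq] at hab
    funext ⟨u, hu⟩
    rcases Finset.mem_insert.1 hu with rfl | h
    · exact hab.1
    · exact congrFun hab.2 ⟨u, h⟩
  · rintro ⟨i, b⟩
    refine ⟨fun u => if h : u.1 = v then Fin.cast (by rw [h]) i else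
      b ⟨u.1, (Finset.mem_insert.1 u.2).resolve_left h⟩, ?_⟩
    refine Prod.ext (by simp) ?_
    funext u
    have : u.1 ≠ v := fun h => hv (h ▸ u.2)
    simp [this]

/-- Opening one more site. -/
theorem nrm_insert_update (ρ : Matrix (FullConf d) (FullConf d) ℂ) {K : Finset V} {v : V}
    (hv : v ∉ K) (G : (v : V) → Matrix (Fin (d v)) (Fin (d v)) ℂ) :
    nrm ρ (insert v K) (Function.update G v 1) =
      l2 (fun p : (Fin (d v) × Fin (d v)) × (Conf d K × Conf d K) =>
        ev ρ (Function.update (openAt K p.2.1 p.2.2 G) v (Matrix.single p.1.1 p.1.2 1))) := by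
  unfold nrm l2
  congr 1
  simp only [openAt_insert_update hv]
  simp only [Fintype.sum_prod_type]
  let g : Fin (d v) × Conf d K → Fin (d v) × Conf d K → ℝ := fun p q =>
    ‖ev ρ (Function.update (openAt K p.2 q.2 G) v (Matrix.single q.1 p.1 1))‖ ^ 2
  have h1 : ∀ p, ∑ a' : Conf d (insert v K), g p (a' ⟨v, Finset.mem_insert_self v K⟩,
      fun u => a' ⟨u, Finset.mem_insert_of_mem u.2⟩) = ∑ q, g p q := fun p =>
    (bijective_insert hv).sum_comp (g p)
  have h2 : ∑ a : Conf d (insert v K), (∑ q, g (a ⟨v, Finset.mem_insert_self v K⟩,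
      fun u => a ⟨u, Finset.mem_insert_of_mem u.2⟩) q) = ∑ p, ∑ q, g p q :=
    (bijective_insert hv).sum_comp (fun p => ∑ q, g p q)
  refine (Finset.sum_congr rfl fun a _ => h1 (a ⟨v, Finset.mem_insert_self v K⟩,
    fun u => a ⟨u, Finset.mem_insert_of_mem u.2⟩)).trans (h2.trans ?_)
  rw [Finset.sum_comm]
  simp only [Fintype.sum_prod_type]
  refine Finset.sum_congr rfl fun i _ => ?_
  rw [Finset.sum_comm]
  refine Finset.sum_congr rfl fun j _ => ?_
  rw [Finset.sum_comm]

include hF in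
/-- A traceless site may be replaced by an unmeasured one. -/
theorem phi_le_insert (ρ : Matrix (FullConf d) (FullConf d) ℂ) {K N H : Finset V} {v : V}
    (hF₂ : IsTwoDesignPOVM (F v)) (hH : v ∈ H) (hN : v ∉ N) (hK : v ∉ K) :
    phi ρ F K N H ≤ phi ρ F (insert v K) (insert v N) H := by
  have hw0 : ∀ r, 0 ≤ wt F v r := fun r => (hF v).weight_nonneg (wt_eq v) r
  unfold phi
  rw [sum_eq_sum_update (wt F) v ((hF v).sum_weight (wt_eq v))]
  refine Finset.sum_le_sum fun s _ => ?_
  -- With `v` averaged, its outcome enters only through the weight, which matches the prefactor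
  -- produced by `sum_eq_sum_update`.
  have h1 : modified F (insert v N) H s = fun u => (if u = v then (wt F v (s v) : ℂ) else 1) •
      Function.update (modified F N H s) v 1 u := by
    funext u
    by_cases hu : u = v
    · subst hu
      simp [modified]
    · simp [modified, hu]
  rw [h1, nrm_smul]
  have h2 : ‖∏ u, (if u = v then (wt F v (s v) : ℂ) else 1)‖ = wt F v (s v) := by
    rw [Finset.prod_ite_eq' Finset.univ v, if_pos (Finset.mem_univ v), Complex.norm_real,
      Real.norm_of_nonneg (hw0 _)]
  rw [h2]
  refine mul_le_mul_of_nonneg_left ?_ (hw0 _)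
  have h3 : ∀ r, modified F N H (Function.update s v r) =
      Function.update (modified F N H s) v (F v r - (wt F v r : ℂ) • 1) := by
    intro r
    funext u
    by_cases hu : u = v
    · subst hu
      simp [modified, hN, hH]
    · simp [modified, hu]
  have h4 : ∀ r, nrm ρ K (modified F N H (Function.update s v r)) =
      l2 (fun e : Conf d K × Conf d K => ∑ p : Fin (d v) × Fin (d v),
        (F v r - (wt F v r : ℂ) • 1) p.1 p.2 *
        ev ρ (Function.update (openAt K e.1 e.2 (modified F N H s)) v
          (Matrix.single p.1 p.2 1))) := by
    intro r
    unfold nrm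
    congr 1
    funext e
    rw [h3, openAt_update hK, ev_update]
  simp only [h4]
  rw [nrm_insert_update ρ hK]
  exact sum_l2_traceless_le (hF v) hF₂ (wt_eq v)
    (fun (p : Fin (d v) × Fin (d v)) (e : Conf d K × Conf d K) =>
      ev ρ (Function.update (openAt K e.1 e.2 (modified F N H s)) v (Matrix.single p.1 p.2 1)))

include hF in
theorem phi_le_union (ρ : Matrix (FullConf d) (FullConf d) ℂ) {K N H : Finset V} (hKN : K ⊆ N)
    (D : Finset V) (hF₂ : ∀ v ∈ D, IsTwoDesignPOVM (F v)) (hDH : D ⊆ H) (hDN : Disjoint D N) :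
    phi ρ F K N H ≤ phi ρ F (K ∪ D) (N ∪ D) H := by
  induction D using Finset.induction_on with
  | empty => simp
  | insert v D hv ih =>
    rw [Finset.disjoint_insert_left] at hDN
    refine (ih (fun u hu => hF₂ u (Finset.mem_insert_of_mem hu))
      ((Finset.subset_insert v D).trans hDH) hDN.2).trans ?_
    rw [Finset.union_insert, Finset.union_insert]
    refine phi_le_insert hF ρ (hF₂ v (Finset.mem_insert_self v D))
      (hDH (Finset.mem_insert_self v D)) ?_ ?_
    · rw [Finset.mem_union]; exact fun h => h.elim hDN.1 hv
    · rw [Finset.mem_union]; exact fun h => h.elim (fun h => hDN.1 (hKN h)) hv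

theorem sum_ev (ρ : Matrix (FullConf d) (FullConf d) ℂ)
    (Φ : (v : V) → R v → Matrix (Fin (d v)) (Fin (d v)) ℂ) :
    ∑ s : (v : V) → R v, ev ρ (fun v => Φ v (s v)) = ev ρ (fun v => ∑ r, Φ v r) := by
  unfold ev
  rw [Finset.sum_comm]
  refine Finset.sum_congr rfl fun x _ => ?_
  rw [Finset.sum_comm]
  refine Finset.sum_congr rfl fun y _ => ?_
  rw [← Finset.sum_mul]
  simp only [Matrix.sum_apply]
  rw [Finset.prod_univ_sum, Fintype.piFinset_univ]

theorem ev_one (Ψ : FullConf d → ℂ) (hΨ : ∑ x, ‖Ψ x‖ ^ 2 = 1) :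
    ev (pureState Ψ) (fun _ => 1) = 1 := by
  rw [ev_eq_sum_reduced _ ∅ _ fun _ _ => rfl, ← trace_reduced Ψ hΨ ∅]
  refine Finset.sum_congr rfl fun s _ => ?_
  rw [Finset.sum_eq_single s]
  · rw [prod_one_apply, if_pos rfl, one_mul]
  · intro t _ ht
    rw [prod_one_apply, if_neg ht.symm, zero_mul]
  · intro h; exact absurd (Finset.mem_univ s) h

include hF in
-- Since `H ⊆ N`, no traceless operator is left: all operators are positive, and the probabilities
-- multiplying the purity bound sum to one.
theorem phi_le_hsNorm_of_subset {Λ : SimpleGraph V} {Ψ : FullConf d → ℂ}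
    (hΨ : ∑ x, ‖Ψ x‖ ^ 2 = 1) (hloc : StrictlyLocal Λ (pureState Ψ)) {K N H E : Finset V}
    (hHN : H ⊆ N) (hKN : K ⊆ N) (hEN : E ⊆ N) (hKE : Disjoint K E)
    (hΛ : ∀ x ∈ (K ∪ E)ᶜ, ∀ y ∈ E, ¬ Λ.Adj x y) :
    phi (pureState Ψ) F K N H ≤ hsNorm (pureState Ψ) E := by
  have hw0 : ∀ v r, 0 ≤ wt F v r := fun v r => (hF v).weight_nonneg (wt_eq v) r
  have hw1 : ∀ v, ∑ r, wt F v r = 1 := fun v => (hF v).sum_weight (wt_eq v)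
  have hps : ∀ s v, (modified F N H s v).PosSemidef := by
    intro s v
    unfold modified
    by_cases hv : v ∈ N
    · rw [if_pos hv]
      exact Matrix.PosSemidef.one.smul (by exact_mod_cast hw0 _ _)
    · rw [if_neg hv, if_neg fun h => hv (hHN h)]
      exact (hF v).posSemidef _
  have hsum : ∑ s, (ev (pureState Ψ) (modified F N H s)).re = 1 := by
    rw [← Complex.re_sum]
    have h1 := sum_ev (pureState Ψ) (fun v r => if v ∈ N then (wt F v r : ℂ) • 1 else
      if v ∈ H then F v r - (wt F v r : ℂ) • 1 else F v r)
    have h2 : ∀ v, ∑ r, (if v ∈ N then (wt F v r : ℂ) • (1 : Matrix (Fin (d v)) (Fin (d v)) ℂ) else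
        if v ∈ H then F v r - (wt F v r : ℂ) • 1 else F v r) = 1 := by
      intro v
      by_cases hv : v ∈ N
      · simp only [if_pos hv]
        rw [← Finset.sum_smul, ← Complex.ofReal_sum, hw1, Complex.ofReal_one, one_smul]
      · simp only [if_neg hv, if_neg fun h => hv (hHN h)]
        exact (hF v).sum_eq_one
    simp only [h2, ev_one Ψ hΨ] at h1
    unfold modified
    rw [h1, Complex.one_re]
  calc phi (pureState Ψ) F K N H
      ≤ ∑ s, (ev (pureState Ψ) (modified F N H s)).re * hsNorm (pureState Ψ) E :=
        Finset.sum_le_sum fun s _ => nrm_le hΨ hloc hKE hΛ _ (hps s) (fun v => wt F v (s v))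
          (fun v => hw0 _ _) fun v hv => by
            rw [modified, if_pos ((Finset.union_subset hKN hEN) hv)]
    _ = hsNorm (pureState Ψ) E := by rw [← Finset.sum_mul, hsum, one_mul]

include hF in
-- Open all remaining traceless sites. Adjacency to `E` then needs to be excluded only for the sites
-- that are still measured.
theorem phi_le_hsNorm {Λ : SimpleGraph V} {Ψ : FullConf d → ℂ}
    (hΨ : ∑ x, ‖Ψ x‖ ^ 2 = 1) (hloc : StrictlyLocal Λ (pureState Ψ)) {K N H E : Finset V}
    (hF₂ : ∀ v ∈ H, IsTwoDesignPOVM (F v)) (hKN : K ⊆ N) (hEN : E ⊆ N) (hKE : Disjoint K E)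
    (hΛ : ∀ x ∈ (K ∪ (H \ N) ∪ E)ᶜ, ∀ y ∈ E, ¬ Λ.Adj x y) :
    phi (pureState Ψ) F K N H ≤ hsNorm (pureState Ψ) E := by
  refine (phi_le_union hF _ hKN (H \ N) (fun v hv => hF₂ v (Finset.mem_sdiff.1 hv).1)
    Finset.sdiff_subset Finset.sdiff_disjoint).trans ?_
  refine phi_le_hsNorm_of_subset hF hΨ hloc ?_ (Finset.union_subset_union_left hKN)
    (hEN.trans Finset.subset_union_left) ?_ hΛ
  · intro v hv
    by_cases h : v ∈ N <;> simp [h, hv]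
  · rw [Finset.disjoint_union_left]
    refine ⟨hKE, ?_⟩
    rw [Finset.disjoint_left]
    exact fun v hv hE => (Finset.mem_sdiff.1 hv).2 (hEN hE)

theorem hsNorm_empty (Ψ : FullConf d → ℂ) (hΨ : ∑ x, ‖Ψ x‖ ^ 2 = 1) :
    hsNorm (pureState Ψ) ∅ = 1 := by
  have : IsEmpty {v // v ∈ (∅ : Finset V)} := ⟨fun v => Finset.notMem_empty _ v.2⟩
  have h1 := trace_reduced Ψ hΨ ∅
  rw [Fintype.sum_unique] at h1
  simp only [hsNorm, l2]
  rw [Fintype.sum_prod_type, Fintype.sum_unique, Fintype.sum_unique, h1]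
  simp

include hF in
/-- A family of nested cuts contributes at most the product of the Boltzmann weights. -/
theorem phi_le_prod {Λ Λ' : SimpleGraph V} (hΛ : Λ ≤ Λ') {Ψ : FullConf d → ℂ}
    (hΨ : ∑ x, ‖Ψ x‖ ^ 2 = 1) (hloc : StrictlyLocal Λ (pureState Ψ)) {H : Finset V}
    (hF₂ : ∀ v ∈ H, IsTwoDesignPOVM (F v)) (n : ℕ) :
    ∀ (T : Finset (Finset V)) (K N : Finset V), T.card = n → (T.Nonempty ∨ K = ∅) → K ⊆ N →
      (∀ S ∈ T, K ⊆ S) → (∀ S ∈ T, outerBd Λ' S ⊆ N) → (∀ S ∈ T, innerBd Λ' S ⊆ H ∪ K) →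
      (∀ S ∈ T, Disjoint (innerBd Λ' S \ K) N) → (∀ v ∈ H, v ∉ N → ∃ S ∈ T, v ∈ S) →
      (∀ S ∈ T, ∀ S' ∈ T, S = S' ∨ (S ⊆ S' ∧ outerBd Λ' S ⊆ S') ∨
        (S' ⊆ S ∧ outerBd Λ' S' ⊆ S)) →
      phi (pureState Ψ) F K N H ≤ ∏ S ∈ T, hsNorm (pureState Ψ) Sᶜ := by
  induction n with
  | zero =>
    intro T K N hcard hne _ _ _ _ _ hH _
    rw [Finset.card_eq_zero] at hcard
    subst hcard
    obtain rfl : K = ∅ := hne.resolve_left Finset.not_nonempty_empty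
    rw [Finset.prod_empty, ← hsNorm_empty Ψ hΨ]
    refine phi_le_hsNorm_of_subset hF hΨ hloc ?_ (Finset.empty_subset _) (Finset.empty_subset _)
      (Finset.disjoint_empty_left _) (by simp)
    intro v hv
    by_contra hN
    obtain ⟨S, hS, -⟩ := hH v hv hN
    exact Finset.notMem_empty S hS
  | succ n ih =>
    intro T K N hcard _ hKN hKT hout hin hdisj hH hnest
    have hTne : T.Nonempty := Finset.card_pos.1 (by omega)
    -- By nestedness the smallest cut lies, together with its outer layer, inside all the others.
    obtain ⟨S, hS, hmin⟩ := Finset.exists_min_image T Finset.card hTne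
    have hnext : ∀ S' ∈ T, S' ≠ S → S ⊆ S' ∧ outerBd Λ' S ⊆ S' := by
      intro S' hS' hne
      rcases hnest S hS S' hS' with h | h | h
      · exact absurd h.symm hne
      · exact h
      · exact absurd (Finset.eq_of_subset_of_card_le h.1 (hmin S' hS')) hne
    -- An exit from `S'` starting in `S` would pass through the outer layer of `S`, which is
    -- contained in `S'`.
    have hinS : ∀ S' ∈ T, S' ≠ S → ∀ v ∈ innerBd Λ' S', v ∉ S := by
      intro S' hS' hne v hv hvS
      obtain ⟨-, u, hu, hvu⟩ := mem_innerBd.1 hv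
      obtain ⟨h1, h2⟩ := hnext S' hS' hne
      exact hu (h2 (mem_outerBd.2 ⟨fun h => hu (h1 h), v, hvS, hvu.symm⟩))
    -- Split along the outer layer of `S`, which is averaged. The inner factor yields the weight of
    -- `S`; the outer one has no open site and keeps the remaining cuts.
    rw [← Finset.mul_prod_erase T _ hS,
      phi_eq_mul hF hloc H (X := S) (Y := (S ∪ outerBd Λ' S)ᶜ) (K := K)]
    · refine mul_le_mul ?_ ?_ (phi_nonneg _ _ _ _) (l2_nonneg _)
      · refine phi_le_hsNorm hF hΨ hloc hF₂ (hKN.trans Finset.subset_union_left)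
          Finset.subset_union_right ?_ ?_
        · rw [Finset.disjoint_left]
          exact fun v hv h => Finset.mem_compl.1 h (hKT S hS hv)
        -- A site of `S` with a neighbor in `Sᶜ` belongs to the inner layer, so it is either in `K`
        -- or traceless and hence opened.
        · intro x hx y hy hxy
          simp only [Finset.mem_compl, Finset.mem_union, Finset.mem_sdiff, not_or, not_not] at hx hy
          obtain ⟨⟨hxK, hxH⟩, hxS⟩ := hx
          have hxin : x ∈ innerBd Λ' S := mem_innerBd.2 ⟨hxS, y, hy, hΛ hxy⟩
          have hxN : x ∉ N := Finset.disjoint_left.1 (hdisj S hS)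
            (Finset.mem_sdiff.2 ⟨hxin, hxK⟩)
          have hxH' : x ∈ H := (Finset.mem_union.1 (hin S hS hxin)).resolve_right hxK
          tauto
      · have hNeq : N ∪ (S ∪ outerBd Λ' S)ᶜᶜ = N ∪ S := by
          rw [compl_compl]
          ext v
          simp only [Finset.mem_union]
          have := @hout S hS v
          tauto
        rw [hNeq]
        refine ih (T.erase S) ∅ (N ∪ S) (by rw [Finset.card_erase_of_mem hS]; omega) (Or.inr rfl)
          (Finset.empty_subset _) (fun _ _ => Finset.empty_subset _) ?_ ?_ ?_ ?_ ?_
        · exact fun S' hS' => (hout S' (Finset.mem_of_mem_erase hS')).trans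
            Finset.subset_union_left
        · intro S' hS' v hv
          have hvS := hinS S' (Finset.mem_of_mem_erase hS') (Finset.ne_of_mem_erase hS') v hv
          rcases Finset.mem_union.1 (hin S' (Finset.mem_of_mem_erase hS') hv) with h | h
          · exact Finset.mem_union_left _ h
          · exact absurd (hKT S hS h) hvS
        · intro S' hS'
          rw [Finset.sdiff_empty, Finset.disjoint_left]
          intro v hv hvN
          have hvS := hinS S' (Finset.mem_of_mem_erase hS') (Finset.ne_of_mem_erase hS') v hv
          have hvN' := (Finset.mem_union.1 hvN).resolve_right hvS
          exact Finset.disjoint_left.1 (hdisj S' (Finset.mem_of_mem_erase hS'))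
            (Finset.mem_sdiff.2 ⟨hv, fun h => hvS (hKT S hS h)⟩) hvN'
        · intro v hv hvN
          rw [Finset.mem_union, not_or] at hvN
          obtain ⟨S', hS', hvS'⟩ := hH v hv hvN.1
          exact ⟨S', Finset.mem_erase.2 ⟨fun h => hvN.2 (h ▸ hvS'), hS'⟩, hvS'⟩
        · exact fun S₁ h₁ S₂ h₂ => hnest S₁ (Finset.mem_of_mem_erase h₁) S₂
            (Finset.mem_of_mem_erase h₂)
    · rw [Finset.disjoint_left]
      intro v hv h
      exact Finset.mem_compl.1 h (Finset.mem_union_left _ hv)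
    · intro x hx y hy hxy
      have hy' := Finset.mem_compl.1 hy
      rw [Finset.mem_union, not_or] at hy'
      exact hy'.2 (mem_outerBd.2 ⟨hy'.1, x, hx, (hΛ hxy).symm⟩)
    · exact hKT S hS
    · intro v hv
      refine hout S hS ?_
      simp only [Finset.mem_compl, Finset.mem_union, not_or] at hv
      tauto

end Phi

/-! ### Inclusion-exclusion over families of cuts. -/

section Expansion

variable {V : Type*} [Fintype V] [DecidableEq V] {d : V → ℕ} {R : V → Type*} [∀ v, Fintype (R v)]
  {F : (v : V) → R v → Matrix (Fin (d v)) (Fin (d v)) ℂ}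

/-- Split each unconstrained site into its average and its traceless part. -/
theorem ev_modified_eq_sum (ρ : Matrix (FullConf d) (FullConf d) ℂ) {A N H : Finset V}
    (hAN : A ⊆ N) (hNH : Disjoint N H) (a a' : Conf d A) (s : (v : V) → R v) :
    ev ρ (openAt A a a' (modified F N H s)) =
      ∑ D : Finset V, if N ⊆ D ∧ Disjoint H D then
        ev ρ (openAt A a a' (modified F D Finset.univ s)) else 0 := by
  have hprod : ∀ x y : FullConf d, ∏ v, openAt A a a' (modified F N H s) v (x v) (y v) =
      ∑ D : Finset V, if N ⊆ D ∧ Disjoint H D then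
        ∏ v, openAt A a a' (modified F D Finset.univ s) v (x v) (y v) else 0 := by
    intro x y
    -- `f` is the averaged contribution, suppressed on `H`; `g` is the traceless one, suppressed on
    -- `N`. Expanding `∏ (f + g)` leaves exactly the sets `D` with `N ⊆ D` and `D` disjoint from
    -- `H`.
    let f : V → ℂ := fun v => if v ∈ H then 0 else
      openAt A a a' (fun v => (wt F v (s v) : ℂ) • 1) v (x v) (y v)
    let g : V → ℂ := fun v => if v ∈ N then 0 else
      (F v (s v) - (wt F v (s v) : ℂ) • 1) (x v) (y v)
    have h1 : ∀ v, openAt A a a' (modified F N H s) v (x v) (y v) = f v + g v := by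
      intro v
      by_cases hN : v ∈ N
      · have hH : v ∉ H := Finset.disjoint_left.1 hNH hN
        simp [f, g, hN, hH, openAt, modified]
      · have hA : v ∉ A := fun h => hN (hAN h)
        by_cases hH : v ∈ H <;> simp [f, g, hN, hH, openAt, modified, hA]
    simp only [h1]
    rw [Finset.prod_add, Finset.powerset_univ]
    refine Finset.sum_congr rfl fun D _ => ?_
    by_cases hD : N ⊆ D ∧ Disjoint H D
    · rw [if_pos hD, ← Finset.compl_eq_univ_sdiff, ← Finset.prod_mul_prod_compl D]
      congr 1
      · refine Finset.prod_congr rfl fun v hv => ?_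
        have hH : v ∉ H := Finset.disjoint_right.1 hD.2 hv
        simp [f, hH, openAt, modified, hv]
      · refine Finset.prod_congr rfl fun v hv => ?_
        have hv' := Finset.mem_compl.1 hv
        have hN : v ∉ N := fun h => hv' (hD.1 h)
        have hA : v ∉ A := fun h => hN (hAN h)
        simp [g, hN, openAt, modified, hv', hA]
    · rw [if_neg hD]
      rw [not_and_or] at hD
      rcases hD with hD | hD
      · obtain ⟨v, hvN, hvD⟩ := Finset.not_subset.1 hD
        rw [Finset.prod_eq_zero (s := Finset.univ \ D) (i := v) (by simp [hvD])
          (by simp [g, hvN]), mul_zero]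
      · obtain ⟨v, hvH, hvD⟩ := Finset.not_disjoint_iff.1 hD
        rw [Finset.prod_eq_zero hvD (by simp [f, hvH]), zero_mul]
  unfold ev
  simp only [hprod, Finset.sum_mul]
  rw [Finset.sum_congr rfl fun x _ => Finset.sum_comm, Finset.sum_comm]
  refine Finset.sum_congr rfl fun D _ => ?_
  by_cases hD : N ⊆ D ∧ Disjoint H D
  · simp only [if_pos hD]
  · simp only [if_neg hD, zero_mul, Finset.sum_const_zero]

variable {G : SimpleGraph V}

/-- The averaged sites of a set of cuts. -/
def outerSites (G : SimpleGraph V) (A C : Finset V) (T : Finset (Finset V)) : Finset V :=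
  A ∪ C ∪ T.biUnion (outerBd G)

/-- The traceless sites of a set of cuts. -/
def innerSites (G : SimpleGraph V) (A : Finset V) (T : Finset (Finset V)) : Finset V :=
  T.biUnion (innerBd G) \ A

/-- When `A ∪ C ⊆ D`, a family fits `D` exactly if each of its cuts does, so the sum is the
alternating sum over the subsets of a nonempty set. Otherwise every term vanishes. -/
theorem sum_neg_one_pow_eq_zero (hG : G.Connected) {A C D : Finset V} (hA : A.Nonempty)
    (hC : C.Nonempty) (hAC : Disjoint A C)
    (hAc : (G.induce (A : Set V)).Preconnected) (hCc : (G.induce (C : Set V)).Preconnected) :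
    ∑ T ∈ (cutSets G A C).powerset, (-1 : ℂ) ^ T.card *
      (if outerSites G A C T ⊆ D ∧ Disjoint (innerSites G A T) D then 1 else 0) = 0 := by
  classical
  by_cases hD : A ∪ C ⊆ D
  · let good := (cutSets G A C).filter fun S => outerBd G S ⊆ D ∧ Disjoint (innerBd G S \ A) D
    have hgood : good.Nonempty := by
      -- The open region `A` counts as averaged in `D`, whereas the cut must separate it from `D`;
      -- hence `D \ A` here, and inner layers stripped of `A` throughout.
      obtain ⟨S, hS, h1, h2⟩ := exists_cutSet (D := D \ A) hG hA hC hAc hCc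
        (fun v hv => Finset.mem_sdiff.2 ⟨hD (Finset.mem_union_right A hv),
          Finset.disjoint_right.1 hAC hv⟩) Finset.disjoint_sdiff
      refine ⟨S, Finset.mem_filter.2 ⟨hS, h1.trans Finset.sdiff_subset, ?_⟩⟩
      rw [Finset.disjoint_left] at h2 ⊢
      intro v hv hvD
      rw [Finset.mem_sdiff] at hv
      exact h2 hv.1 (Finset.mem_sdiff.2 ⟨hvD, hv.2⟩)
    have hiff : ∀ T, (outerSites G A C T ⊆ D ∧ Disjoint (innerSites G A T) D) ↔
        ∀ S ∈ T, outerBd G S ⊆ D ∧ Disjoint (innerBd G S \ A) D := by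
      intro T
      constructor
      · rintro ⟨h1, h2⟩ S hS
        refine ⟨fun v hv => h1 (Finset.mem_union_right _ (Finset.mem_biUnion.2 ⟨S, hS, hv⟩)), ?_⟩
        exact Finset.disjoint_of_subset_left
          (Finset.sdiff_subset_sdiff (Finset.subset_biUnion_of_mem _ hS) subset_rfl) h2
      · intro h
        constructor
        · refine Finset.union_subset hD ?_
          exact Finset.biUnion_subset.2 fun S hS => (h S hS).1
        · rw [Finset.disjoint_left]
          intro v hv hvD
          obtain ⟨hv1, hv2⟩ := Finset.mem_sdiff.1 hv
          obtain ⟨S, hS, hvS⟩ := Finset.mem_biUnion.1 hv1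
          exact Finset.disjoint_left.1 (h S hS).2 (Finset.mem_sdiff.2 ⟨hvS, hv2⟩) hvD
    have hfilter : (cutSets G A C).powerset.filter
        (fun T => outerSites G A C T ⊆ D ∧ Disjoint (innerSites G A T) D) = good.powerset := by
      ext T
      rw [Finset.mem_filter, Finset.mem_powerset, Finset.mem_powerset, hiff]
      constructor
      · rintro ⟨h1, h2⟩ S hS
        exact Finset.mem_filter.2 ⟨h1 hS, h2 S hS⟩
      · intro h
        exact ⟨fun S hS => (Finset.mem_filter.1 (h hS)).1,
          fun S hS => (Finset.mem_filter.1 (h hS)).2⟩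
    simp only [mul_ite, mul_one, mul_zero]
    rw [← Finset.sum_filter, hfilter]
    have := Finset.sum_powerset_neg_one_pow_card_of_nonempty hgood
    exact_mod_cast this
  · refine Finset.sum_eq_zero fun T _ => ?_
    rw [if_neg, mul_zero]
    rintro ⟨h1, -⟩
    exact hD (Finset.subset_union_left.trans h1)

/-- Inclusion-exclusion over the sets of cuts between `A` and `C`. -/
theorem nrm_le_sum (hG : G.Connected) {A C : Finset V} (hA : A.Nonempty)
    (hC : C.Nonempty) (hAC : Disjoint A C)
    (hAc : (G.induce (A : Set V)).Preconnected) (hCc : (G.induce (C : Set V)).Preconnected)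
    (ρ : Matrix (FullConf d) (FullConf d) ℂ) (s : (v : V) → R v) :
    nrm ρ A (modified F (A ∪ C) ∅ s) ≤
      ∑ T ∈ (cutSets G A C).powerset.erase ∅,
        if Disjoint (outerSites G A C T) (innerSites G A T) then
          nrm ρ A (modified F (outerSites G A C T) (innerSites G A T) s) else 0 := by
  classical
  let X : Finset (Finset V) → Conf d A × Conf d A → ℂ := fun T p => ∑ D : Finset V,
    if outerSites G A C T ⊆ D ∧ Disjoint (innerSites G A T) D then
      ev ρ (openAt A p.1 p.2 (modified F D Finset.univ s)) else 0
  have hX : ∀ T, Disjoint (outerSites G A C T) (innerSites G A T) → ∀ p, X T p =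
      ev ρ (openAt A p.1 p.2 (modified F (outerSites G A C T) (innerSites G A T) s)) :=
    fun T hT p => (ev_modified_eq_sum ρ (Finset.subset_union_left.trans
      Finset.subset_union_left) hT p.1 p.2 s).symm
  have hX0 : ∀ T, ¬ Disjoint (outerSites G A C T) (innerSites G A T) → ∀ p, X T p = 0 := by
    intro T hT p
    refine Finset.sum_eq_zero fun D _ => if_neg ?_
    rintro ⟨h1, h2⟩
    exact hT (Finset.disjoint_of_subset_left h1 h2.symm)
  have hsum : ∀ p, ∑ T ∈ (cutSets G A C).powerset, (-1 : ℂ) ^ T.card * X T p = 0 := by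
    intro p
    simp only [X, Finset.mul_sum]
    rw [Finset.sum_comm]
    refine Finset.sum_eq_zero fun D _ => ?_
    have := sum_neg_one_pow_eq_zero (D := D) hG hA hC hAC hAc hCc
    have h2 := congrArg (· * ev ρ (openAt A p.1 p.2 (modified F D Finset.univ s))) this
    simp only [zero_mul, Finset.sum_mul] at h2
    refine Eq.trans (Finset.sum_congr rfl fun T _ => ?_) h2
    split_ifs <;> simp
  have hmod : modified F (outerSites G A C ∅) (innerSites G A ∅) s = modified F (A ∪ C) ∅ s := by
    simp [outerSites, innerSites]
  -- Solve the alternating identity for the term `T = ∅`. The signs disappear in the triangle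
  -- inequality below, and conflicting families contribute zero.
  have h0 : ∀ p, ev ρ (openAt A p.1 p.2 (modified F (A ∪ C) ∅ s)) =
      ∑ T ∈ (cutSets G A C).powerset.erase ∅, -(-1 : ℂ) ^ T.card * X T p := by
    intro p
    have h1 := hsum p
    rw [← Finset.add_sum_erase _ _ (Finset.empty_mem_powerset _),
      hX ∅ (by simp [innerSites]), hmod] at h1
    simp only [Finset.card_empty, pow_zero, one_mul] at h1
    rw [eq_neg_of_add_eq_zero_left h1, ← Finset.sum_neg_distrib]
    exact Finset.sum_congr rfl fun T _ => by ring
  unfold nrm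
  simp only [h0]
  refine (l2_sum_le _ _).trans (Finset.sum_le_sum fun T _ => ?_)
  have hsign : ‖-(-1 : ℂ) ^ T.card‖ = 1 := by simp
  rw [l2_smul, hsign, one_mul]
  split_ifs with hT
  · refine le_of_eq ?_
    congr 1
    funext p
    exact hX T hT p
  · refine le_of_eq ?_
    have : X T = fun _ => 0 := funext (hX0 T hT)
    rw [this]
    simp [l2]

/-- The full sum over subsets is `∏ (1 + z)`, bounded factor by factor with `1 + z ≤ exp z`. -/
theorem sum_nonempty_prod_le (S : Finset (Finset V)) (z : Finset V → ℝ) (hz : ∀ T, 0 ≤ z T) :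
    ∑ T ∈ S.powerset.erase ∅, ∏ t ∈ T, z t ≤ Real.exp (∑ t ∈ S, z t) - 1 := by
  have h1 := Finset.add_sum_erase S.powerset (fun T => ∏ t ∈ T, z t) (Finset.empty_mem_powerset S)
  rw [← Finset.prod_add_one, Finset.prod_empty] at h1
  have h2 : ∏ t ∈ S, (z t + 1) ≤ Real.exp (∑ t ∈ S, z t) := by
    rw [Real.exp_sum]
    exact Finset.prod_le_prod (fun t _ => by linarith [hz t]) fun t _ => Real.add_one_le_exp _
  linarith

/-- The Hilbert-Schmidt norm of the state of `A` after the measurement, summed over the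
outcomes. -/
theorem phi_le_exp [∀ v, Nonempty (Fin (d v))] (hF : ∀ v, IsPOVM (F v)) {Λ : SimpleGraph V}
    (hΛ : Λ ≤ G) (P : PlaneEmbedding G) {outer : P.Face} (hP : P.IsTriangulation outer)
    {A C : Finset V} (hA : A.Nonempty) (hC : C.Nonempty) (hAC : Disjoint A C)
    (hAc : (G.induce (A : Set V)).Preconnected) (hCc : (G.induce (C : Set V)).Preconnected)
    (hF₂ : ∀ v, v ∉ A → v ∉ C → IsTwoDesignPOVM (F v))
    {Ψ : FullConf d → ℂ} (hΨ : ∑ x, ‖Ψ x‖ ^ 2 = 1) (hloc : StrictlyLocal Λ (pureState Ψ)) :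
    phi (pureState Ψ) F A (A ∪ C) ∅ ≤
      Real.exp (∑ S ∈ cutSets G A C, hsNorm (pureState Ψ) Sᶜ) - 1 := by
  refine le_trans ?_ (sum_nonempty_prod_le _ _ fun _ => l2_nonneg _)
  refine (Finset.sum_le_sum fun s _ =>
    nrm_le_sum P.connected hA hC hAC hAc hCc (pureState Ψ) s).trans ?_
  rw [Finset.sum_comm]
  refine Finset.sum_le_sum fun T hT => ?_
  obtain ⟨hTne, hTsub⟩ := Finset.mem_erase.1 hT
  rw [Finset.mem_powerset] at hTsub
  by_cases hdisj : Disjoint (outerSites G A C T) (innerSites G A T)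
  swap
  · simp only [if_neg hdisj, Finset.sum_const_zero]
    exact Finset.prod_nonneg fun _ _ => l2_nonneg _
  simp only [if_pos hdisj]
  have hAS : ∀ S ∈ T, A ⊆ S := fun S hS => (mem_cutSets.1 (hTsub hS)).1
  have hSC : ∀ S ∈ T, Disjoint S C := fun S hS => (mem_cutSets.1 (hTsub hS)).2.1
  have houter : ∀ S ∈ T, outerBd G S ⊆ outerSites G A C T := fun S hS =>
    (Finset.subset_biUnion_of_mem _ hS).trans Finset.subset_union_right
  have hinner : ∀ S ∈ T, innerBd G S \ A ⊆ innerSites G A T := fun S hS =>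
    Finset.sdiff_subset_sdiff (Finset.subset_biUnion_of_mem _ hS) subset_rfl
  -- Outer layers never meet `A`, because `A ⊆ S`, so removing `A` from the inner sites loses no
  -- conflict.
  have hconf : ∀ S ∈ T, ∀ S' ∈ T, ∀ v ∈ outerBd G S, v ∉ innerBd G S' := by
    intro S hS S' hS' v hv hv'
    have hvA : v ∉ A := fun h => (mem_outerBd.1 hv).1 (hAS S hS h)
    exact Finset.disjoint_left.1 hdisj (houter S hS hv)
      (hinner S' hS' (Finset.mem_sdiff.2 ⟨hv', hvA⟩))
  refine phi_le_prod hF hΛ hΨ hloc ?_ T.card T A _ rfl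
    (Or.inl (Finset.nonempty_iff_ne_empty.2 hTne))
    (Finset.subset_union_left.trans Finset.subset_union_left) hAS houter ?_ ?_ ?_ ?_
  · intro v hv
    obtain ⟨hv1, hv2⟩ := Finset.mem_sdiff.1 hv
    obtain ⟨S, hS, hvS⟩ := Finset.mem_biUnion.1 hv1
    exact hF₂ v hv2 (Finset.disjoint_left.1 (hSC S hS) (mem_innerBd.1 hvS).1)
  · intro S hS v hv
    by_cases hvA : v ∈ A
    · exact Finset.mem_union_right _ hvA
    · exact Finset.mem_union_left _ (hinner S hS (Finset.mem_sdiff.2 ⟨hv, hvA⟩))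
  · exact fun S hS => Finset.disjoint_of_subset_left (hinner S hS) hdisj.symm
  · intro v hv _
    obtain ⟨S, hS, hvS⟩ := Finset.mem_biUnion.1 (Finset.mem_sdiff.1 hv).1
    exact ⟨S, hS, (mem_innerBd.1 hvS).1⟩
  · intro S hS S' hS'
    exact cutSets_nested P hP hA hC (hTsub hS) (hTsub hS') (hconf S hS S' hS')
      (hconf S' hS' S hS)

/-- The Hilbert-Schmidt norm of a reduced state in terms of its Rényi entropy. -/
theorem hsNorm_le_exp (Ψ : FullConf d → ℂ) (E : Finset V) :
    hsNorm (pureState Ψ) E ≤ Real.exp (-((1 / 2) * renyi2 (reduced (pureState Ψ) E))) := by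
  have hherm : ∀ e e', reduced (pureState Ψ) E e' e = star (reduced (pureState Ψ) E e e') := by
    intro e e'
    simp only [reduced, pureState, Matrix.vecMulVec_apply, star_sum, star_mul', Pi.star_apply,
      star_star]
    exact Finset.sum_congr rfl fun r _ => mul_comm _ _
  have htr : ((reduced (pureState Ψ) E * reduced (pureState Ψ) E).trace).re =
      ∑ p : Conf d E × Conf d E, ‖reduced (pureState Ψ) E p.1 p.2‖ ^ 2 := by
    have : (reduced (pureState Ψ) E * reduced (pureState Ψ) E).trace =
        ((∑ p : Conf d E × Conf d E, ‖reduced (pureState Ψ) E p.1 p.2‖ ^ 2 : ℝ) : ℂ) := by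
      rw [Complex.ofReal_sum, Fintype.sum_prod_type]
      refine Finset.sum_congr rfl fun e _ => ?_
      rw [Matrix.diag_apply, Matrix.mul_apply]
      refine Finset.sum_congr rfl fun e' _ => ?_
      rw [norm_sq_eq_mul_conj, hherm e e']
    rw [this, Complex.ofReal_re]
  rw [renyi2, htr, hsNorm, l2]
  set q := ∑ p : Conf d E × Conf d E, ‖reduced (pureState Ψ) E p.1 p.2‖ ^ 2
  have hq : 0 ≤ q := Finset.sum_nonneg fun _ _ => by positivity
  -- If the purity were zero, `Real.log 0 = 0` would make the right side 1; this is why only an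
  -- inequality is claimed.
  rcases hq.eq_or_lt with h | h
  · rw [← h]
    simp
  · rw [Real.sqrt_eq_rpow, Real.rpow_def_of_pos h]
    refine le_of_eq ?_
    congr 1
    ring

/-- The `C`-side of the edge cut of `S` is `Sᶜ`, so each weight is bounded by that of a distinct
walk; further separating walks only add positive terms. -/
theorem sum_hsNorm_le_zSAW (P : PlaneEmbedding G) {A C : Finset V} (hA : A.Nonempty)
    (hC : C.Nonempty) (Ψ : FullConf d → ℂ) :
    ∑ S ∈ cutSets G A C, hsNorm (pureState Ψ) Sᶜ ≤ zSAW P Ψ A C := by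
  refine le_trans ?_ (sum_cutSets_le P hA hC (fun W => Real.exp (-cutEnergy G Ψ C W))
    fun _ => (Real.exp_pos _).le)
  refine Finset.sum_le_sum fun S hS => ?_
  rw [cutEnergy, cSide_edgeCut hC hS]
  exact hsNorm_le_exp Ψ Sᶜ

end Expansion

/-! ### Distillation by random projections -/

section TraceNorm

variable {m : Type*} [Fintype m] [DecidableEq m]

theorem traceNorm_nonneg (Y : Matrix m m ℂ) : 0 ≤ traceNorm Y :=
  Finset.sum_nonneg fun _ _ => Real.sqrt_nonneg _

/-- Variational characterization of the trace norm. -/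
theorem exists_trace_mul_eq_traceNorm (Y : Matrix m m ℂ) :
    ∃ U : Matrix m m ℂ, (U * Y).trace = (traceNorm Y : ℂ) ∧ ∀ a, ∑ b, ‖U a b‖ ^ 2 ≤ 1 := by
  have hH := Matrix.isHermitian_conjTranspose_mul_self Y
  let ev : m → ℝ := hH.eigenvalues
  have hev : ∀ i, 0 ≤ ev i := Matrix.eigenvalues_conjTranspose_mul_self_nonneg Y
  let W : Matrix m m ℂ := hH.eigenvectorUnitary
  have hW1 : W.conjTranspose * W = 1 := by
    have := Unitary.coe_star_mul_self hH.eigenvectorUnitary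
    simpa [W, Matrix.star_eq_conjTranspose] using this
  have hW2 : W * W.conjTranspose = 1 := by
    have := Unitary.coe_mul_star_self hH.eigenvectorUnitary
    simpa [W, Matrix.star_eq_conjTranspose] using this
  have hspec : Y.conjTranspose * Y =
      W * Matrix.diagonal (fun i => (ev i : ℂ)) * W.conjTranspose := by
    have := hH.spectral_theorem
    rw [Unitary.conjStarAlgAut_apply] at this
    exact this
  -- The maximizer is `(YᴴY)^(-1/2) Yᴴ`, with the inverse taken as zero on the kernel through `0⁻¹ =
  -- 0`. It is a partial isometry, so its rows have norm at most one.
  let σ : m → ℂ := fun i => ((Real.sqrt (ev i))⁻¹ : ℝ)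
  refine ⟨W * Matrix.diagonal σ * W.conjTranspose * Y.conjTranspose, ?_, ?_⟩
  · have h1 : W * Matrix.diagonal σ * W.conjTranspose * Y.conjTranspose * Y =
        W * Matrix.diagonal (fun i => σ i * ev i) * W.conjTranspose := by
      rw [Matrix.mul_assoc _ Y.conjTranspose Y, hspec, ← Matrix.diagonal_mul_diagonal]
      calc _ = W * Matrix.diagonal σ * (W.conjTranspose * W) *
            Matrix.diagonal (fun i => (ev i : ℂ)) * W.conjTranspose := by
              simp only [Matrix.mul_assoc]
        _ = _ := by rw [hW1, Matrix.mul_one]; simp only [Matrix.mul_assoc]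
    rw [h1, Matrix.trace_mul_comm, ← Matrix.mul_assoc, hW1, Matrix.one_mul, Matrix.trace_diagonal,
      traceNorm, Complex.ofReal_sum]
    refine Finset.sum_congr rfl fun i _ => ?_
    simp only [σ]
    rw [← Complex.ofReal_mul]
    congr 1
    rcases (hev i).eq_or_lt with h | h
    · have : ev i = 0 := h.symm
      change (Real.sqrt (ev i))⁻¹ * ev i = Real.sqrt (ev i)
      rw [this]; simp
    · change (Real.sqrt (ev i))⁻¹ * ev i = Real.sqrt (ev i)
      have h2 := Real.sqrt_pos.2 h
      rw [inv_mul_eq_div, div_eq_iff h2.ne', Real.mul_self_sqrt h.le]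
  · intro a
    have hσ : ∀ i, star (σ i) = σ i := fun i => Complex.conj_ofReal _
    have h1 : (W * Matrix.diagonal σ * W.conjTranspose * Y.conjTranspose) *
        (W * Matrix.diagonal σ * W.conjTranspose * Y.conjTranspose).conjTranspose =
        W * Matrix.diagonal (fun i => σ i * ev i * σ i) * W.conjTranspose := by
      have hd : (Matrix.diagonal σ).conjTranspose = Matrix.diagonal σ := by
        rw [Matrix.diagonal_conjTranspose]
        congr 1
        exact funext hσ
      simp only [Matrix.conjTranspose_mul, Matrix.conjTranspose_conjTranspose, hd]
      calc _ = W * Matrix.diagonal σ * W.conjTranspose * (Y.conjTranspose * Y) *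
            (W * Matrix.diagonal σ * W.conjTranspose) := by simp only [Matrix.mul_assoc]
        _ = W * Matrix.diagonal σ * (W.conjTranspose * W) *
            Matrix.diagonal (fun i => (ev i : ℂ)) * (W.conjTranspose * W) *
              Matrix.diagonal σ * W.conjTranspose := by
              rw [hspec]; simp only [Matrix.mul_assoc]
        _ = _ := by
          rw [hW1, Matrix.mul_one, Matrix.mul_one, ← Matrix.diagonal_mul_diagonal,
            ← Matrix.diagonal_mul_diagonal]
          simp only [Matrix.mul_assoc]
    have hrow : ∀ (M : Matrix m m ℂ) (a : m),
        ((∑ b, ‖M a b‖ ^ 2 : ℝ) : ℂ) = (M * M.conjTranspose) a a := by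
      intro M a
      rw [Complex.ofReal_sum, Matrix.mul_apply]
      exact Finset.sum_congr rfl fun b _ => norm_sq_eq_mul_conj _
    have h2 : ∑ b, ‖(W * Matrix.diagonal σ * W.conjTranspose * Y.conjTranspose) a b‖ ^ 2 =
        ∑ i, ((Real.sqrt (ev i))⁻¹ * ev i * (Real.sqrt (ev i))⁻¹) * ‖W a i‖ ^ 2 := by
      apply Complex.ofReal_injective
      rw [hrow, h1, Matrix.mul_apply, Complex.ofReal_sum]
      refine Finset.sum_congr rfl fun i _ => ?_
      rw [Matrix.mul_diagonal, Complex.ofReal_mul, norm_sq_eq_mul_conj, Complex.ofReal_mul,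
        Complex.ofReal_mul, Matrix.conjTranspose_apply]
      simp only [σ]
      ring
    have h3 : ∑ i, ‖W a i‖ ^ 2 = 1 := by
      apply Complex.ofReal_injective
      rw [hrow, hW2, Matrix.one_apply_eq, Complex.ofReal_one]
    rw [h2, ← h3]
    refine Finset.sum_le_sum fun i _ => ?_
    refine mul_le_of_le_one_left (by positivity) ?_
    rcases (hev i).eq_or_lt with h | h
    · rw [← h]; simp
    · have h2 := Real.sqrt_pos.2 h
      have h3 : (Real.sqrt (ev i))⁻¹ * ev i * (Real.sqrt (ev i))⁻¹ = 1 := by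
        nth_rewrite 2 [← Real.mul_self_sqrt h.le]
        field_simp
      exact h3.le

end TraceNorm

/-! ### Second moments of random unitaries followed by a projection. -/

section Twirl

variable {n : Type*} [Fintype n] [DecidableEq n]

theorem trace_swapOp_mul_kronecker (M N : Matrix n n ℂ) :
    (swapOp n * (M ⊗ₖ N)).trace = (M * N).trace := by
  simp only [Matrix.trace, Matrix.diag_apply, Matrix.mul_apply, swapOp, Fintype.sum_prod_type,
    Matrix.kroneckerMap_apply, ite_mul, one_mul, zero_mul, ite_and]
  simp only [Finset.sum_ite_eq, Finset.mem_univ, if_true]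
  rw [Finset.sum_comm]

theorem swapOp_mul_swapOp : swapOp n * swapOp n = 1 := by
  ext ⟨i, j⟩ ⟨k, l⟩
  simp only [Matrix.mul_apply, swapOp, Fintype.sum_prod_type, Matrix.one_apply, Prod.mk.injEq]
  rw [Finset.sum_eq_single j, Finset.sum_eq_single i]
  · simp [and_comm]
  · intro b _ hb; simp [hb.symm]
  · simp
  · intro b _ hb
    refine Finset.sum_eq_zero fun c _ => ?_
    simp [hb.symm]
  · simp

theorem trace_swapOp : (swapOp n).trace = Fintype.card n := by
  have := trace_swapOp_mul_kronecker (1 : Matrix n n ℂ) 1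
  rw [Matrix.one_kronecker_one, Matrix.mul_one, Matrix.mul_one, Matrix.trace_one] at this
  exact this

/-- The functional `Tr[(SWAP - 1 / δ) (Q ⊗ Q) T]`. -/
def projVar (Q : Matrix n n ℂ) (δ : ℂ) (T : Matrix (n × n) (n × n) ℂ) : ℂ :=
  (swapOp n * (Q ⊗ₖ Q) * T).trace - δ⁻¹ * ((Q ⊗ₖ Q) * T).trace

theorem projVar_add (Q : Matrix n n ℂ) (δ : ℂ) (T T' : Matrix (n × n) (n × n) ℂ) :
    projVar Q δ (T + T') = projVar Q δ T + projVar Q δ T' := by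
  simp only [projVar, Matrix.mul_add, Matrix.trace_add]; ring

theorem projVar_smul (Q : Matrix n n ℂ) (δ c : ℂ) (T : Matrix (n × n) (n × n) ℂ) :
    projVar Q δ (c • T) = c * projVar Q δ T := by
  simp only [projVar, Matrix.mul_smul, Matrix.trace_smul, smul_eq_mul]; ring

theorem projVar_sum {K : Type*} (Q : Matrix n n ℂ) (δ : ℂ) (s : Finset K)
    (T : K → Matrix (n × n) (n × n) ℂ) :
    projVar Q δ (∑ k ∈ s, T k) = ∑ k ∈ s, projVar Q δ (T k) := by
  simp only [projVar, Matrix.trace_sum, Finset.mul_sum, Finset.sum_sub_distrib]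

theorem projVar_kronecker (Q : Matrix n n ℂ) (δ : ℂ) (M N : Matrix n n ℂ) :
    projVar Q δ (M ⊗ₖ N) = (Q * M * (Q * N)).trace -
      δ⁻¹ * ((Q * M).trace * (Q * N).trace) := by
  rw [projVar, Matrix.mul_assoc, ← Matrix.mul_kronecker_mul, trace_swapOp_mul_kronecker,
    Matrix.trace_kronecker]

/-- The functional measures deviation from the maximally mixed output, so it vanishes on the
identity; only the swap component of the twirl survives. -/
theorem projVar_one {Q : Matrix n n ℂ} {δ : ℂ} (hQ : Q * Q = Q) (hQt : Q.trace = δ) :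
    projVar Q δ 1 = 0 := by
  rw [← Matrix.one_kronecker_one, projVar_kronecker, Matrix.mul_one, hQ, hQt]
  field_simp
  ring

theorem projVar_swapOp {Q : Matrix n n ℂ} {δ : ℂ} (hδ : δ ≠ 0) (hQ : Q * Q = Q)
    (hQt : Q.trace = δ) : projVar Q δ (swapOp n) = δ ^ 2 - 1 := by
  have h1 : (swapOp n * (Q ⊗ₖ Q) * swapOp n).trace = δ * δ := by
    rw [Matrix.trace_mul_comm, ← Matrix.mul_assoc, swapOp_mul_swapOp, Matrix.one_mul,
      Matrix.trace_kronecker, hQt]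
  rw [projVar, h1, Matrix.trace_mul_comm, trace_swapOp_mul_kronecker, hQ, hQt]
  field_simp

/-- The variance of a randomly rotated operator after a projection. -/
theorem projVar_haarTwirl {Q : Matrix n n ℂ} {δ : ℂ} (hδ : δ ≠ 0) (hQ : Q * Q = Q)
    (hQt : Q.trace = δ) (M N : Matrix n n ℂ) :
    projVar Q δ (haarTwirl (M ⊗ₖ N)) = 2⁻¹ * (δ ^ 2 - 1) *
      ((M.trace * N.trace + (M * N).trace) / ((Fintype.card n : ℂ) ^ 2 + Fintype.card n) -
        (M.trace * N.trace - (M * N).trace) / ((Fintype.card n : ℂ) ^ 2 - Fintype.card n)) := by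
  have h1 : projVar Q δ (symProj n) = 2⁻¹ * (δ ^ 2 - 1) := by
    rw [symProj, projVar_smul, projVar_add, projVar_one hQ hQt, projVar_swapOp hδ hQ hQt,
      zero_add]
  have h2 : projVar Q δ (antiProj n) = -(2⁻¹ * (δ ^ 2 - 1)) := by
    rw [antiProj, sub_eq_add_neg, ← neg_one_smul ℂ (swapOp n), projVar_smul, projVar_add,
      projVar_smul, projVar_one hQ hQt, projVar_swapOp hδ hQ hQt]
    ring
  have h3 : (symProj n * (M ⊗ₖ N)).trace = 2⁻¹ * (M.trace * N.trace + (M * N).trace) := by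
    rw [symProj, Matrix.smul_mul, Matrix.trace_smul, Matrix.add_mul, Matrix.one_mul,
      Matrix.trace_add, trace_swapOp_mul_kronecker, Matrix.trace_kronecker, smul_eq_mul]
  have h4 : (antiProj n * (M ⊗ₖ N)).trace = 2⁻¹ * (M.trace * N.trace - (M * N).trace) := by
    rw [antiProj, Matrix.smul_mul, Matrix.trace_smul, Matrix.sub_mul, Matrix.one_mul,
      Matrix.trace_sub, trace_swapOp_mul_kronecker, Matrix.trace_kronecker, smul_eq_mul]
  have h5 : (symProj n).trace = 2⁻¹ * ((Fintype.card n : ℂ) ^ 2 + Fintype.card n) := by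
    rw [symProj, Matrix.trace_smul, Matrix.trace_add, Matrix.trace_one, trace_swapOp,
      Fintype.card_prod, smul_eq_mul]
    push_cast; ring
  have h6 : (antiProj n).trace = 2⁻¹ * ((Fintype.card n : ℂ) ^ 2 - Fintype.card n) := by
    rw [antiProj, Matrix.trace_smul, Matrix.trace_sub, Matrix.trace_one, trace_swapOp,
      Fintype.card_prod, smul_eq_mul]
    push_cast; ring
  have h7 : (2⁻¹ : ℂ) ≠ 0 := by norm_num
  rw [haarTwirl, projVar_add, projVar_smul, projVar_smul, h1, h2, h3, h4, h5, h6,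
    mul_div_mul_left _ _ h7, mul_div_mul_left _ _ h7]
  ring

end Twirl

/-! ### Distillation error from the Hilbert-Schmidt norm. -/

section Distill

variable {n : Type*} [Fintype n] [DecidableEq n]

theorem trace_mul_conjTranspose_self {m : Type*} [Fintype m] (M : Matrix m m ℂ) :
    (M * M.conjTranspose).trace = ((∑ i, ∑ j, ‖M i j‖ ^ 2 : ℝ) : ℂ) := by
  rw [Complex.ofReal_sum]
  refine Finset.sum_congr rfl fun i _ => ?_
  rw [Matrix.diag_apply, Matrix.mul_apply, Complex.ofReal_sum]
  exact Finset.sum_congr rfl fun j _ => (norm_sq_eq_mul_conj _).symm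

/-- The traceless part of a square matrix. -/
def traceless {m : ℕ} (Y : Matrix (Fin m) (Fin m) ℂ) : Matrix (Fin m) (Fin m) ℂ :=
  Y - ((m : ℂ)⁻¹ * Y.trace) • 1

/-- Removing the trace part reduces the squared Hilbert-Schmidt norm. -/
theorem sum_norm_sq_sub_trace {m : ℕ} (hm : 0 < m) (Y : Matrix (Fin m) (Fin m) ℂ) :
    ((∑ i, ∑ j, ‖traceless Y i j‖ ^ 2 : ℝ) : ℂ) =
      (Y * Y.conjTranspose).trace - (m : ℂ)⁻¹ * (Y.trace * star Y.trace) := by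
  have hm' : (m : ℂ) ≠ 0 := Nat.cast_ne_zero.2 hm.ne'
  have hst : star (m : ℂ) = m := Complex.conj_natCast m
  rw [← trace_mul_conjTranspose_self, traceless]
  simp only [Matrix.conjTranspose_sub, Matrix.conjTranspose_smul, Matrix.conjTranspose_one,
    Matrix.mul_sub, Matrix.sub_mul, Matrix.smul_mul, Matrix.mul_smul, Matrix.one_mul,
    Matrix.mul_one, Matrix.trace_sub, Matrix.trace_smul, Matrix.trace_one, smul_eq_mul,
    Matrix.trace_conjTranspose, star_mul', star_inv₀, hst, Fintype.card_fin]
  field_simp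
  ring

variable {K : Type*} [Fintype K] [DecidableEq K] {d' : ℕ}

theorem le_card_of_isometry {L₀ : Matrix n (Fin d') ℂ} (hL₀ : L₀.conjTranspose * L₀ = 1) :
    d' ≤ Fintype.card n := by
  have h1 := Matrix.rank_mul_le_right L₀.conjTranspose L₀
  rw [hL₀, Matrix.rank_one, Fintype.card_fin] at h1
  exact h1.trans (Matrix.rank_le_card_height L₀)

/-- The average over a unitary 2-design of the squared Hilbert-Schmidt norm of the traceless part
of the projected operator. -/
theorem sum_variance_eq {L₀ : Matrix n (Fin d') ℂ} (hL₀ : L₀.conjTranspose * L₀ = 1)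
    (hd' : 0 < d') {p : K → ℝ} {U : K → Matrix n n ℂ} (hU : IsUnitaryTwoDesign p U)
    (X : Matrix n n ℂ) :
    ∑ k, p k * ∑ i, ∑ j, ‖traceless
        (L₀.conjTranspose * U k * X * (L₀.conjTranspose * U k).conjTranspose) i j‖ ^ 2 =
      2⁻¹ * ((d' : ℝ) ^ 2 - 1) *
        ((‖X.trace‖ ^ 2 + ∑ i, ∑ j, ‖X i j‖ ^ 2) /
            ((Fintype.card n : ℝ) ^ 2 + Fintype.card n) -
          (‖X.trace‖ ^ 2 - ∑ i, ∑ j, ‖X i j‖ ^ 2) /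
            ((Fintype.card n : ℝ) ^ 2 - Fintype.card n)) := by
  set Q : Matrix n n ℂ := L₀ * L₀.conjTranspose with hQdef
  have hδ : (d' : ℂ) ≠ 0 := Nat.cast_ne_zero.2 hd'.ne'
  have hQ : Q * Q = Q := by
    rw [hQdef]
    calc _ = L₀ * (L₀.conjTranspose * L₀) * L₀.conjTranspose := by simp only [Matrix.mul_assoc]
      _ = _ := by rw [hL₀, Matrix.mul_one]
  have hQt : Q.trace = d' := by
    rw [hQdef, Matrix.trace_mul_comm, hL₀, Matrix.trace_one, Fintype.card_fin]
  -- With `Q = L₀ L₀ᴴ`, the functional evaluated on the rotated `X ⊗ Xᴴ` is the squared norm of the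
  -- traceless projected operator, so the design identity averages it.
  have hk : ∀ k, projVar Q (d' : ℂ) ((U k ⊗ₖ U k) * (X ⊗ₖ X.conjTranspose) *
      (U k ⊗ₖ U k).conjTranspose) =
      ((∑ i, ∑ j, ‖traceless
        (L₀.conjTranspose * U k * X * (L₀.conjTranspose * U k).conjTranspose) i j‖ ^ 2 : ℝ) : ℂ) := by
    intro k
    rw [sum_norm_sq_sub_trace hd', Matrix.conjTranspose_kronecker, ← Matrix.mul_kronecker_mul,
      ← Matrix.mul_kronecker_mul, projVar_kronecker]
    set A := U k * X * (U k).conjTranspose with hA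
    have hA' : U k * X.conjTranspose * (U k).conjTranspose = A.conjTranspose := by
      simp only [hA, Matrix.conjTranspose_mul, Matrix.conjTranspose_conjTranspose, Matrix.mul_assoc]
    have hY : L₀.conjTranspose * U k * X * (L₀.conjTranspose * U k).conjTranspose =
        L₀.conjTranspose * A * L₀ := by
      simp only [hA, Matrix.conjTranspose_mul, Matrix.conjTranspose_conjTranspose, Matrix.mul_assoc]
    have ht : ∀ B : Matrix n n ℂ, (Q * B).trace = (L₀.conjTranspose * B * L₀).trace := by
      intro B
      rw [hQdef, Matrix.mul_assoc, Matrix.trace_mul_comm]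
    have hst : star (L₀.conjTranspose * A * L₀).trace =
        (L₀.conjTranspose * A.conjTranspose * L₀).trace := by
      rw [← Matrix.trace_conjTranspose]
      simp only [Matrix.conjTranspose_mul, Matrix.conjTranspose_conjTranspose, Matrix.mul_assoc]
    rw [hA', hY, hst, ht, ht]
    congr 1
    have h2 : (Q * A * (Q * A.conjTranspose)) = Q * (A * Q * A.conjTranspose) := by
      simp only [Matrix.mul_assoc]
    rw [h2, ht, hQdef]
    simp only [Matrix.conjTranspose_mul, Matrix.conjTranspose_conjTranspose, Matrix.mul_assoc]
  have htw := congrArg (projVar Q (d' : ℂ)) (hU.twirl (X ⊗ₖ X.conjTranspose))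
  rw [projVar_sum, projVar_haarTwirl hδ hQ hQt, trace_mul_conjTranspose_self,
    Matrix.trace_conjTranspose, ← norm_sq_eq_mul_conj] at htw
  simp only [projVar_smul, hk] at htw
  apply Complex.ofReal_injective
  push_cast at htw ⊢
  exact htw

/-- In dimension `N > 1` the exact value is `(d'² - 1)/(N² - 1) · (q - τ/N)`, and `d' ≤ N` gives
`(d'² - 1)/(N² - 1) ≤ (d'/N)²`. -/
theorem sum_variance_le {L₀ : Matrix n (Fin d') ℂ} (hL₀ : L₀.conjTranspose * L₀ = 1)
    (hd' : 0 < d') {p : K → ℝ} {U : K → Matrix n n ℂ} (hU : IsUnitaryTwoDesign p U)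
    (X : Matrix n n ℂ) :
    ∑ k, p k * ∑ i, ∑ j, ‖traceless
        (L₀.conjTranspose * U k * X * (L₀.conjTranspose * U k).conjTranspose) i j‖ ^ 2 ≤
      ((d' : ℝ) / Fintype.card n) ^ 2 * ∑ i, ∑ j, ‖X i j‖ ^ 2 := by
  rw [sum_variance_eq hL₀ hd' hU X]
  have hle := le_card_of_isometry hL₀
  set q := ∑ i, ∑ j, ‖X i j‖ ^ 2 with hq
  have hq0 : 0 ≤ q := Finset.sum_nonneg fun _ _ => Finset.sum_nonneg fun _ _ => by positivity
  set τ := ‖X.trace‖ ^ 2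
  have hτ : 0 ≤ τ := by positivity
  have hd1 : (1 : ℝ) ≤ d' := by exact_mod_cast hd'
  rcases Nat.lt_or_ge 1 (Fintype.card n) with hn | hn
  · have hN : (1 : ℝ) < Fintype.card n := by exact_mod_cast hn
    have hdN : (d' : ℝ) ≤ Fintype.card n := by exact_mod_cast hle
    set N : ℝ := (Fintype.card n : ℝ)
    have hN1 : N - 1 ≠ 0 := by linarith
    have hN2 : N + 1 ≠ 0 := by linarith
    have hN0 : N ≠ 0 := by linarith
    have hpos : 0 < N ^ 2 - 1 := by nlinarith
    have hpos' : N ^ 2 - 1 ≠ 0 := hpos.ne'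
    have e1 : (τ + q) / (N ^ 2 + N) - (τ - q) / (N ^ 2 - N) = 2 * (q - τ / N) / (N ^ 2 - 1) := by
      have h1 : N ^ 2 + N = N * (N + 1) := by ring
      have h2 : N ^ 2 - N = N * (N - 1) := by ring
      have h3 : N ^ 2 - 1 = (N - 1) * (N + 1) := by ring
      rw [h1, h2, h3]
      field_simp
      ring
    rw [e1]
    have e2 : 2⁻¹ * ((d' : ℝ) ^ 2 - 1) * (2 * (q - τ / N) / (N ^ 2 - 1)) =
        ((d' : ℝ) ^ 2 - 1) / (N ^ 2 - 1) * (q - τ / N) := by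
      field_simp
    rw [e2]
    have hd2 : 0 ≤ (d' : ℝ) ^ 2 - 1 := by nlinarith
    have h4 : ((d' : ℝ) ^ 2 - 1) / (N ^ 2 - 1) ≤ (d' / N) ^ 2 := by
      rw [div_pow, div_le_div_iff₀ hpos (by positivity)]
      have : (d' : ℝ) ^ 2 ≤ N ^ 2 := by nlinarith
      nlinarith
    have h5 : 0 ≤ τ / N := div_nonneg hτ (by linarith)
    calc _ ≤ ((d' : ℝ) ^ 2 - 1) / (N ^ 2 - 1) * q :=
          mul_le_mul_of_nonneg_left (by linarith) (div_nonneg hd2 hpos.le)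
      _ ≤ _ := mul_le_mul_of_nonneg_right h4 hq0
  -- In dimension one the antisymmetric denominator vanishes, but `d' = 1` makes the prefactor zero.
  · have h1 : d' = 1 := by omega
    rw [h1]
    simp only [Nat.cast_one, one_pow, sub_self, mul_zero, zero_mul]
    positivity

/-- The distillation error is bounded by the Hilbert-Schmidt norm of the state. -/
theorem distillError_le {L₀ : Matrix n (Fin d') ℂ} (hL₀ : L₀.conjTranspose * L₀ = 1)
    (hd' : 0 < d') {p : K → ℝ} {U : K → Matrix n n ℂ} (hU : IsUnitaryTwoDesign p U)
    (X : Matrix n n ℂ) :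
    distillError L₀ p U X ≤ Real.sqrt d' * l2 (fun q : n × n => X q.1 q.2) := by
  let Y : K → Matrix (Fin d') (Fin d') ℂ := fun k =>
    L₀.conjTranspose * U k * X * (L₀.conjTranspose * U k).conjTranspose
  let Z : K → Matrix (Fin d') (Fin d') ℂ := fun k => traceless (Y k)
  set c : ℝ := (Fintype.card n : ℝ) / d' with hc
  have hcc : (Fintype.card n : ℂ) / (d' : ℂ) = (c : ℂ) := by rw [hc]; push_cast; rfl
  have hc0 : 0 ≤ c := by positivity
  have hdist : ∀ i j k l, distill L₀ p U X (i, k) (j, l) =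
      if k = l then (c : ℂ) * (p k * Y k i j) else 0 := by
    intro i j k l
    simp only [distill, hcc, Matrix.smul_apply, Matrix.sum_apply, Matrix.kroneckerMap_apply,
      smul_eq_mul, Matrix.single_apply]
    by_cases hkl : k = l
    · subst hkl
      rw [Finset.sum_eq_single k]
      · simp [Y]
      · intro b _ hb; simp [hb]
      · simp
    · rw [if_neg hkl, Finset.sum_eq_zero, mul_zero]
      intro b _
      rw [if_neg]
      · ring
      · rintro ⟨rfl, rfl⟩; exact hkl rfl
  -- The deviation from the ideal output is block diagonal in the register, with the traceless parts
  -- `Z k` as blocks.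
  have hΔ : ∀ i j k l, (distill L₀ p U X - ((d' : ℂ)⁻¹ • (1 : Matrix (Fin d') (Fin d') ℂ)) ⊗ₖ
      registerState (distill L₀ p U X)) (i, k) (j, l) =
      if k = l then (c : ℂ) * (p k * Z k i j) else 0 := by
    intro i j k l
    rw [Matrix.sub_apply, Matrix.kroneckerMap_apply, registerState, hdist]
    simp only [hdist, Matrix.smul_apply, smul_eq_mul]
    by_cases hkl : k = l
    · simp only [if_pos hkl, ← Finset.mul_sum]
      simp only [Z, traceless, Matrix.sub_apply, Matrix.smul_apply, smul_eq_mul, Matrix.trace,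
        Matrix.diag_apply]
      ring
    · simp [hkl]
  obtain ⟨W, hW1, hW2⟩ := exists_trace_mul_eq_traceNorm (distill L₀ p U X -
    ((d' : ℂ)⁻¹ • (1 : Matrix (Fin d') (Fin d') ℂ)) ⊗ₖ registerState (distill L₀ p U X))
  have htr : ((distillError L₀ p U X : ℝ) : ℂ) =
      ∑ k, ∑ j, ∑ i, W (j, k) (i, k) * ((c : ℂ) * (p k * Z k i j)) := by
    rw [distillError, ← hW1, Matrix.trace, Fintype.sum_prod_type, Finset.sum_comm]
    refine Finset.sum_congr rfl fun k _ => Finset.sum_congr rfl fun j _ => ?_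
    rw [Matrix.diag_apply, Matrix.mul_apply, Fintype.sum_prod_type]
    refine Finset.sum_congr rfl fun i _ => ?_
    rw [Finset.sum_eq_single k]
    · rw [hΔ, if_pos rfl]
    · intro l _ hl
      rw [hΔ, if_neg hl, mul_zero]
    · intro h; exact absurd (Finset.mem_univ k) h
  have hp := hU.nonneg
  -- Each factor receives `√p`, so that Cauchy-Schwarz produces two averages over the ensemble: at
  -- most `d'` from the rows of `W`, and at most `c⁻²` times the squared norm of `X` from the
  -- blocks.
  have hbound : distillError L₀ p U X ≤
      c * ∑ q : K × Fin d' × Fin d', (Real.sqrt (p q.1 * ‖W (q.2.1, q.1) (q.2.2, q.1)‖ ^ 2) *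
        Real.sqrt (p q.1 * ‖Z q.1 q.2.2 q.2.1‖ ^ 2)) := by
    have h1 : distillError L₀ p U X = ‖((distillError L₀ p U X : ℝ) : ℂ)‖ := by
      rw [Complex.norm_real,
        Real.norm_of_nonneg (show 0 ≤ distillError L₀ p U X from traceNorm_nonneg _)]
    rw [h1, htr]
    refine (norm_sum_le _ _).trans ?_
    rw [Fintype.sum_prod_type, Finset.mul_sum]
    refine Finset.sum_le_sum fun k _ => ?_
    refine (norm_sum_le _ _).trans ?_
    rw [Fintype.sum_prod_type, Finset.mul_sum]
    refine Finset.sum_le_sum fun j _ => ?_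
    refine (norm_sum_le _ _).trans ?_
    rw [Finset.mul_sum]
    refine Finset.sum_le_sum fun i _ => le_of_eq ?_
    dsimp only
    rw [Real.sqrt_mul (hp k), Real.sqrt_mul (hp k), Real.sqrt_sq (norm_nonneg _),
      Real.sqrt_sq (norm_nonneg _), norm_mul, norm_mul, norm_mul, Complex.norm_real,
      Complex.norm_real, Real.norm_of_nonneg hc0, Real.norm_of_nonneg (hp k)]
    have := Real.mul_self_sqrt (hp k)
    calc _ = c * ((Real.sqrt (p k) * Real.sqrt (p k)) * ‖W (j, k) (i, k)‖ * ‖Z k i j‖) := by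
          rw [this]; ring
      _ = _ := by ring
  have hWsum : ∑ q : K × Fin d' × Fin d', p q.1 * ‖W (q.2.1, q.1) (q.2.2, q.1)‖ ^ 2 ≤ d' := by
    rw [Fintype.sum_prod_type]
    have h1 : ∀ k, ∑ x : Fin d' × Fin d', p k * ‖W (x.1, k) (x.2, k)‖ ^ 2 ≤ p k * d' := by
      intro k
      rw [Fintype.sum_prod_type]
      have h2 : ∀ j, ∑ i, p k * ‖W (j, k) (i, k)‖ ^ 2 ≤ p k := by
        intro j
        rw [← Finset.mul_sum]
        refine mul_le_of_le_one_right (hp k) (le_trans ?_ (hW2 (j, k)))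
        rw [Fintype.sum_prod_type]
        exact Finset.sum_le_sum fun i _ => Finset.single_le_sum
          (f := fun l => ‖W (j, k) (i, l)‖ ^ 2) (fun _ _ => by positivity) (Finset.mem_univ k)
      refine (Finset.sum_le_sum fun j _ => h2 j).trans ?_
      rw [Finset.sum_const, Finset.card_univ, Fintype.card_fin, nsmul_eq_mul, mul_comm]
    refine (Finset.sum_le_sum fun k _ => h1 k).trans ?_
    rw [← Finset.sum_mul, hU.sum_eq_one, one_mul]
  have hZsum : ∑ q : K × Fin d' × Fin d', p q.1 * ‖Z q.1 q.2.2 q.2.1‖ ^ 2 ≤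
      (c⁻¹) ^ 2 * ∑ i, ∑ j, ‖X i j‖ ^ 2 := by
    have h1 := sum_variance_le hL₀ hd' hU X
    rw [hc, inv_div]
    refine le_trans (le_of_eq ?_) h1
    rw [Fintype.sum_prod_type]
    refine Finset.sum_congr rfl fun k _ => ?_
    rw [Fintype.sum_prod_type, Finset.sum_comm]
    simp only [Finset.mul_sum]
    rfl
  have hcpos : 0 < c := by
    have := le_card_of_isometry hL₀
    have h2 : 0 < Fintype.card n := lt_of_lt_of_le hd' this
    have h3 : (0 : ℝ) < Fintype.card n := by exact_mod_cast h2
    have h4 : (0 : ℝ) < d' := by exact_mod_cast hd'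
    positivity
  refine hbound.trans ?_
  have hCS := Real.sum_sqrt_mul_sqrt_le (Finset.univ : Finset (K × Fin d' × Fin d'))
    (f := fun q => p q.1 * ‖W (q.2.1, q.1) (q.2.2, q.1)‖ ^ 2)
    (g := fun q => p q.1 * ‖Z q.1 q.2.2 q.2.1‖ ^ 2)
    (fun q => mul_nonneg (hp _) (by positivity)) (fun q => mul_nonneg (hp _) (by positivity))
  have hl2 : l2 (fun q : n × n => X q.1 q.2) = Real.sqrt (∑ i, ∑ j, ‖X i j‖ ^ 2) := by
    rw [l2, Fintype.sum_prod_type]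
  calc _ ≤ c * (Real.sqrt d' * (c⁻¹ * l2 (fun q : n × n => X q.1 q.2))) := by
        refine mul_le_mul_of_nonneg_left (hCS.trans ?_) hc0
        refine mul_le_mul (Real.sqrt_le_sqrt hWsum) ?_ (Real.sqrt_nonneg _) (Real.sqrt_nonneg _)
        refine (Real.sqrt_le_sqrt hZsum).trans (le_of_eq ?_)
        rw [Real.sqrt_mul (by positivity), Real.sqrt_sq (by positivity), hl2]
    _ = _ := by field_simp

end Distill

/-! ### From the average error to product operators on all sites. -/

section Main

variable {V : Type*} [Fintype V] [DecidableEq V] {d : V → ℕ}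

theorem openAt_apply {K : Finset V} (a a' : Conf d K)
    (G : (v : V) → Matrix (Fin (d v)) (Fin (d v)) ℂ) (s : Conf d K) (r : Conf d Kᶜ)
    (y : FullConf d) :
    ∏ v, openAt K a a' G v (glue s r v) (y v) =
      if s = a' then ∏ v, G v (glue a r v) (y v) else 0 := by
  rw [prod_eq_prod_mem_mul K, prod_eq_prod_mem_mul K (fun v => G v (glue a r v) (y v))]
  have h1 : ∏ v : {v // v ∈ Kᶜ}, openAt K a a' G v (glue s r v) (y v) =
      ∏ v : {v // v ∈ Kᶜ}, G v (glue a r v) (y v) := by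
    refine Finset.prod_congr rfl fun v _ => ?_
    rw [glue_notMem, glue_notMem, openAt, dif_neg (Finset.mem_compl.1 v.2)]
  have h2 : ∏ v : {v // v ∈ K}, openAt K a a' G v (glue s r v) (y v) =
      ∏ v : {v // v ∈ K}, if a' v = s v then G v (glue a r v) (y v) else 0 := by
    refine Finset.prod_congr rfl fun v _ => ?_
    rw [glue_mem, glue_mem, openAt, dif_pos v.2]
    by_cases h : a' v = s v
    · rw [if_pos h, ← h, Matrix.single_mul_apply_same, one_mul]
    · rw [if_neg h]
      exact Matrix.single_mul_apply_of_ne _ _ _ _ _ (Ne.symm h) _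
  rw [h1, h2, Finset.prod_ite_zero]
  have h3 : (∀ v ∈ Finset.univ (α := {v // v ∈ K}), a' v = s v) ↔ s = a' := by
    rw [funext_iff]
    exact ⟨fun h v => (h v (Finset.mem_univ v)).symm, fun h v _ => (h v).symm⟩
  simp only [h3, ite_mul, zero_mul]

/-- Matrix units on the open sites read off the entries of the partial trace, so `nrm` is the
Hilbert-Schmidt norm of the post-measurement operator. -/
theorem reduced_tensorOp_mul (ρ : Matrix (FullConf d) (FullConf d) ℂ) (K : Finset V)
    (G : (v : V) → Matrix (Fin (d v)) (Fin (d v)) ℂ) (a a' : Conf d K) :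
    reduced (tensorOp G * ρ) K a a' = ev ρ (openAt K a a' G) := by
  unfold ev
  rw [← Equiv.sum_comp (glueEquiv K), Fintype.sum_prod_type]
  have h1 : ∀ (s : Conf d K) (r : Conf d Kᶜ) (y : FullConf d),
      (∏ v, openAt K a a' G v (glueEquiv K (s, r) v) (y v)) * ρ y (glueEquiv K (s, r)) =
        if s = a' then (∏ v, G v (glue a r v) (y v)) * ρ y (glue a' r) else 0 := by
    intro s r y
    change (∏ v, openAt K a a' G v (glue s r v) (y v)) * ρ y (glue s r) = _
    rw [openAt_apply]
    by_cases h : s = a'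
    · rw [if_pos h, if_pos h, h]
    · rw [if_neg h, if_neg h, zero_mul]
  simp only [h1]
  rw [Finset.sum_eq_single a']
  · simp only [if_true]
    rfl
  · intro s _ hs
    simp only [if_neg hs, Finset.sum_const_zero]
  · intro h; exact absurd (Finset.mem_univ a') h

/-- The measured operators as a family on all sites; the other sites have a single outcome. -/
def extended {R : V → Type*} (B : Finset V)
    (F : (v : V) → R v → Matrix (Fin (d v)) (Fin (d v)) ℂ) :
    (v : V) → (v ∈ B → R v) → Matrix (Fin (d v)) (Fin (d v)) ℂ :=
  fun v r => if h : v ∈ B then F v (r h) else 1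

variable {R : V → Type*} [∀ v, Fintype (R v)]
  {F : (v : V) → R v → Matrix (Fin (d v)) (Fin (d v)) ℂ}

/-- Outcomes at a measured site. -/
def siteEquiv {B : Finset V} {v : V} (hv : v ∈ B) : (v ∈ B → R v) ≃ R v where
  toFun r := r hv
  invFun r _ := r
  left_inv _ := rfl
  right_inv _ := rfl

theorem isPOVM_extended {B : Finset V} (hF : ∀ v ∈ B, IsPOVM (F v)) (v : V) :
    IsPOVM (extended B F v) := by
  by_cases hv : v ∈ B
  · have h1 : ∀ r, extended B F v r = F v (r hv) := fun r => by simp [extended, hv]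
    refine ⟨fun r => by rw [h1]; exact (hF v hv).posSemidef _, ?_⟩
    simp only [h1]
    rw [← (hF v hv).sum_eq_one]
    exact Equiv.sum_comp (siteEquiv hv) (F v)
  · have h1 : ∀ r, extended B F v r = 1 := fun r => by simp [extended, hv]
    refine ⟨fun r => by rw [h1]; exact Matrix.PosSemidef.one, ?_⟩
    have : IsEmpty (v ∈ B) := ⟨hv⟩
    simp only [h1]
    rw [Fintype.sum_unique]

theorem isTwoDesignPOVM_extended {B : Finset V} {v : V} (hv : v ∈ B)
    (hF₂ : IsTwoDesignPOVM (F v)) : IsTwoDesignPOVM (extended B F v) := by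
  have h1 : ∀ r, extended B F v r = F v (r hv) := fun r => by simp [extended, hv]
  have h2 : povmSecondMoment (extended B F v) = povmSecondMoment (F v) := by
    unfold povmSecondMoment
    simp only [h1]
    exact Equiv.sum_comp (siteEquiv hv) (fun r => (F v r).trace •
      (((F v r).trace⁻¹ • F v r) ⊗ₖ ((F v r).trace⁻¹ • F v r)))
  unfold IsTwoDesignPOVM
  rw [h2]
  exact hF₂

/-- Outcomes of the measured region as outcomes on all sites. -/
def outcomeEquiv (A C : Finset V) : Outcome R A C ≃ ((v : V) → (v ∈ bulk A C → R v)) where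
  toFun s v h := s ⟨v, h⟩
  invFun s v := s v.1 v.2
  left_inv _ := rfl
  right_inv _ := rfl

/-- The error bound is homogeneous in the state, so multiplying by the Born probability cancels the
normalization. Sites of `A` and `C` have the single operator `1` of weight one, so averaging there
changes nothing. -/
theorem avgError_le_phi [∀ v, Nonempty (Fin (d v))] {K : Type*} [Fintype K] [DecidableEq K]
    {d' : ℕ} (hd' : 0 < d')
    (Ψ : FullConf d → ℂ) (A C : Finset V) (L₀ : Matrix (Conf d A) (Fin d') ℂ)
    (hL₀ : L₀.conjTranspose * L₀ = 1) (p : K → ℝ) (U : K → Matrix (Conf d A) (Conf d A) ℂ)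
    (hU : IsUnitaryTwoDesign p U) :
    avgError Ψ F A C L₀ p U ≤
      Real.sqrt d' * phi (pureState Ψ) (extended (bulk A C) F) A (A ∪ C) ∅ := by
  unfold avgError phi
  rw [← Equiv.sum_comp (outcomeEquiv A C), Finset.mul_sum]
  refine Finset.sum_le_sum fun s _ => ?_
  have hmod : modified (extended (bulk A C) F) (A ∪ C) ∅ (outcomeEquiv A C s) =
      fun v => if h : v ∈ bulk A C then F v (s ⟨v, h⟩) else 1 := by
    funext v
    by_cases hv : v ∈ A ∪ C
    · have hv' : v ∉ bulk A C := fun h => Finset.mem_compl.1 h hv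
      have h1 : wt (extended (bulk A C) F) v (outcomeEquiv A C s v) = 1 := by
        have h2 : (d v : ℝ) ≠ 0 := by
          have := Fin.pos_iff_nonempty.2 (inferInstance : Nonempty (Fin (d v)))
          exact_mod_cast this.ne'
        have he : extended (bulk A C) F v (outcomeEquiv A C s v) = 1 := by
          rw [extended, dif_neg hv']
        rw [wt, he, Matrix.trace_one, Fintype.card_fin]
        simp [h2]
      rw [modified, if_pos hv, dif_neg hv', h1, Complex.ofReal_one, one_smul]
    · have hv' : v ∈ bulk A C := Finset.mem_compl.2 hv
      rw [modified, if_neg hv, if_neg (Finset.notMem_empty v), dif_pos hv', extended, dif_pos hv']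
      rfl
  have hpost : nrm (pureState Ψ) A (modified (extended (bulk A C) F) (A ∪ C) ∅
      (outcomeEquiv A C s)) = l2 fun q : Conf d A × Conf d A => postMeas Ψ F A C s q.1 q.2 := by
    unfold nrm
    congr 1
    funext q
    rw [hmod, postMeas, reduced_tensorOp_mul]
  rw [hpost]
  set X := postMeas Ψ F A C s
  set t := outcomeProb Ψ F A C s
  have herr := distillError_le hL₀ hd' hU (condState Ψ F A C s)
  have hl2 : l2 (fun q : Conf d A × Conf d A => condState Ψ F A C s q.1 q.2) =
      ‖((t : ℂ))⁻¹‖ * l2 fun q : Conf d A × Conf d A => X q.1 q.2 := l2_smul _ _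
  rw [hl2, norm_inv, Complex.norm_real, Real.norm_eq_abs] at herr
  have hX := l2_nonneg fun q : Conf d A × Conf d A => X q.1 q.2
  have hd0 := Real.sqrt_nonneg (d' : ℝ)
  -- Positivity of the Born probability is not needed: if `t ≤ 0`, the left side is nonpositive.
  rcases le_or_gt t 0 with ht | ht
  · exact (mul_nonpos_of_nonpos_of_nonneg ht (traceNorm_nonneg _)).trans (mul_nonneg hd0 hX)
  · rw [abs_of_pos ht] at herr
    calc _ ≤ t * (Real.sqrt d' * (t⁻¹ * l2 fun q : Conf d A × Conf d A => X q.1 q.2)) :=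
          mul_le_mul_of_nonneg_left herr ht.le
      _ = _ := by field_simp

end Main

end MIE

end

theorem lemma2 {V : Type*} [Fintype V] [DecidableEq V]
    -- the planar graph, contained in a plane triangulation of the same set of sites
    (Λ Λ' : SimpleGraph V) (hΛ : Λ ≤ Λ') (P : MIE.PlaneEmbedding Λ') (outer : P.Face)
    (hP : P.IsTriangulation outer)
    -- the regions; all other sites form the measured region
    (A C : Finset V) (hAC : Disjoint A C)
    (hA : (Λ'.induce (A : Set V)).Connected) (hC : (Λ'.induce (C : Set V)).Connected)
    -- the strictly local pure state
    (d : V → ℕ) (Ψ : MIE.FullConf d → ℂ) (hΨ : ∑ x, ‖Ψ x‖ ^ 2 = 1)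
    (hloc : MIE.StrictlyLocal Λ (MIE.pureState Ψ))
    -- the local measurements
    {R : V → Type*} [∀ v, Fintype (R v)]
    (F : (v : V) → R v → Matrix (Fin (d v)) (Fin (d v)) ℂ)
    (hF : ∀ v ∈ MIE.bulk A C, MIE.IsPOVM (F v))
    (hF₂ : ∀ v ∈ MIE.bulk A C, MIE.IsTwoDesignPOVM (F v))
    -- the random projections of rank `d'`
    {K : Type*} [Fintype K] [DecidableEq K] (d' : ℕ) (hd' : 0 < d')
    (L₀ : Matrix (MIE.Conf d A) (Fin d') ℂ) (hL₀ : L₀.conjTranspose * L₀ = 1)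
    (p : K → ℝ) (U : K → Matrix (MIE.Conf d A) (MIE.Conf d A) ℂ)
    (hU : MIE.IsUnitaryTwoDesign p U) :
    MIE.avgError Ψ F A C L₀ p U ≤
      Real.sqrt d' * MIE.zSAW P Ψ A C * MIE.f (MIE.zSAW P Ψ A C) := by
  -- A normalized state requires at least one configuration, so no site has dimension zero.
  have hdim : ∀ v, Nonempty (Fin (d v)) := by
    intro v
    obtain ⟨x⟩ : Nonempty (MIE.FullConf d) := by
      by_contra hcon
      rw [not_nonempty_iff] at hcon
      rw [Finset.univ_eq_empty, Finset.sum_empty] at hΨ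
      exact zero_ne_one hΨ
    exact ⟨x v⟩
  have hA' : A.Nonempty := by
    obtain ⟨a⟩ := hA.nonempty
    exact ⟨a.1, a.2⟩
  have hC' : C.Nonempty := by
    obtain ⟨c⟩ := hC.nonempty
    exact ⟨c.1, c.2⟩
  have h1 := MIE.avgError_le_phi (F := F) hd' Ψ A C L₀ hL₀ p U hU
  have h2 := MIE.phi_le_exp (F := MIE.extended (MIE.bulk A C) F) (MIE.isPOVM_extended hF) hΛ P hP
    hA' hC' hAC hA.preconnected hC.preconnected
    (fun v hvA hvC => by
      have hv : v ∈ MIE.bulk A C := by simp [MIE.bulk, hvA, hvC]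
      exact MIE.isTwoDesignPOVM_extended hv (hF₂ v hv)) hΨ hloc
  have h3 := MIE.sum_hsNorm_le_zSAW P hA' hC' Ψ
  -- At zero the convention `0/0 = 0` for `f` is harmless, since both sides vanish.
  have h4 : MIE.zSAW P Ψ A C * MIE.f (MIE.zSAW P Ψ A C) = Real.exp (MIE.zSAW P Ψ A C) - 1 := by
    unfold MIE.f
    by_cases h0 : MIE.zSAW P Ψ A C = 0
    · rw [h0]; simp
    · field_simp
  rw [mul_assoc, h4]
  refine h1.trans (mul_le_mul_of_nonneg_left (h2.trans ?_) (Real.sqrt_nonneg _))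
  exact sub_le_sub_right (Real.exp_le_exp.2 h3) 1
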